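/- **Setting.** Fix countably infinite sets of concept, role and individual names (identified with finite bit strings). Basic roles are $Q::=P\mid P^-$, basic concepts $B::=A\mid\exists Q$, and general concepts and roles are $C::=B\mid\neg B$, $R::=Q\mid\neg Q$. A fuzzy DL-Lite$_R$ ontology $\mathcal O=(\mathcal T,\mathcal A)$ consists of a finite set $\mathcal T$ of axioms $\langle B\sqsubseteq C,d\rangle$, $\langle Q\sqsubseteq R,d\rangle$ (the TBox) and a finite set $\mathcal A$ of assertions $\langle B(a),d\rangle$, $\langle P(a,b),d\rangle$ (the ABox), with rational degrees $d\in[0,1]$. A fuzzy interpretation $\mathcal I$ has a non-empty domain and interprets individual names by elements and concept and role names by unary and binary relations with values in the real interval $[0,1]$. It is extended under the Gödel semantics ("G-DL-Lite$_R$"): $\otimes=\min$; $d\Rightarrow e$ is $1$ if $d\le e$ and $e$ otherwise; $\ominus d=d\Rightarrow 0$; $(\exists Q)^{\mathcal I}(\delta)=\sup_{\delta'}Q^{\mathcal I}(\delta,\delta')$; $(P^-)^{\mathcal I}(\delta,\eta)=P^{\mathcal I}(\eta,\delta)$; negation is $\ominus$. It satisfies $\langle B\sqsubseteq C,d\rangle$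 if $B^{\mathcal I}(\delta)\Rightarrow C^{\mathcal I}(\delta)\ge d$ for all $\delta$ (similarly for roles), and $\langle B(a),d\rangle$ if $B^{\mathcal I}(a^{\mathcal I})\ge d$ (similarly for roles). A model of $\mathcal O$ satisfies all its axioms and assertions; $\mathcal O$ is consistent if it has a model. A conjunctive query (CQ) $q(\mathbf x)=\exists\mathbf y.\,\varphi(\mathbf x,\mathbf y)$ is a finite conjunction of atoms $B(t)$, $P(t_1,t_2)$ over variables from $\mathbf x,\mathbf y$ and individual names. For a tuple $\mathbf a$ of individual names, $q^{\mathcal I}(\mathbf a)$ is the supremum, over all assignments of domain elements to $\mathbf y$, of the minimum of the degrees of the atoms. Write $\mathcal O\models q(\mathbf a)\ge d$ if $q^{\mathcal I}(\mathbf a)\ge d$ in every model $\mathcal I$ of $\mathcal O$. The degree of the answer $\mathbf a$ is the $d\in[0,1]$ with $\mathcal O\models q(\mathbf a)\ge d$ and $\mathcal O\not\models q(\mathbf a)\ge d'$ for all $d'>d$. A list of top-$k$ answers is a list of $k$ distinct tuples (all tuples, if there are fewer than $k$) with their degrees, such that no unlisted tuple has a degree larger than that of a listed one. "Computable in logarithmic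 space" means: by a deterministic Turing machine with a two-way read-only input tape, a fixed number of work tapes and a write-only output tape, which halts on every input string of length $n$ after visiting only $O(\log n)$ work tape cells. ABoxes are encoded as lists of assertions, names as bit strings, and degrees by numerator and denominator in binary. **Statement.** Fix a TBox $\mathcal T$ and a CQ $q(\mathbf x)$. 1. The degree of the answer $\mathbf a$ to $q$ w.r.t. $(\mathcal T,\mathcal A)$ is computable in logarithmic space, where the input consists of $\mathcal A$ and $\mathbf a$, and $(\mathcal T,\mathcal A)$ is promised to be consistent. 2. This degree is returned by the following method, for every consistent $\mathcal O=(\mathcal T,\mathcal A)$. Let $1=d_{m}>\dots>d_0=0$ be the degrees occurring in $\mathcal O$ together with $0$ and $1$. For $\theta>0$ let $\widehat{\mathcal O}_{\ge\theta}$ be the classical ontology consisting of the axioms and assertions of $\mathcal O$ that have degree at least $\theta$, with the degrees dropped. For $i=m,m-1,\dots,1$ test whether the classical entailment $\widehat{\mathcal O}_{\ge d_i}\models q(\mathbf a)$ holds, i.e. whether $q(\mathbf a)$ holds in all classical ($\{0,1\}$-valued) models; return the first $d_i$ for which it does, and $0$ if there is none. 3. For every $k\in\mathbb N$, a list of top-$k$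 answers to $q$ w.r.t. $(\mathcal T,\mathcal A)$ is computable in logarithmic space, where the input is $\mathcal A$, and $(\mathcal T,\mathcal A)$ is promised to be consistent. -/

import Mathlib

/-! ## Syntax of fuzzy DL-Lite_R -/

/-- Concept names, role names and individual names are finite bit strings (three separate copies;
they never mix, because every syntactic position has a fixed sort). -/
abbrev ConceptName := List Bool
abbrev RoleName := List Bool
abbrev IndName := List Bool

/-- Degrees that occur in ontologies: rational numbers in `[0,1]`, so that an ABox is a finite
object. Interpretations use all real degrees. -/
abbrev Degree : Type := Set.Icc (0 : ℚ) 1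

/-- A rational degree, seen in the real unit interval. -/
def toUnit (d : Degree) : unitInterval :=
  ⟨((d : ℚ) : ℝ), by exact_mod_cast d.2.1, by exact_mod_cast d.2.2⟩

/-- Basic roles `Q ::= P | P⁻`. -/
inductive BasicRole
  | name (P : RoleName)
  | inv (P : RoleName)
  deriving DecidableEq

/-- Basic concepts `B ::= A | ∃Q`. -/
inductive BasicConcept
  | name (A : ConceptName)
  | ex (Q : BasicRole)
  deriving DecidableEq

/-- General concepts `C ::= B | ¬B`. -/
inductive GenConcept
  | pos (B : BasicConcept)
  | neg (B : BasicConcept)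
  deriving DecidableEq

/-- General roles `R ::= Q | ¬Q`. -/
inductive GenRole
  | pos (Q : BasicRole)
  | neg (Q : BasicRole)
  deriving DecidableEq

/-- TBox axioms `⟨B ⊑ C, d⟩` and `⟨Q ⊑ R, d⟩`. -/
inductive FuzzyAxiom
  | concept (B : BasicConcept) (C : GenConcept) (d : Degree)
  | role (Q : BasicRole) (R : GenRole) (d : Degree)
  deriving DecidableEq

/-- ABox assertions `⟨B(a), d⟩` and `⟨P(a,b), d⟩`. -/
inductive Assertion
  | concept (B : BasicConcept) (a : IndName) (d : Degree)
  | role (P : RoleName) (a b : IndName) (d : Degree)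
  deriving DecidableEq

def FuzzyAxiom.degree : FuzzyAxiom → Degree
  | .concept _ _ d => d
  | .role _ _ d => d

def Assertion.degree : Assertion → Degree
  | .concept _ _ d => d
  | .role _ _ _ d => d

/-- The same axiom with degree `1`, that is, the classical axiom. -/
def FuzzyAxiom.toClassical : FuzzyAxiom → FuzzyAxiom
  | .concept B C _ => .concept B C 1
  | .role Q R _ => .role Q R 1

/-- The same assertion with degree `1`, that is, the classical assertion. -/
def Assertion.toClassical : Assertion → Assertion
  | .concept B a _ => .concept B a 1
  | .role P a b _ => .role P a b 1

/-- A fuzzy DL-Lite_R ontology: a finite TBox and a finite ABox. -/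
structure Ontology where
  tbox : Finset FuzzyAxiom
  abox : Finset Assertion

/-! ## Gödel semantics -/

/-- The residuum of the Gödel t-norm (the t-norm itself is `min`). -/
noncomputable def godelImp (d e : unitInterval) : unitInterval := if d ≤ e then 1 else e

/-- Gödel negation. -/
noncomputable def godelNeg (d : unitInterval) : unitInterval := godelImp d 0

/-- Fuzzy interpretations. -/
structure Interpretation where
  Dom : Type
  nonempty : Nonempty Dom
  ind : IndName → Dom
  con : ConceptName → Dom → unitInterval
  rol : RoleName → Dom → Dom → unitInterval

namespace Interpretation

variable (I : Interpretation)

def basicRole : BasicRole → I.Dom → I.Dom → unitInterval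
  | .name P, x, y => I.rol P x y
  | .inv P, x, y => I.rol P y x

noncomputable def basicConcept : BasicConcept → I.Dom → unitInterval
  | .name A, x => I.con A x
  | .ex Q, x => ⨆ y : I.Dom, I.basicRole Q x y

noncomputable def genConcept : GenConcept → I.Dom → unitInterval
  | .pos B, x => I.basicConcept B x
  | .neg B, x => godelNeg (I.basicConcept B x)

noncomputable def genRole : GenRole → I.Dom → I.Dom → unitInterval
  | .pos Q, x, y => I.basicRole Q x y
  | .neg Q, x, y => godelNeg (I.basicRole Q x y)

def SatisfiesAxiom : FuzzyAxiom → Prop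
  | .concept B C d => ∀ x, toUnit d ≤ godelImp (I.basicConcept B x) (I.genConcept C x)
  | .role Q R d => ∀ x y, toUnit d ≤ godelImp (I.basicRole Q x y) (I.genRole R x y)

def SatisfiesAssertion : Assertion → Prop
  | .concept B a d => toUnit d ≤ I.basicConcept B (I.ind a)
  | .role P a b d => toUnit d ≤ I.rol P (I.ind a) (I.ind b)

def IsModel (O : Ontology) : Prop :=
  (∀ τ ∈ O.tbox, I.SatisfiesAxiom τ) ∧ (∀ α ∈ O.abox, I.SatisfiesAssertion α)

/-- Classical interpretations are those that only use the degrees `0` and `1`. -/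
def IsClassical : Prop :=
  (∀ A x, I.con A x = 0 ∨ I.con A x = 1) ∧ (∀ P x y, I.rol P x y = 0 ∨ I.rol P x y = 1)

end Interpretation

def Ontology.Consistent (O : Ontology) : Prop := ∃ I : Interpretation, I.IsModel O

/-! ## Conjunctive queries -/

/-- Terms over `n` answer variables and `m` existential variables. -/
inductive Term (n m : ℕ)
  | ans (i : Fin n)
  | ex (j : Fin m)
  | ind (a : IndName)
  deriving DecidableEq

/-- Query atoms `B(t)` and `P(t₁,t₂)`. -/
inductive QAtom (n m : ℕ)
  | concept (B : BasicConcept) (t : Term n m)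
  | role (P : RoleName) (t₁ t₂ : Term n m)
  deriving DecidableEq

/-- A conjunctive query `∃ y₁ … y_m. φ(x₁, …, x_n, y₁, …, y_m)`, given by the set of its atoms. -/
structure CQ (n : ℕ) where
  m : ℕ
  atoms : Finset (QAtom n m)

namespace CQ

variable {n : ℕ} (q : CQ n) (I : Interpretation)

/-- The match that sends `x` to `a` and `y` to `π`. -/
def termValue (a : Fin n → IndName) (π : Fin q.m → I.Dom) : Term n q.m → I.Dom
  | .ans i => I.ind (a i)
  | .ex j => π j
  | .ind b => I.ind b

noncomputable def atomValue (a : Fin n → IndName) (π : Fin q.m → I.Dom) :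
    QAtom n q.m → unitInterval
  | .concept B t => I.basicConcept B (q.termValue I a π t)
  | .role P t₁ t₂ => I.rol P (q.termValue I a π t₁) (q.termValue I a π t₂)

/-- The degree of the query under a match: the Gödel t-norm (minimum) of the degrees of its atoms;
the empty conjunction has degree `1`. -/
noncomputable def matchDegree (a : Fin n → IndName) (π : Fin q.m → I.Dom) : unitInterval :=
  q.atoms.inf (q.atomValue I a π)

/-- The degree of the tuple `a` in the interpretation: the supremum over all matches. -/
noncomputable def degreeIn (a : Fin n → IndName) : unitInterval :=
  ⨆ π : Fin q.m → I.Dom, q.matchDegree I a π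

end CQ

/-- `O ⊨ q(a) ≥ d`. -/
def Ontology.EntailsGE (O : Ontology) {n : ℕ} (q : CQ n) (a : Fin n → IndName)
    (d : unitInterval) : Prop :=
  ∀ I : Interpretation, I.IsModel O → d ≤ q.degreeIn I a

/-- The set `ans(q, O)` of certain answers with their degrees. -/
def CQ.answers {n : ℕ} (q : CQ n) (O : Ontology) : Set ((Fin n → IndName) × unitInterval) :=
  {p | O.EntailsGE q p.1 p.2 ∧ ∀ d, p.2 < d → ¬ O.EntailsGE q p.1 d}

/-- `l` lists `k` distinct answers of highest degree with their degrees (or all answers, if there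
are fewer than `k`). Ties at the lowest listed degree may be broken arbitrarily. -/
structure IsTopK {n : ℕ} (q : CQ n) (O : Ontology) (k : ℕ)
    (l : List ((Fin n → IndName) × Degree)) : Prop where
  nodup : (l.map Prod.fst).Nodup
  mem_answers : ∀ p ∈ l, (p.1, toUnit p.2) ∈ q.answers O
  length_le : l.length ≤ k
  exhaustive : l.length < k → ∀ a : Fin n → IndName, a ∈ l.map Prod.fst
  best : ∀ p ∈ l, ∀ r ∈ q.answers O, r.1 ∉ l.map Prod.fst → r.2 ≤ toUnit p.2

/-! ## Cuts, classical versions, and the iterative method -/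

/-- The `θ`-cut: only the axioms and assertions of degree at least `θ`. -/
def Ontology.cut (O : Ontology) (θ : Degree) : Ontology where
  tbox := O.tbox.filter fun τ => θ ≤ τ.degree
  abox := O.abox.filter fun α => θ ≤ α.degree

/-- The classical version: the axioms and assertions of positive degree, without their degrees
(that is, all with degree `1`). -/
def Ontology.classical (O : Ontology) : Ontology where
  tbox := (O.tbox.filter fun τ => 0 < τ.degree).image FuzzyAxiom.toClassical
  abox := (O.abox.filter fun α => 0 < α.degree).image Assertion.toClassical

/-- Classical certain answers: the query holds at `a` in all classical models. -/
def Ontology.ClassicallyEntails (O : Ontology) {n : ℕ} (q : CQ n) (a : Fin n → IndName) : Prop :=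
  ∀ I : Interpretation, I.IsClassical → I.IsModel O → q.degreeIn I a = 1

/-- The degrees that occur in the ontology, together with `0` and `1`. -/
def Ontology.degrees (O : Ontology) : Finset Degree :=
  {0, 1} ∪ (O.tbox.image FuzzyAxiom.degree ∪ O.abox.image Assertion.degree)

open Classical in
/-- Go through a list of degrees; return the first degree whose classical cut ontology entails
`q(a)`, or the last degree of the list. -/
noncomputable def degreeLoop (O : Ontology) {n : ℕ} (q : CQ n) (a : Fin n → IndName) :
    List Degree → Degree
  | [] => 0
  | [d] => d
  | d :: e :: l =>
    if (O.cut d).classical.ClassicallyEntails q a then d else degreeLoop O q a (e :: l)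

/-- The iterative method: query the classical versions of the cuts, from the highest degree down,
until the query is answered affirmatively or the degree `0` is reached. -/
noncomputable def iterativeDegree (O : Ontology) {n : ℕ} (q : CQ n) (a : Fin n → IndName) :
    Degree :=
  degreeLoop O q a (O.degrees.sort (· ≥ ·))

/-! ## Turing machines with a read-only input and a write-only output -/

inductive Move
  | left
  | stay
  | right

/-- What the input head sees: an input symbol or one of the two end markers. -/
inductive InputCell (α : Type)
  | leftEnd
  | sym (s : α)
  | rightEnd

/-- A deterministic Turing transducer: a two-way read-only input tape over `α` delimited by end
markers, `k` read-write work tapes (infinite to the right) over a finite alphabet, and a one-way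
write-only output tape over `β`. A step may change the state, move the input head, write on and move
on every work tape, and append one output symbol. The machine halts when no step is defined. -/
structure Transducer (α β : Type) where
  State : Type
  finState : Finite State
  Γ : Type
  finΓ : Finite Γ
  k : ℕ
  blank : Γ
  start : State
  step : State → InputCell α → (Fin k → Γ) →
    Option (State × Move × (Fin k → Γ × Move) × Option β)

namespace Transducer

variable {α β : Type} (M : Transducer α β)

/-- Input position `0` is the left end marker, position `x.length + 1` the right one. -/
structure Config where
  state : M.State
  inPos : ℕ
  tape : Fin M.k → ℕ → M.Γ
  head : Fin M.k → ℕ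
  out : List β

def init : M.Config where
  state := M.start
  inPos := 0
  tape := fun _ _ => M.blank
  head := fun _ => 0
  out := []

def readInput (x : List α) : ℕ → InputCell α
  | 0 => .leftEnd
  | p + 1 =>
    match x[p]? with
    | some s => .sym s
    | none => .rightEnd

/-- A head at cell `0` that is told to move left stays where it is. -/
def moveHead : Move → ℕ → ℕ
  | .left, p => p - 1
  | .stay, p => p
  | .right, p => p + 1

def stepConfig (x : List α) (c : M.Config) : Option M.Config :=
  (M.step c.state (readInput x c.inPos) (fun i => c.tape i (c.head i))).map
    fun r =>
      { state := r.1
        inPos := min (moveHead r.2.1 c.inPos) (x.length + 1)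
        tape := fun i => Function.update (c.tape i) (c.head i) (r.2.2.1 i).1
        head := fun i => moveHead (r.2.2.1 i).2 (c.head i)
        out := c.out ++ r.2.2.2.toList }

/-- The configurations in the run of the machine on input `x`. -/
def Reaches (x : List α) (c : M.Config) : Prop :=
  Relation.ReflTransGen (fun c₁ c₂ => M.stepConfig x c₁ = some c₂) M.init c

/-- On input `x` the machine halts with output `y`. -/
def Outputs (x : List α) (y : List β) : Prop :=
  ∃ c, M.Reaches x c ∧ M.stepConfig x c = none ∧ c.out = y

/-- The machine halts on every input and visits only `O(log |x|)` cells of its work tapes. -/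
def RunsInLogSpace : Prop :=
  ∃ C : ℕ, ∀ x : List α,
    (∃ y, M.Outputs x y) ∧
      ∀ c, M.Reaches x c → ∀ i, c.head i < C * Nat.log 2 x.length + C

end Transducer

/-- A search problem with instances `X`, promise `P`, solutions `Y` and solution relation `R` is
solvable in logarithmic space (with respect to the given encodings as strings over finite alphabets): some log-space
Turing transducer outputs a solution on each instance that satisfies the promise. -/
def SolvableInLogSpace {X Y α β : Type} [Finite α] [Finite β] (encX : X → List α) (encY : Y → List β)
    (P : X → Prop) (R : X → Y → Prop) : Prop :=
  ∃ M : Transducer α β, M.RunsInLogSpace ∧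
    ∀ x, P x → ∃ y, R x y ∧ M.Outputs (encX x) (encY y)

/-! ## String encodings of ABoxes, tuples and degrees -/

inductive Letter
  | bit (b : Bool)
  | sep
  | nameTag
  | exTag
  | exInvTag
  | roleTag
  | tupleTag
  | degreeTag
  deriving DecidableEq, Fintype

def encodeName (w : List Bool) : List Letter := w.map Letter.bit

/-- Numerator and denominator (in lowest terms) in binary, least significant bit first. -/
def encodeDegree (d : Degree) : List Letter :=
  encodeName (d : ℚ).num.toNat.bits ++ Letter.sep :: encodeName (d : ℚ).den.bits

def encodeBasicConcept : BasicConcept → List Letter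
  | .name A => Letter.nameTag :: encodeName A
  | .ex (.name P) => Letter.exTag :: encodeName P
  | .ex (.inv P) => Letter.exInvTag :: encodeName P

def encodeAssertion : Assertion → List Letter
  | .concept B a d => encodeBasicConcept B ++ Letter.sep :: encodeName a ++ Letter.sep :: encodeDegree d
  | .role P a b d => Letter.roleTag :: encodeName P ++ Letter.sep :: encodeName a ++
      Letter.sep :: encodeName b ++ Letter.sep :: encodeDegree d

/-- An ABox is written down by listing its assertions in any order. -/
def encodeABox (L : List Assertion) : List Letter := L.flatMap encodeAssertion

def encodeTuple {n : ℕ} (a : Fin n → IndName) : List Letter :=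
  (List.ofFn a).flatMap fun w => Letter.tupleTag :: encodeName w

def encodeAnswers {n : ℕ} (l : List ((Fin n → IndName) × Degree)) : List Letter :=
  l.flatMap fun p => encodeTuple p.1 ++ Letter.degreeTag :: encodeDegree p.2

/-! Semantics. The degree of an answer is the greatest degree θ of the ontology whose classical cut
entails q(a), or 0. If I is a fuzzy model and t < θ, then "degree greater than t" defines a
classical model of the cut at θ (`Interpretation.above`); since strict cuts commute with suprema and
finite minima, entailment by the cut forces q(a) to have degree at least θ in I. Conversely, let r
be 0 or a degree whose cut entails q(a), and suppose that no greater degree has this property. Let s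
be the next degree of the ontology, J a classical countermodel for the cut at s, and K any fuzzy
model. On the product of K and J keep the degrees of K wherever J agrees, and lower them to at most
r elsewhere (`Interpretation.combine`). Axioms and assertions of degree at most r survive the
lowering, those above r survive because J satisfies them, negative axioms are inherited from K, and
q(a) gets degree at most r. This is `mem_answers`; the iterative method and both algorithms rest on
it.

Complexity. No query rewriting is constructed. Positive inclusions have a single premise, so in the
presence of a model every certain answer already follows from at most one fact for each query atom
(`Entails.exists_range`). It therefore suffices to try all choices of that many positions in the
input. Entailment from a fixed number of facts is invariant under renaming (`Entails.map`), so it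
depends only on a finite pattern: the predicates of the facts, the coincidences between names, and
the comparisons of degrees with the threshold. For a fixed TBox and query there are finitely many
patterns, and the verdict on each of them is a constant that is built into the machine
(`LP.of_determined`).

Machines. Turing machine fragments implement binary counters, and these implement register programs
whose counters are linear in the input length (`LogSpace.exists_transducer`). On top of them stands
`LFO`, a class of functions that is closed under linearly bounded recursion and hence under bounded
quantifiers and searches. Its programs nest because the arguments lie in registers below `b`, the
result goes to `b`, and everything above is scratch. Degrees are too large for counters; they are
handled digit by digit and compared by cross multiplication (`BN.mul`).

Top-k. There are infinitely many tuples, but replacing names that occur neither in the ABox nor in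
the query does not lower a degree. A finite pool of names with k·n + 1 new ones is thus enough, and
the machine searches for pointers into this pool. -/

/-! ## Fragments of Turing machines -/

namespace LogSpace

open Relation Transducer

/-- The work tape alphabet of the machines built here. -/
abbrev Sym := Option (Option Bool)

abbrev Sym.dig (b : Bool) : Sym := some (some b)

abbrev Sym.mark : Sym := some none

abbrev Sym.blank : Sym := none

/-- The data of a configuration, without the control state. -/
structure Data (β : Type) (k : ℕ) where
  pos : ℕ
  tape : Fin k → ℕ → Sym
  head : Fin k → ℕ
  out : List β

abbrev Action (β : Type) (k : ℕ) := Move × (Fin k → Sym × Move) × Option β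

variable {α β : Type} {k : ℕ}

namespace Data

def act (x : List α) (d : Data β k) (a : Action β k) : Data β k where
  pos := min (moveHead a.1 d.pos) (x.length + 1)
  tape i := Function.update (d.tape i) (d.head i) (a.2.1 i).1
  head i := moveHead (a.2.1 i).2 (d.head i)
  out := d.out ++ a.2.2.toList

def scan (d : Data β k) : Fin k → Sym := fun i => d.tape i (d.head i)

def Good (x : List α) (L : ℕ) (d : Data β k) : Prop :=
  d.pos ≤ x.length + 1 ∧ ∀ i, d.head i < L

end Data

/-- The action that changes nothing, given the scanned symbols. -/
def idle (s : Fin k → Sym) : Action β k := (.stay, fun i => (s i, .stay), none)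

/-- Every step clips the input position at `x.length + 1`, so standing still is the identity only if
the position is already in range. -/
theorem Data.act_idle {x : List α} {L : ℕ} {d : Data β k} (h : d.Good x L) :
    d.act x (idle d.scan) = d := by
  cases d
  simp only [Data.Good] at h
  simp [Data.act, idle, moveHead, Data.scan, h.1]

/-- A machine without initialisation: it starts on arbitrary tape contents. -/
structure Frag (α β : Type) (k : ℕ) where
  Q : Type
  fin : Finite Q
  start : Q
  step : Q → InputCell α → (Fin k → Sym) → Option (Q × Action β k)

namespace Frag

def next (F : Frag α β k) (x : List α) (c : F.Q × Data β k) : Option (F.Q × Data β k) :=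
  (F.step c.1 (readInput x c.2.pos) c.2.scan).map fun r => (r.1, c.2.act x r.2)

/-- The space bound is demanded of the source of each step; the last configuration receives it from
`Runs`. -/
def Path (F : Frag α β k) (x : List α) (L : ℕ) : F.Q × Data β k → F.Q × Data β k → Prop :=
  ReflTransGen fun c c' => F.next x c = some c' ∧ c.2.Good x L

/-- Started on `d`, the fragment halts with `d'`, all heads staying below `L`. -/
def Runs (F : Frag α β k) (x : List α) (L : ℕ) (d d' : Data β k) : Prop :=
  d'.Good x L ∧ ∃ q, F.Path x L (F.start, d) (q, d') ∧
    F.step q (readInput x d'.pos) d'.scan = none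

variable {F G : Frag α β k} {x : List α} {L : ℕ} {d d₁ d₂ : Data β k}

theorem Path.good_left {c c' : F.Q × Data β k} (h : F.Path x L c c') (h' : c'.2.Good x L) :
    c.2.Good x L := by
  rcases ReflTransGen.cases_head h with rfl | ⟨_, h, _⟩
  · exact h'
  · exact h.2

theorem Runs.good_left (h : F.Runs x L d d₁) : d.Good x L := by
  obtain ⟨h1, q, h2, -⟩ := h
  exact h2.good_left h1

/-- Serves to embed the control of a fragment into that of a compound fragment. -/
theorem Path.lift {H : Frag α β k} {q q' : F.Q} (p : F.Path x L (q, d) (q', d₁)) (f : F.Q → H.Q)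
    (hf : ∀ q c s r, F.step q c s = some r → H.step (f q) c s = some (f r.1, r.2)) :
    H.Path x L (f q, d) (f q', d₁) := by
  refine ReflTransGen.lift (fun c : F.Q × Data β k => ((f c.1, c.2) : H.Q × _)) ?_ _ _ p
  rintro ⟨q, e⟩ ⟨q', e'⟩ ⟨h, hg⟩
  refine ⟨?_, hg⟩
  simp only [next, Option.map_eq_some_iff] at h ⊢
  obtain ⟨r, h1, h2⟩ := h
  refine ⟨_, hf _ _ _ _ h1, ?_⟩
  simp only [Prod.mk.injEq] at h2 ⊢
  exact ⟨by rw [h2.1], h2.2⟩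

/-- One step that performs the action computed by `f`. -/
def one (f : (Fin k → Sym) → Action β k) : Frag α β k where
  Q := Bool
  fin := inferInstance
  start := false
  step q _ s := if q then none else some (true, f s)

theorem one_runs {f : (Fin k → Sym) → Action β k} (h : d.Good x L)
    (h' : (d.act x (f d.scan)).Good x L) :
    (one f : Frag α β k).Runs x L d (d.act x (f d.scan)) :=
  ⟨h', true, ReflTransGen.single ⟨by simp [next, one], h⟩, by simp [one]⟩

def seq (F G : Frag α β k) : Frag α β k where
  Q := F.Q ⊕ G.Q
  fin := by have := F.fin; have := G.fin; infer_instance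
  start := .inl F.start
  step q c s :=
    match q with
    | .inl q =>
      match F.step q c s with
      | some r => some (.inl r.1, r.2)
      | none => some (.inr G.start, idle s)
    | .inr q => (G.step q c s).map fun r => (.inr r.1, r.2)

theorem seq_runs (h₁ : F.Runs x L d d₁) (h₂ : G.Runs x L d₁ d₂) :
    (F.seq G).Runs x L d d₂ := by
  obtain ⟨g1, q1, p1, e1⟩ := h₁
  obtain ⟨g2, q2, p2, e2⟩ := h₂
  refine ⟨g2, .inr q2, ?_, by simp [seq, e2]⟩
  have a1 : (F.seq G).Path x L (.inl F.start, d) (.inl q1, d₁) := 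
    p1.lift (H := F.seq G) Sum.inl (by intro q c s r h; simp [seq, h])
  have a2 : (F.seq G).Path x L (.inr G.start, d₁) (.inr q2, d₂) := 
    p2.lift (H := F.seq G) Sum.inr (by intro q c s r h; simp [seq, h])
  refine (a1.tail ⟨?_, g1⟩).trans a2
  simp [next, seq, e1, Data.act_idle g1]

/-- Tests of the scanned symbols. -/
abbrev TestFn (α : Type) (k : ℕ) := InputCell α → (Fin k → Sym) → Bool

def ite (t : TestFn α k) (F G : Frag α β k) : Frag α β k where
  Q := Option (F.Q ⊕ G.Q)
  fin := by have := F.fin; have := G.fin; infer_instance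
  start := none
  step q c s :=
    match q with
    | none => some (some (if t c s then .inl F.start else .inr G.start), idle s)
    | some (.inl q) => (F.step q c s).map fun r => (some (.inl r.1), r.2)
    | some (.inr q) => (G.step q c s).map fun r => (some (.inr r.1), r.2)

theorem ite_runs_true {t : TestFn α k} (ht : t (readInput x d.pos) d.scan = true)
    (h₁ : F.Runs x L d d₁) : (ite t F G).Runs x L d d₁ := by
  have g0 := h₁.good_left
  obtain ⟨g1, q1, p1, e1⟩ := h₁
  refine ⟨g1, some (.inl q1), ?_, by simp [ite, e1]⟩
  have a1 : (ite t F G).Path x L (some (.inl F.start), d) (some (.inl q1), d₁) := 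
    p1.lift (H := ite t F G) (fun q => some (Sum.inl q)) (by intro q c s r h; simp [ite, h])
  refine ReflTransGen.head ⟨?_, g0⟩ a1
  simp [next, ite, ht, Data.act_idle g0]

theorem ite_runs_false {t : TestFn α k} (ht : t (readInput x d.pos) d.scan = false)
    (h₁ : G.Runs x L d d₁) : (ite t F G).Runs x L d d₁ := by
  have g0 := h₁.good_left
  obtain ⟨g1, q1, p1, e1⟩ := h₁
  refine ⟨g1, some (.inr q1), ?_, by simp [ite, e1]⟩
  have a1 : (ite t F G).Path x L (some (.inr G.start), d) (some (.inr q1), d₁) := 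
    p1.lift (H := ite t F G) (fun q => some (Sum.inr q)) (by intro q c s r h; simp [ite, h])
  refine ReflTransGen.head ⟨?_, g0⟩ a1
  simp [next, ite, ht, Data.act_idle g0]

def loop (t : TestFn α k) (F : Frag α β k) : Frag α β k where
  Q := Option F.Q
  fin := by have := F.fin; infer_instance
  start := none
  step q c s :=
    match q with
    | none => if t c s then some (some F.start, idle s) else none
    | some q =>
      match F.step q c s with
      | some r => some (some r.1, r.2)
      | none => some (none, idle s)

theorem loop_runs_false {t : TestFn α k} (hg : d.Good x L)
    (ht : t (readInput x d.pos) d.scan = false) : (loop t F).Runs x L d d :=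
  ⟨hg, none, .refl, by simp [loop, ht]⟩

theorem loop_runs_true {t : TestFn α k} (ht : t (readInput x d.pos) d.scan = true)
    (h₁ : F.Runs x L d d₁) (h₂ : (loop t F).Runs x L d₁ d₂) : (loop t F).Runs x L d d₂ := by
  have g0 := h₁.good_left
  obtain ⟨g1, q1, p1, e1⟩ := h₁
  obtain ⟨g2, q2, p2, e2⟩ := h₂
  refine ⟨g2, q2, ?_, e2⟩
  have a1 : (loop t F).Path x L (some F.start, d) (some q1, d₁) := 
    p1.lift (H := loop t F) some (by intro q c s r h; simp [loop, h])
  have a0 : (loop t F).next x (none, d) = some (some F.start, d) := by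
    simp [next, loop, ht, Data.act_idle g0]
  have a2 : (loop t F).next x (some q1, d₁) = some (none, d₁) := by
    simp [next, loop, e1, Data.act_idle g1]
  exact (ReflTransGen.head ⟨a0, g0⟩ (a1.tail ⟨a2, g1⟩)).trans p2

/-- The transducer with the control of a fragment. -/
def toTransducer (F : Frag α β k) : Transducer α β where
  State := F.Q
  finState := F.fin
  Γ := Sym
  finΓ := inferInstance
  k := k
  blank := Sym.blank
  start := F.start
  step := F.step

def toConfig (F : Frag α β k) (c : F.Q × Data β k) : F.toTransducer.Config where
  state := c.1
  inPos := c.2.pos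
  tape := c.2.tape
  head := c.2.head
  out := c.2.out

theorem stepConfig_toConfig (c : F.Q × Data β k) :
    F.toTransducer.stepConfig x (F.toConfig c) = (F.next x c).map F.toConfig := by
  simp only [stepConfig, next, Option.map_map]
  rfl

/-- The machine is deterministic, so every reachable configuration lies on the one halting path,
along which all heads stay below `L`. -/
theorem runs_reaches (h : F.Runs x L ⟨0, fun _ _ => Sym.blank, fun _ => 0, []⟩ d) :
    F.toTransducer.Outputs x d.out ∧
      ∀ c, F.toTransducer.Reaches x c → ∀ i, c.head i < L := by
  obtain ⟨hg, q, p, e⟩ := h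
  have halt : F.toTransducer.stepConfig x (F.toConfig (q, d)) = none := by
    rw [stepConfig_toConfig]; simp [next, e]
  constructor
  · refine ⟨F.toConfig (q, d), ?_, halt, rfl⟩
    refine ReflTransGen.lift F.toConfig ?_ _ _ p
    intro c c' h
    simp only [Function.onFun]
    rw [stepConfig_toConfig, h.1]; rfl
  · have key : ∀ c, F.Path x L c (q, d) → ∀ c', ReflTransGen
        (fun c₁ c₂ => F.toTransducer.stepConfig x c₁ = some c₂) (F.toConfig c) c' →
        ∀ i, c'.head i < L := by
      intro c hc
      induction hc using ReflTransGen.head_induction_on with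
      | refl =>
        intro c' h
        rcases ReflTransGen.cases_head h with rfl | ⟨b, h, -⟩
        · exact hg.2
        · rw [halt] at h; cases h
      | head h1 _ ih =>
        intro c' h
        rcases ReflTransGen.cases_head h with rfl | ⟨b, h2, h3⟩
        · exact h1.2.2
        · rw [stepConfig_toConfig, h1.1] at h2
          cases h2
          exact ih _ h3
    exact fun c hc => key _ p c hc

end Frag

end LogSpace

namespace LogSpace

open Relation Transducer

variable {α β : Type} {k : ℕ}

/-! ## Binary counters on work tapes -/

theorem length_bits (v : ℕ) : v.bits.length = v.size := Nat.size_eq_bits_len v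

/-- Binary increment, least significant digit first: the initial ones become zeros, and the zero or
blank behind them becomes a one. The clause `z ≠ [false]` says that there is no leading zero; the
decrement needs it to recognise whether the digit that it clears is the top one. -/
theorem bits_succ_eq (v : ℕ) : ∃ (j : ℕ) (z : List Bool), z.head? ≠ some true ∧ z ≠ [false] ∧
    v.bits = List.replicate j true ++ z ∧
    (v + 1).bits = List.replicate j false ++ true :: z.tail := by
  induction v using Nat.strong_induction_on with
  | _ v ih =>
    obtain ⟨m, rfl | rfl⟩ := Nat.even_or_odd' v
    · rcases Nat.eq_zero_or_pos m with rfl | hm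
      · exact ⟨0, [], by simp, by simp, by simp, by simp⟩
      · refine ⟨0, (2 * m).bits, ?_, ?_, by simp, ?_⟩
        · rw [Nat.bit0_bits m (by omega)]; simp
        · intro h
          have h' : m.bits = [] := by simpa [Nat.bit0_bits m (by omega)] using h
          have := length_bits m
          rw [h'] at this
          have := Nat.size_pos.2 hm
          simp_all
        · rw [Nat.bit0_bits m (by omega), Nat.bit1_bits]; simp
    · obtain ⟨j, z, h1, h2, h3, h4⟩ := ih m (by omega)
      refine ⟨j + 1, z, h1, h2, ?_, ?_⟩
      · rw [Nat.bit1_bits, h3]; simp [List.replicate_succ]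
      · rw [show 2 * m + 1 + 1 = 2 * (m + 1) by ring, Nat.bit0_bits _ (by omega), h4]
        simp [List.replicate_succ]

/-- A work tape that holds a string of binary digits, behind a mark. -/
def tapeOf (w : List Bool) : ℕ → Sym
  | 0 => Sym.mark
  | i + 1 => w[i]?.map some

theorem tapeOf_succ_ne_mark (w : List Bool) (i : ℕ) : tapeOf w (i + 1) ≠ Sym.mark := by
  simp [tapeOf]

theorem tapeOf_length (u y : List Bool) :
    tapeOf (u ++ y) (u.length + 1) = y.head?.map some := by
  simp [tapeOf, List.head?_eq_getElem?, List.getElem?_append_right]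

theorem update_tapeOf (u y : List Bool) (b : Bool) :
    Function.update (tapeOf (u ++ y)) (u.length + 1) (Sym.dig b) = tapeOf (u ++ b :: y.tail) := by
  funext i
  rcases i with _ | i
  · simp [tapeOf]
  · rcases lt_trichotomy i u.length with h | rfl | h
    · rw [Function.update_of_ne (by omega)]; simp [tapeOf, List.getElem?_append_left h]
    · simp [tapeOf, Sym.dig]
    · rw [Function.update_of_ne (by omega)]
      obtain ⟨j, rfl⟩ := Nat.exists_eq_add_of_lt h
      simp [tapeOf, List.getElem?_append_right, Nat.add_assoc]

theorem update_tapeOf_blank (u : List Bool) (b : Bool) :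
    Function.update (tapeOf (u ++ [b])) (u.length + 1) Sym.blank = tapeOf u := by
  funext i
  rcases i with _ | i
  · simp [tapeOf]
  · rcases lt_trichotomy i u.length with h | rfl | h
    · rw [Function.update_of_ne (by omega)]; simp [tapeOf, List.getElem?_append_left h]
    · simp [tapeOf, Sym.blank]
    · rw [Function.update_of_ne (by omega)]
      obtain ⟨j, rfl⟩ := Nat.exists_eq_add_of_lt h
      simp [tapeOf, Nat.add_assoc]

namespace Data

/-- Replace the contents of tape `r` by the digits `w`, and put its head on cell `h`. -/
def setT (d : Data β k) (r : Fin k) (w : List Bool) (h : ℕ) : Data β k :=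
  { d with tape := Function.update d.tape r (tapeOf w), head := Function.update d.head r h }

theorem Good.setT {x : List α} {L : ℕ} {d : Data β k} (hd : d.Good x L) {r : Fin k}
    {w : List Bool} {h : ℕ} (hh : h < L) : (d.setT r w h).Good x L := by
  refine ⟨hd.1, fun i => ?_⟩
  by_cases hi : i = r
  · subst hi; simpa [Data.setT] using hh
  · simpa [Data.setT, hi] using hd.2 i

theorem scan_setT (d : Data β k) (r : Fin k) (w : List Bool) (h : ℕ) :
    (d.setT r w h).scan r = tapeOf w h := by
  simp [scan, setT]

end Data

namespace Frag

/-- Work on tape `r` only. -/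
def onTape (r : Fin k) (f : Sym → Sym × Move) : Frag α β k :=
  one fun s => (.stay, Function.update (fun i => (s i, .stay)) r (f (s r)), none)

variable {x : List α} {L : ℕ} {d : Data β k} {r : Fin k}

theorem onTape_runs {f : Sym → Sym × Move} {w w' : List Bool} {h h' : ℕ} (hd : d.Good x L)
    (hh : h < L) (hh' : h' < L)
    (e1 : Function.update (tapeOf w) h (f (tapeOf w h)).1 = tapeOf w')
    (e2 : moveHead (f (tapeOf w h)).2 h = h') :
    (onTape r f : Frag α β k).Runs x L (d.setT r w h) (d.setT r w' h') := by
  have key : (d.setT r w h).act x (.stay, Function.update (fun i => ((d.setT r w h).scan i, .stay)) r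
      (f ((d.setT r w h).scan r)), none) = d.setT r w' h' := by
    rw [Data.scan_setT]
    simp only [Data.act, Data.setT, moveHead, Option.toList_none, List.append_nil,
      Data.mk.injEq, and_true]
    refine ⟨by simpa using hd.1, ?_, ?_⟩
    · funext i
      by_cases hi : i = r
      · subst hi; simpa using e1
      · simp [hi, Data.scan]
    · funext i
      by_cases hi : i = r
      · subst hi; simpa [moveHead] using e2
      · simp [hi]
  have := one_runs (f := fun s => (.stay, Function.update (fun i => (s i, .stay)) r (f (s r)), none))
    (hd.setT (r := r) (w := w) hh) (by simp only [key]; exact hd.setT hh')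
  rwa [key] at this

/-- Turn a run of digits `b` into digits `!b`. -/
def flip (r : Fin k) (b : Bool) : Frag α β k :=
  loop (fun _ s => s r == Sym.dig b) (onTape r fun _ => (Sym.dig !b, .right))

theorem flip_runs {b : Bool} (hd : d.Good x L) (j : ℕ) (u z : List Bool) (hz : z.head? ≠ some b)
    (hL : u.length + j + 1 < L) :
    (flip r b : Frag α β k).Runs x L (d.setT r (u ++ (List.replicate j b ++ z)) (u.length + 1))
      (d.setT r (u ++ (List.replicate j (!b) ++ z)) (u.length + j + 1)) := by
  induction j generalizing u with
  | zero =>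
    refine loop_runs_false (hd.setT (by omega)) ?_
    rw [Data.scan_setT, tapeOf_length]
    simp only [List.replicate_zero, List.nil_append, beq_eq_false_iff_ne, ne_eq, Sym.dig]
    simpa using hz
  | succ j ih =>
    refine loop_runs_true (d₁ := d.setT r (u ++ (!b) :: (List.replicate j b ++ z))
      (u.length + 1 + 1)) ?_ ?_ ?_
    · rw [Data.scan_setT, tapeOf_length]
      simp [List.replicate_succ]
    · refine onTape_runs hd (by omega) (by omega) ?_ rfl
      rw [update_tapeOf]
      simp [List.replicate_succ]
    · have := ih (u ++ [!b]) (by simp; omega)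
      simp only [List.append_assoc, List.length_append, List.length_cons, List.length_nil,
        List.cons_append, List.nil_append] at this
      rw [show u.length + (j + 1) + 1 = u.length + 1 + j + 1 by omega]
      simpa [List.replicate_succ, flip] using this

/-- Move head `r` back to its rest position. -/
def back (r : Fin k) : Frag α β k :=
  (loop (fun _ s => s r != Sym.mark) (onTape r fun s => (s, .left))).seq
    (onTape r fun s => (s, .right))

theorem back_runs (hd : d.Good x L) (h : ℕ) (w : List Bool) (hL : h < L) (h1 : 1 < L) :
    (back r : Frag α β k).Runs x L (d.setT r w h) (d.setT r w 1) := by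
  refine seq_runs (d₁ := d.setT r w 0) ?_ (onTape_runs hd (by omega) h1 (by simp) rfl)
  induction h with
  | zero =>
    refine loop_runs_false (hd.setT (by omega)) ?_
    rw [Data.scan_setT]; simp [tapeOf]
  | succ h ih =>
    refine loop_runs_true (d₁ := d.setT r w h) ?_ (onTape_runs hd hL (by omega) (by simp) rfl)
      (ih (by omega))
    rw [Data.scan_setT]; simpa using tapeOf_succ_ne_mark w h

def inc (r : Fin k) : Frag α β k :=
  (flip r true).seq ((onTape r fun _ => (Sym.dig true, .left)).seq (back r))

theorem inc_runs (hd : d.Good x L) (v : ℕ) (hL : (v + 1).size + 1 < L) :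
    (inc r : Frag α β k).Runs x L (d.setT r v.bits 1) (d.setT r (v + 1).bits 1) := by
  obtain ⟨j, z, hz, -, h1, h2⟩ := bits_succ_eq v
  have hl := length_bits (v + 1)
  rw [h2] at hl
  simp only [List.length_append, List.length_replicate, List.length_cons] at hl
  rw [h1, h2]
  have a := flip_runs (r := r) hd j [] z hz (by simp; omega)
  simp only [List.nil_append, List.length_nil, Nat.zero_add] at a
  refine seq_runs a (seq_runs (d₁ := d.setT r (List.replicate j false ++ true :: z.tail) j)
    (onTape_runs hd (by omega) (by omega) ?_ (by simp [moveHead])) (back_runs hd _ _ (by omega) (by omega)))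
  simpa using update_tapeOf (List.replicate j false) z true

/-- If the cell behind the cleared digit is blank, this digit was the top one and is erased. The
tape thus holds exactly `Nat.bits` again, and zero is the empty word. -/
def dec (r : Fin k) : Frag α β k :=
  (flip r false).seq ((onTape r fun _ => (Sym.dig false, .right)).seq
    ((ite (fun _ s => s r == Sym.blank)
      ((onTape r fun s => (s, .left)).seq (onTape r fun _ => (Sym.blank, .left)))
      (onTape r fun s => (s, .left))).seq (back r)))

theorem dec_runs (hd : d.Good x L) (v : ℕ) (hL : (v + 1).size + 1 < L) :
    (dec r : Frag α β k).Runs x L (d.setT r (v + 1).bits 1) (d.setT r v.bits 1) := by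
  obtain ⟨j, z, hz, hz', h1, h2⟩ := bits_succ_eq v
  have hl := length_bits (v + 1)
  rw [h2] at hl
  simp only [List.length_append, List.length_replicate, List.length_cons] at hl
  rw [h1, h2]
  have a := flip_runs (r := r) hd j [] (true :: z.tail) (b := false) (by simp) (by simp; omega)
  simp only [List.nil_append, List.length_nil, Nat.zero_add, Bool.not_false] at a
  refine seq_runs a (seq_runs
    (d₁ := d.setT r (List.replicate j true ++ false :: z.tail) (j + 1 + 1))
    (onTape_runs hd (by omega) (by omega) ?_ rfl) ?_)
  · simpa using update_tapeOf (List.replicate j true) (true :: z.tail) false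
  have hs := tapeOf_length (List.replicate j true ++ [false]) z.tail
  simp only [List.append_assoc, List.cons_append, List.nil_append, List.length_append,
    List.length_replicate, List.length_cons, List.length_nil, Nat.zero_add] at hs
  rcases z with _ | ⟨b, z⟩
  · refine seq_runs (d₁ := d.setT r (List.replicate j true) j) (ite_runs_true ?_
      (seq_runs (d₁ := d.setT r (List.replicate j true ++ [false]) (j + 1)) ?_ ?_)) ?_
    · rw [Data.scan_setT, hs]; simp [Sym.blank]
    · exact onTape_runs hd (by omega) (by omega) (by simp) rfl
    · refine onTape_runs hd (by omega) (by omega) ?_ rfl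
      simpa using update_tapeOf_blank (List.replicate j true) false
    · simpa using back_runs hd _ _ (by omega) (by omega)
  · obtain rfl : b = false := by simpa using hz
    refine seq_runs (ite_runs_false ?_ (onTape_runs (h' := j + 1) hd (by omega) (by omega) (by simp) rfl))
      (back_runs hd (j + 1) _ (by omega) (by omega))
    rw [Data.scan_setT, List.tail_cons] at *
    rw [hs]
    rcases z with _ | ⟨c, z⟩
    · simp at hz'
    · simp [Sym.blank]

end Frag

/-! ## Register programs -/

/-- The store of a register program. -/
@[ext]
structure Store (β : Type) where
  reg : ℕ → ℕ
  pos : ℕ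
  out : List β

inductive Test (α : Type)
  | nz (r : ℕ)
  | sym (p : InputCell α → Bool)

/-- Programs with counters, a two-way input head and an output tape. -/
inductive Cmd (α β : Type)
  | skip
  | inc (r : ℕ)
  | dec (r : ℕ)
  | inL
  | inR
  | out (b : β)
  | seq (c d : Cmd α β)
  | ite (t : Test α) (c d : Cmd α β)
  | loop (t : Test α) (c : Cmd α β)

def Store.set (σ : Store β) (r v : ℕ) : Store β := { σ with reg := Function.update σ.reg r v }

def Test.eval (x : List α) (σ : Store β) : Test α → Bool
  | .nz r => σ.reg r != 0
  | .sym p => p (readInput x σ.pos)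

/-- Big-step semantics; no register may exceed `M`. -/
inductive Exec (M : ℕ) (x : List α) : Cmd α β → Store β → Store β → Prop
  | skip σ : Exec M x .skip σ σ
  | inc σ r : σ.reg r < M → Exec M x (.inc r) σ (σ.set r (σ.reg r + 1))
  | dec σ r : 0 < σ.reg r → Exec M x (.dec r) σ (σ.set r (σ.reg r - 1))
  | inL σ : Exec M x .inL σ { σ with pos := σ.pos - 1 }
  | inR σ : Exec M x .inR σ { σ with pos := min (σ.pos + 1) (x.length + 1) }
  | out σ b : Exec M x (.out b) σ { σ with out := σ.out ++ [b] }
  | seq {c d σ₀ σ₁ σ₂} : Exec M x c σ₀ σ₁ → Exec M x d σ₁ σ₂ → Exec M x (.seq c d) σ₀ σ₂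
  | iteT {t c d σ₀ σ₁} : t.eval x σ₀ = true → Exec M x c σ₀ σ₁ → Exec M x (.ite t c d) σ₀ σ₁
  | iteF {t c d σ₀ σ₁} : t.eval x σ₀ = false → Exec M x d σ₀ σ₁ → Exec M x (.ite t c d) σ₀ σ₁
  | loopF {t c σ} : t.eval x σ = false → Exec M x (.loop t c) σ σ
  | loopT {t c σ₀ σ₁ σ₂} : t.eval x σ₀ = true → Exec M x c σ₀ σ₁ → Exec M x (.loop t c) σ₁ σ₂ →
      Exec M x (.loop t c) σ₀ σ₂

def Store.Inv (M : ℕ) (x : List α) (σ : Store β) : Prop :=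
  σ.pos ≤ x.length + 1 ∧ ∀ r, σ.reg r ≤ M

theorem Exec.inv {M : ℕ} {x : List α} {c : Cmd α β} {σ σ' : Store β} (h : Exec M x c σ σ') :
    σ.Inv M x → σ'.Inv M x := by
  induction h with
  | skip σ => exact id
  | inc σ r hr =>
    rintro ⟨h1, h2⟩
    refine ⟨h1, fun s => ?_⟩
    by_cases hs : s = r
    · subst hs; simpa [Store.set] using hr
    · simpa [Store.set, hs] using h2 s
  | dec σ r hr =>
    rintro ⟨h1, h2⟩
    refine ⟨h1, fun s => ?_⟩
    by_cases hs : s = r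
    · subst hs; simpa [Store.set] using (Nat.sub_le _ _).trans (h2 s)
    · simpa [Store.set, hs] using h2 s
  | inL σ => exact fun h => ⟨(Nat.sub_le _ _).trans h.1, h.2⟩
  | inR σ => exact fun h => ⟨min_le_right _ _, h.2⟩
  | out σ b => exact id
  | seq _ _ ih1 ih2 => exact ih2 ∘ ih1
  | iteT _ _ ih => exact ih
  | iteF _ _ ih => exact ih
  | loopF _ => exact id
  | loopT _ _ _ ih1 ih2 => exact ih2 ∘ ih1

/-- All registers of the program are below `k`. -/
def Test.Below (k : ℕ) : Test α → Prop
  | .nz r => r < k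
  | .sym _ => True

def Cmd.Below (k : ℕ) : Cmd α β → Prop
  | .skip => True
  | .inc r => r < k
  | .dec r => r < k
  | .inL => True
  | .inR => True
  | .out _ => True
  | .seq c d => c.Below k ∧ d.Below k
  | .ite t c d => t.Below k ∧ c.Below k ∧ d.Below k
  | .loop t c => t.Below k ∧ c.Below k

theorem Cmd.Below.mono {c : Cmd α β} {k l : ℕ} (hkl : k ≤ l) (h : c.Below k) : c.Below l := by
  have ht : ∀ t : Test α, t.Below k → t.Below l := by
    rintro (r | _) h
    · exact lt_of_lt_of_le (h : r < k) hkl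
    · trivial
  induction c with
  | skip | inL | inR | out => trivial
  | inc r | dec r => exact lt_of_lt_of_le (h : r < k) hkl
  | seq c d ih1 ih2 => exact ⟨ih1 h.1, ih2 h.2⟩
  | ite t c d ih1 ih2 => exact ⟨ht t h.1, ih1 h.2.1, ih2 h.2.2⟩
  | loop t c ih => exact ⟨ht t h.1, ih h.2⟩

theorem Cmd.exists_below (c : Cmd α β) : ∃ k, c.Below k := by
  have ht : ∀ t : Test α, ∃ k, t.Below k := by
    rintro (r | _)
    · exact ⟨r + 1, Nat.lt_succ_self r⟩
    · exact ⟨0, trivial⟩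
  have hm : ∀ (t : Test α) k l, k ≤ l → t.Below k → t.Below l := by
    rintro (r | _) k l hkl h
    · exact lt_of_lt_of_le (h : r < k) hkl
    · trivial
  induction c with
  | skip | inL | inR | out => exact ⟨0, trivial⟩
  | inc r | dec r => exact ⟨r + 1, Nat.lt_succ_self r⟩
  | seq c d ih1 ih2 =>
    obtain ⟨k, hk⟩ := ih1
    obtain ⟨l, hl⟩ := ih2
    exact ⟨max k l, hk.mono (le_max_left _ _), hl.mono (le_max_right _ _)⟩
  | ite t c d ih1 ih2 =>
    obtain ⟨k, hk⟩ := ih1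
    obtain ⟨l, hl⟩ := ih2
    obtain ⟨m, hm'⟩ := ht t
    exact ⟨max m (max k l), hm _ _ _ (by simp) hm', hk.mono (by simp), hl.mono (by simp)⟩
  | loop t c ih =>
    obtain ⟨k, hk⟩ := ih
    obtain ⟨m, hm'⟩ := ht t
    exact ⟨max m k, hm _ _ _ (by simp) hm', hk.mono (by simp)⟩

/-- The tapes that represent a store. -/
def Store.enc (k : ℕ) (σ : Store β) : Data β k where
  pos := σ.pos
  tape i := tapeOf (σ.reg i).bits
  head _ := 1
  out := σ.out

theorem Store.enc_set (σ : Store β) (r : Fin k) (v : ℕ) :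
    (σ.set r v).enc k = (σ.enc k).setT r v.bits 1 := by
  simp only [enc, set, Data.setT, Data.mk.injEq, and_true, true_and]
  constructor
  · funext i
    by_cases hi : i = r
    · subst hi; simp
    · simp [hi, Fin.val_inj]
  · funext i
    by_cases hi : i = r
    · subst hi; simp
    · simp [hi]

theorem Store.enc_eq_setT (σ : Store β) (r : Fin k) :
    σ.enc k = (σ.enc k).setT r (σ.reg r).bits 1 := by
  rw [← enc_set]; simp [set]

def Test.fn (k : ℕ) : Test α → Frag.TestFn α k
  | .nz r => fun _ s => if h : r < k then s ⟨r, h⟩ != Sym.blank else false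
  | .sym p => fun c _ => p c

/-- The digits of zero form the empty word and the heads rest on cell 1, so a zero test only has to
see whether the scanned cell is blank. -/
theorem Test.fn_enc {t : Test α} (ht : t.Below k) (x : List α) (σ : Store β) :
    t.fn k (readInput x (σ.enc k).pos) (σ.enc k).scan = t.eval x σ := by
  cases t with
  | sym p => rfl
  | nz r =>
    have hr : r < k := ht
    simp only [fn, hr, dif_pos, eval, Data.scan, Store.enc, tapeOf]
    rcases h : σ.reg r with _ | v
    · simp [Sym.blank]
    · obtain ⟨j, z, -, -, -, h2⟩ := bits_succ_eq v
      rw [h2]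
      rcases j with _ | j <;> simp [Sym.blank, List.replicate_succ]

theorem Store.Inv.good {M L : ℕ} {x : List α} {σ : Store β} (h : σ.Inv M x) (hL : 1 < L) :
    (σ.enc k).Good x L := ⟨h.1, fun _ => hL⟩

/-- Register programs can be run on work tapes of logarithmic length. -/
theorem Cmd.exists_frag (c : Cmd α β) (hc : c.Below k) :
    ∃ F : Frag α β k, ∀ M x σ σ', Exec M x c σ σ' → σ.Inv M x →
      F.Runs x (M.size + 2) (σ.enc k) (σ'.enc k) := by
  induction c with
  | skip =>
    refine ⟨Frag.one idle, fun M x σ σ' h hi => ?_⟩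
    cases h
    have g : (σ.enc k).Good x (M.size + 2) := hi.good (by omega)
    have := Frag.one_runs (f := idle) g (by rw [Data.act_idle g]; exact g)
    rwa [Data.act_idle g] at this
  | inc r =>
    obtain ⟨r, rfl⟩ : ∃ s : Fin k, (s : ℕ) = r := ⟨⟨r, hc⟩, rfl⟩
    refine ⟨Frag.inc r, fun M x σ σ' h hi => ?_⟩
    cases h with
    | inc _ _ hr =>
      rw [Store.enc_set]
      nth_rewrite 1 [Store.enc_eq_setT σ r]
      refine Frag.inc_runs (hi.good (by omega)) _ ?_
      have := Nat.size_le_size (show σ.reg r + 1 ≤ M from hr)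
      omega
  | dec r =>
    obtain ⟨r, rfl⟩ : ∃ s : Fin k, (s : ℕ) = r := ⟨⟨r, hc⟩, rfl⟩
    refine ⟨Frag.dec r, fun M x σ σ' h hi => ?_⟩
    cases h with
    | dec _ _ hr =>
      rw [Store.enc_set]
      nth_rewrite 1 [Store.enc_eq_setT σ r]
      obtain ⟨v, hv⟩ : ∃ v, σ.reg r = v + 1 := ⟨σ.reg r - 1, by omega⟩
      have := Nat.size_le_size (hi.2 r)
      rw [hv] at this
      rw [hv, Nat.add_sub_cancel]
      exact Frag.dec_runs (hi.good (by omega)) _ (by omega)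
  | inL =>
    refine ⟨Frag.one fun s => (.left, fun i => (s i, .stay), none), fun M x σ σ' h hi => ?_⟩
    have hi' := h.inv hi
    cases h
    have e : (σ.enc k).act x (.left, fun i => ((σ.enc k).scan i, .stay), none) =
        Store.enc k { σ with pos := σ.pos - 1 } := by
      simp [Data.act, Store.enc, moveHead, Data.scan]
      have := hi.1; omega
    have := Frag.one_runs (f := fun s => (.left, fun i => (s i, .stay), none))
      (hi.good (k := k) (L := M.size + 2) (by omega)) (by rw [e]; exact hi'.good (by omega))
    rwa [e] at this
  | inR =>
    refine ⟨Frag.one fun s => (.right, fun i => (s i, .stay), none), fun M x σ σ' h hi => ?_⟩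
    have hi' := h.inv hi
    cases h
    have e : (σ.enc k).act x (.right, fun i => ((σ.enc k).scan i, .stay), none) =
        Store.enc k { σ with pos := min (σ.pos + 1) (x.length + 1) } := by
      simp [Data.act, Store.enc, moveHead, Data.scan]
    have := Frag.one_runs (f := fun s => (.right, fun i => (s i, .stay), none))
      (hi.good (k := k) (L := M.size + 2) (by omega)) (by rw [e]; exact hi'.good (by omega))
    rwa [e] at this
  | out b =>
    refine ⟨Frag.one fun s => (.stay, fun i => (s i, .stay), some b), fun M x σ σ' h hi => ?_⟩
    have hi' := h.inv hi
    cases h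
    have e : (σ.enc k).act x (.stay, fun i => ((σ.enc k).scan i, .stay), some b) =
        Store.enc k { σ with out := σ.out ++ [b] } := by
      simp [Data.act, Store.enc, moveHead, Data.scan]
      have := hi.1; omega
    have := Frag.one_runs (f := fun s => (.stay, fun i => (s i, .stay), some b))
      (hi.good (k := k) (L := M.size + 2) (by omega)) (by rw [e]; exact hi'.good (by omega))
    rwa [e] at this
  | seq c d ih1 ih2 =>
    obtain ⟨F, hF⟩ := ih1 hc.1
    obtain ⟨G, hG⟩ := ih2 hc.2
    refine ⟨F.seq G, fun M x σ σ' h hi => ?_⟩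
    cases h with
    | seq h1 h2 => exact Frag.seq_runs (hF _ _ _ _ h1 hi) (hG _ _ _ _ h2 (h1.inv hi))
  | ite t c d ih1 ih2 =>
    obtain ⟨F, hF⟩ := ih1 hc.2.1
    obtain ⟨G, hG⟩ := ih2 hc.2.2
    refine ⟨Frag.ite (t.fn k) F G, fun M x σ σ' h hi => ?_⟩
    cases h with
    | iteT ht h => exact Frag.ite_runs_true (by rw [Test.fn_enc hc.1, ht]) (hF _ _ _ _ h hi)
    | iteF ht h => exact Frag.ite_runs_false (by rw [Test.fn_enc hc.1, ht]) (hG _ _ _ _ h hi)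
  | loop t c ih =>
    obtain ⟨F, hF⟩ := ih hc.2
    refine ⟨Frag.loop (t.fn k) F, fun M x σ σ' h hi => ?_⟩
    generalize he : Cmd.loop t c = e at h
    induction h with
    | loopF ht =>
      cases he
      exact Frag.loop_runs_false (hi.good (by omega)) (by rw [Test.fn_enc hc.1, ht])
    | loopT ht h1 h2 _ ih2 =>
      cases he
      exact Frag.loop_runs_true (by rw [Test.fn_enc hc.1, ht]) (hF _ _ _ _ h1 hi)
        (ih2 (h1.inv hi) rfl)
    | _ => cases he

def Store.init : Store β := ⟨fun _ => 0, 0, []⟩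

/-- A register program whose counters are linear in the length of the input gives a log-space
transducer. -/
theorem exists_transducer (c : Cmd α β) (K : ℕ) (f : List α → List β)
    (h : ∀ x : List α, ∃ σ, Exec (K * (x.length + 1)) x c Store.init σ ∧ σ.out = f x) :
    ∃ M : Transducer α β, M.RunsInLogSpace ∧ ∀ x, M.Outputs x (f x) := by
  obtain ⟨k, hk⟩ := c.exists_below
  obtain ⟨F, hF⟩ := c.exists_frag hk
  -- The extra first step writes the mark on cell 0 of every tape and moves the heads to cell 1;
  -- this is the encoding of the store in which all registers are zero.
  let G : Frag α β k := (Frag.one fun _ => (.stay, fun _ => (Sym.mark, .right), none)).seq F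
  have hG : ∀ x, ∃ d, G.Runs x ((K * (x.length + 1)).size + 2)
      ⟨0, fun _ _ => Sym.blank, fun _ => 0, []⟩ d ∧ d.out = f x := by
    intro x
    obtain ⟨σ, h1, h2⟩ := h x
    refine ⟨σ.enc k, Frag.seq_runs ?_ (hF _ _ _ _ h1 ⟨by simp [Store.init], by simp [Store.init]⟩),
      h2⟩
    let d0 : Data β k := ⟨0, fun _ _ => Sym.blank, fun _ => 0, []⟩
    have e : d0.act x (.stay, fun _ => (Sym.mark, .right), none) = Store.enc k Store.init := by
      simp only [Data.act, d0, Store.enc, Store.init, moveHead, Data.mk.injEq]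
      refine ⟨by simp, ?_, by simp, by simp⟩
      funext i j
      rcases j with _ | j <;> simp [tapeOf, Sym.blank]
    have := Frag.one_runs (d := d0) (x := x) (L := (K * (x.length + 1)).size + 2)
      (f := fun _ => (.stay, fun _ => (Sym.mark, .right), none))
      ⟨by simp [d0], by simp [d0]⟩ (by
        rw [e]; exact ⟨by simp [Store.enc, Store.init], by simp [Store.enc]⟩)
    rwa [e] at this
  -- The heads stay below `(K * (x.length + 1)).size + 2`, and this is at most `K.size + Nat.log 2
  -- x.length + 3`.
  refine ⟨G.toTransducer, ⟨K.size + 4, fun x => ?_⟩, fun x => ?_⟩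
  · obtain ⟨d, hd, -⟩ := hG x
    obtain ⟨h1, h2⟩ := Frag.runs_reaches hd
    refine ⟨⟨_, h1⟩, fun c hc i => (h2 c hc i).trans_le ?_⟩
    have h3 : (K * (x.length + 1)).size ≤ K.size + (Nat.log 2 x.length + 1) := by
      rw [Nat.size_le, pow_add]
      refine Nat.mul_lt_mul_of_lt_of_le (Nat.lt_size_self K) ?_ (by positivity)
      exact Nat.lt_pow_succ_log_self (by omega) x.length
    have h4 : Nat.log 2 x.length ≤ (K.size + 4) * Nat.log 2 x.length :=
      Nat.le_mul_of_pos_left _ (by omega)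
    omega
  · obtain ⟨d, hd, he⟩ := hG x
    rw [← he]
    exact (Frag.runs_reaches hd).1

end LogSpace

namespace LogSpace

open Relation Transducer

/-! ## Functions computed by register programs -/

section Macros

variable {α β : Type} {M : ℕ} {x : List α}

@[simp] theorem Store.set_reg_self (σ : Store β) (r v : ℕ) : (σ.set r v).reg r = v := by
  simp [set]

theorem Store.set_reg_ne (σ : Store β) {r s : ℕ} (v : ℕ) (h : s ≠ r) :
    (σ.set r v).reg s = σ.reg s := by
  simp [set, h]

@[simp] theorem Store.set_out (σ : Store β) (r v : ℕ) : (σ.set r v).out = σ.out := rfl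

def Cmd.clear (r : ℕ) : Cmd α β := .loop (.nz r) (.dec r)

theorem Exec.clear (σ : Store β) (r : ℕ) : Exec M x (Cmd.clear r) σ (σ.set r 0) := by
  induction h : σ.reg r generalizing σ with
  | zero =>
    rw [show σ.set r 0 = σ by ext <;> simp [Store.set, ← h]]
    exact .loopF (by simp [Test.eval, h])
  | succ n ih =>
    refine .loopT (by simp [Test.eval, h]) (.dec σ r (by omega)) ?_
    have := ih (σ.set r (σ.reg r - 1)) (by simp [h])
    simpa [Store.set, Cmd.clear] using this

/-- Add the contents of `r` to `s`, and clear `r`. -/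
def Cmd.move (r s : ℕ) : Cmd α β := .loop (.nz r) (.seq (.dec r) (.inc s))

theorem Exec.move (σ : Store β) {r s : ℕ} (hrs : r ≠ s) (hM : σ.reg r + σ.reg s ≤ M) :
    ∃ σ', Exec M x (Cmd.move r s) σ σ' ∧ σ'.reg s = σ.reg s + σ.reg r ∧ σ'.reg r = 0 ∧
      (∀ t, t ≠ r → t ≠ s → σ'.reg t = σ.reg t) ∧ σ'.out = σ.out := by
  induction h : σ.reg r generalizing σ with
  | zero => exact ⟨σ, .loopF (by simp [Test.eval, h]), rfl, h, fun _ _ _ => rfl, rfl⟩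
  | succ n ih =>
    have e1 : (σ.set r (σ.reg r - 1)).reg s = σ.reg s := Store.set_reg_ne _ _ hrs.symm
    obtain ⟨σ', h1, h2, h3, h4, h5⟩ := ih ((σ.set r (σ.reg r - 1)).set s (σ.reg s + 1))
      (by rw [Store.set_reg_ne _ _ hrs]; simp; omega)
      (by rw [Store.set_reg_ne _ _ hrs]; simp [h])
    refine ⟨σ', .loopT (by simp [Test.eval, h]) (.seq (.dec σ r (by omega)) (.inc _ s ?_)) ?_,
      ?_, h3, ?_, h5⟩
    · rw [e1]; omega
    · rw [e1]; exact h1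
    · rw [h2]; simp; omega
    · intro t t1 t2
      rw [h4 t t1 t2, Store.set_reg_ne _ _ t2, Store.set_reg_ne _ _ t1]

/-- Overwrite `s` with the contents of `r`, and clear `r`. -/
def Cmd.transfer (r s : ℕ) : Cmd α β := .seq (.clear s) (.move r s)

theorem Exec.transfer (σ : Store β) {r s : ℕ} (hrs : r ≠ s) (hM : σ.reg r ≤ M) :
    ∃ σ', Exec M x (Cmd.transfer r s) σ σ' ∧ σ'.reg s = σ.reg r ∧
      (∀ t, t ≠ r → t ≠ s → σ'.reg t = σ.reg t) ∧ σ'.out = σ.out := by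
  obtain ⟨σ', h1, h2, -, h4, h5⟩ := Exec.move (M := M) (x := x) (σ.set s 0) hrs
    (by rw [Store.set_reg_ne _ _ hrs]; simpa using hM)
  refine ⟨σ', .seq (.clear σ s) h1, ?_, fun t t1 t2 => ?_, h5⟩
  · rw [h2, Store.set_reg_ne _ _ hrs]; simp
  · rw [h4 t t1 t2, Store.set_reg_ne _ _ t2]

/-- Overwrite `s` with the contents of `r`, with scratch register `s + 1`. -/
def Cmd.copy (r s : ℕ) : Cmd α β :=
  .seq (.seq (.clear s) (.clear (s + 1)))
    (.seq (.loop (.nz r) (.seq (.dec r) (.seq (.inc s) (.inc (s + 1))))) (.move (s + 1) r))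

theorem Exec.copy (σ : Store β) {r s : ℕ} (hrs : r < s) (hM : σ.reg r ≤ M) :
    ∃ σ', Exec M x (Cmd.copy r s) σ σ' ∧ σ'.reg s = σ.reg r ∧
      (∀ t < s, σ'.reg t = σ.reg t) ∧ σ'.out = σ.out := by
  have key : ∀ n (σ : Store β), σ.reg r = n → n + σ.reg s ≤ M → n + σ.reg (s + 1) ≤ M →
      ∃ σ', Exec M x (.loop (.nz r) (.seq (.dec r) (.seq (.inc s) (.inc (s + 1))))) σ σ' ∧
        σ'.reg r = 0 ∧ σ'.reg s = σ.reg s + n ∧ σ'.reg (s + 1) = σ.reg (s + 1) + n ∧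
        (∀ t < s, t ≠ r → σ'.reg t = σ.reg t) ∧ σ'.out = σ.out := by
    intro n
    induction n with
    | zero =>
      exact fun σ h _ _ => ⟨σ, .loopF (by simp [Test.eval, h]), h, rfl, rfl, fun _ _ _ => rfl, rfl⟩
    | succ n ih =>
      intro σ h hs hs'
      let σ1 := σ.set r (σ.reg r - 1)
      let σ2 := σ1.set s (σ1.reg s + 1)
      let σ3 := σ2.set (s + 1) (σ2.reg (s + 1) + 1)
      have e1 : σ1.reg s = σ.reg s := Store.set_reg_ne _ _ (by omega)
      have e2 : σ2.reg (s + 1) = σ.reg (s + 1) := by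
        rw [Store.set_reg_ne _ _ (by omega), Store.set_reg_ne _ _ (by omega)]
      have a1 : σ3.reg r = n := by
        rw [Store.set_reg_ne _ _ (by omega), Store.set_reg_ne _ _ (by omega)]; simp [σ1, h]
      have a2 : σ3.reg s = σ.reg s + 1 := by
        rw [Store.set_reg_ne _ _ (by omega)]; simp [σ2, e1]
      have a3 : σ3.reg (s + 1) = σ.reg (s + 1) + 1 := by simp [σ3, e2]
      obtain ⟨σ', h1, h2, h3, h4, h5, h6⟩ := ih σ3 a1 (by omega) (by omega)
      refine ⟨σ', .loopT (by simp [Test.eval, h]) (.seq (.dec σ r (by omega)) (.seq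
        (.inc σ1 s (by omega)) (.inc σ2 (s + 1) (by omega)))) h1, h2, by omega, by omega,
        fun t t1 t2 => ?_, h6⟩
      rw [h5 t t1 t2, Store.set_reg_ne _ _ (by omega), Store.set_reg_ne _ _ (by omega),
        Store.set_reg_ne _ _ t2]
  let σ1 := (σ.set s 0).set (s + 1) 0
  have a1 : σ1.reg r = σ.reg r := by
    rw [Store.set_reg_ne _ _ (by omega), Store.set_reg_ne _ _ (by omega)]
  have a2 : σ1.reg s = 0 := by rw [Store.set_reg_ne _ _ (by omega)]; simp
  have a3 : σ1.reg (s + 1) = 0 := by simp [σ1]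
  obtain ⟨σ2, h1, h2, h3, h4, h5, h6⟩ := key _ σ1 a1 (by omega) (by omega)
  obtain ⟨σ3, g1, g2, -, g4, g5⟩ := Exec.move (M := M) (x := x) σ2 (r := s + 1) (s := r)
    (by omega) (by omega)
  refine ⟨σ3, .seq (.seq (.clear _ _) (.clear _ _)) (.seq h1 g1), ?_, fun t ht => ?_, ?_⟩
  · rw [g4 s (by omega) (by omega)]; omega
  · by_cases hr : t = r
    · subst hr; omega
    · rw [g4 t (by omega) hr, h5 t ht hr, Store.set_reg_ne _ _ (by omega),
        Store.set_reg_ne _ _ (by omega)]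
  · rw [g5, h6]; rfl

/-- Move the input head to the left end. -/
def Cmd.rewind : Cmd α β :=
  .loop (.sym fun c => match c with | .leftEnd => false | _ => true) .inL

theorem Exec.rewind (σ : Store β) : Exec M x Cmd.rewind σ { σ with pos := 0 } := by
  induction h : σ.pos generalizing σ with
  | zero =>
    rw [← h]
    exact .loopF (by simp [Test.eval, h, readInput])
  | succ n ih =>
    refine .loopT ?_ (.inL σ) ?_
    · simp only [Test.eval, h, readInput]; split <;> simp_all; split at * <;> simp_all
    · exact ih { σ with pos := σ.pos - 1 } (by simp [h])

end Macros

variable {ι κ : Type}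

/-- Extend an environment by one value. -/
def cons (a : ℕ) (v : ι → ℕ) : Option ι → ℕ := fun o => o.elim a v

@[simp] theorem cons_none (a : ℕ) (v : ι → ℕ) : cons a v none = a := rfl

@[simp] theorem cons_some (a : ℕ) (v : ι → ℕ) (i : ι) : cons a v (some i) = v i := rfl

/-- On environments with values at most `A`, a register program with counters at most
`K * (|x| + A + 1)` computes the value `f x v` and appends `g x v` to the output. -/
def LFO (f : List Letter → (ι → ℕ) → ℕ) (g : List Letter → (ι → ℕ) → List Letter) : Prop :=
  ∃ K, (∀ x v A, (∀ i, v i ≤ A) → f x v ≤ K * (x.length + A + 1)) ∧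
    ∀ (loc : ι → ℕ) (b : ℕ), (∀ i, loc i < b) → ∃ c : Cmd Letter Letter, ∀ x A M (σ : Store Letter),
      (∀ i, σ.reg (loc i) ≤ A) → K * (x.length + A + 1) ≤ M →
      ∃ σ', Exec M x c σ σ' ∧ σ'.reg b = f x (fun i => σ.reg (loc i)) ∧
        (∀ r < b, σ'.reg r = σ.reg r) ∧ σ'.out = σ.out ++ g x (fun i => σ.reg (loc i))

abbrev LF (f : List Letter → (ι → ℕ) → ℕ) : Prop := LFO f fun _ _ => []

abbrev OutP (g : List Letter → (ι → ℕ) → List Letter) : Prop := LFO (fun _ _ => 0) g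

theorem LFO.var (i : ι) : LF fun _ v => v i := by
  refine ⟨1, fun x v A h => by have := h i; dsimp only; omega, fun loc b hb => ⟨.copy (loc i) b, ?_⟩⟩
  intro x A M σ hA hM
  obtain ⟨σ', h1, h2, h3, h4⟩ := Exec.copy (M := M) (x := x) σ (hb i) (by have := hA i; omega)
  exact ⟨σ', h1, h2, h3, by simp [h4]⟩

theorem LFO.zero : LF (ι := ι) fun _ _ => 0 := by
  refine ⟨0, fun x v A h => by simp, fun loc b hb => ⟨.clear b, ?_⟩⟩
  intro x A M σ hA hM
  exact ⟨_, .clear σ b, by simp, fun r hr => Store.set_reg_ne _ _ (by omega), by simp⟩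

theorem LFO.succ {f : List Letter → (ι → ℕ) → ℕ} {g} (h : LFO f g) :
    LFO (fun x v => f x v + 1) g := by
  obtain ⟨K, hK, h⟩ := h
  refine ⟨K + 1, fun x v A hA => ?_, fun loc b hb => ?_⟩
  · have := hK x v A hA
    rw [add_mul]; dsimp only; omega
  · obtain ⟨c, hc⟩ := h loc b hb
    refine ⟨.seq c (.inc b), fun x A M σ hA hM => ?_⟩
    rw [add_mul] at hM
    obtain ⟨σ', h1, h2, h3, h4⟩ := hc x A M σ hA (by omega)
    have := hK x _ A hA
    refine ⟨_, .seq h1 (.inc σ' b (by omega)), by simp [h2], fun r hr => ?_, by simpa using h4⟩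
    rw [Store.set_reg_ne _ _ (by omega), h3 r hr]

theorem LFO.pred {f : List Letter → (ι → ℕ) → ℕ} {g} (h : LFO f g) :
    LFO (fun x v => f x v - 1) g := by
  obtain ⟨K, hK, h⟩ := h
  refine ⟨K, fun x v A hA => (Nat.sub_le _ _).trans (hK x v A hA), fun loc b hb => ?_⟩
  obtain ⟨c, hc⟩ := h loc b hb
  refine ⟨.seq c (.ite (.nz b) (.dec b) .skip), fun x A M σ hA hM => ?_⟩
  obtain ⟨σ', h1, h2, h3, h4⟩ := hc x A M σ hA hM
  rcases Nat.eq_zero_or_pos (σ'.reg b) with h0 | h0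
  · exact ⟨σ', .seq h1 (.iteF (by simp [Test.eval, h0]) (.skip _)), by dsimp only; omega, h3, h4⟩
  · refine ⟨_, .seq h1 (.iteT (by simpa [Test.eval] using h0.ne') (.dec _ _ h0)), by simp [h2],
      fun r hr => ?_, by simpa using h4⟩
    rw [Store.set_reg_ne _ _ (by omega), h3 r hr]

/-- The values of a primitive recursion. -/
def recVal (f : List Letter → (ι → ℕ) → ℕ) (g : List Letter → (Option (Option ι) → ℕ) → ℕ)
    (x : List Letter) (v : ι → ℕ) : ℕ → ℕ
  | 0 => f x v
  | i + 1 => g x (cons i (cons (recVal f g x v i) v))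

/-- A loop in which `b` holds the current value, `b + 1` the index, `b + 2` the number of rounds
left, and `b + 3` receives the next value before it replaces the current one. Values have to remain
linear in order to fit into counters, and iteration alone does not guarantee this: hence `hB`. -/
theorem LFO.recursion {f h : List Letter → (ι → ℕ) → ℕ} {o₁ o₂ : List Letter → (ι → ℕ) → List Letter}
    {g : List Letter → (Option (Option ι) → ℕ) → ℕ}
    {o : List Letter → (Option (Option ι) → ℕ) → List Letter}
    (hf : LFO f o₁) (hh : LFO h o₂) (hg : LFO g o)
    (hB : ∃ B, ∀ x v A, (∀ i, v i ≤ A) → ∀ i ≤ h x v, recVal f g x v i ≤ B * (x.length + A + 1)) :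
    LFO (fun x v => recVal f g x v (h x v)) (fun x v => o₁ x v ++ o₂ x v ++
      (List.range (h x v)).flatMap fun i => o x (cons i (cons (recVal f g x v i) v))) := by
  obtain ⟨Kf, bf, hf⟩ := hf
  obtain ⟨Kh, bh, hh⟩ := hh
  obtain ⟨Kg, bg, hg⟩ := hg
  obtain ⟨B, hB⟩ := hB
  -- The first three summands bound `f`, `h` and the values of the recursion. The last one pays for
  -- `g`, whose arguments may be as large as `A + Kh * N + B * N` with `N` as below.
  refine ⟨Kf + Kh + B + Kg * (2 + Kh + B), fun x v A hA => ?_, fun loc b hb => ?_⟩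
  · refine (hB x v A hA _ le_rfl).trans ?_
    gcongr; omega
  obtain ⟨cf, hcf⟩ := hf loc b hb
  obtain ⟨ch, hch⟩ := hh loc (b + 2) (fun i => (hb i).trans (by omega))
  obtain ⟨cg, hcg⟩ := hg (cons (b + 1) (cons b loc)) (b + 3) (by
    rintro (_ | _ | i)
    · simp
    · simp
    · simpa using (hb i).trans (by omega))
  refine ⟨.seq cf (.seq ch (.seq (.clear (b + 1)) (.loop (.nz (b + 2)) (.seq cg (.seq
    (.transfer (b + 3) b) (.seq (.inc (b + 1)) (.dec (b + 2)))))))), fun x A M σ hA hM => ?_⟩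
  set N := x.length + A + 1 with hN
  set v : ι → ℕ := fun i => σ.reg (loc i) with hv
  have hM' : Kf * N + Kh * N + B * N + Kg * ((2 + Kh + B) * N) ≤ M := by
    rw [← mul_assoc, ← add_mul, ← add_mul, ← add_mul]; exact hM
  obtain ⟨σ1, e1, r1, p1, u1⟩ := hcf x A M σ hA (by rw [← hN]; omega)
  have hv1 : (fun i => σ1.reg (loc i)) = v := funext fun i => p1 _ (hb i)
  obtain ⟨σ2, e2, r2, p2, u2⟩ := hch x A M σ1 (fun i => by rw [p1 _ (hb i)]; exact hA i)
    (by rw [← hN]; omega)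
  rw [hv1] at r2 u2
  have hH : h x v ≤ Kh * N := bh x v A hA
  have hrec : ∀ i ≤ h x v, recVal f g x v i ≤ B * N := hB x v A hA
  -- Loop invariant after `t` rounds, with `n` rounds to go.
  have key : ∀ n t (τ : Store Letter), t + n = h x v → τ.reg b = recVal f g x v t →
      τ.reg (b + 1) = t → τ.reg (b + 2) = n → (∀ r < b, τ.reg r = σ.reg r) →
      ∃ τ', Exec M x (.loop (.nz (b + 2)) (.seq cg (.seq
        (.transfer (b + 3) b) (.seq (.inc (b + 1)) (.dec (b + 2)))))) τ τ' ∧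
        τ'.reg b = recVal f g x v (h x v) ∧ (∀ r < b, τ'.reg r = σ.reg r) ∧
        τ'.out = τ.out ++ ((List.range' t n).flatMap
          fun i => o x (cons i (cons (recVal f g x v i) v))) := by
    intro n
    induction n with
    | zero =>
      intro t τ ht hb0 _ hb2 hp
      exact ⟨τ, .loopF (by simp [Test.eval, hb2]), by rw [hb0, ← ht]; rfl, hp, by simp⟩
    | succ n ih =>
      intro t τ ht hb0 hb1 hb2 hp
      have hvτ : (fun i => τ.reg (loc i)) = v := funext fun i => hp _ (hb i)
      have henv : (fun i => τ.reg (cons (b + 1) (cons b loc) i)) =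
          cons t (cons (recVal f g x v t) v) := by
        funext i
        rcases i with _ | _ | i
        · simpa using hb1
        · simpa using hb0
        · exact congrFun hvτ i
      have hbd : ∀ i, τ.reg (cons (b + 1) (cons b loc) i) ≤ A + Kh * N + B * N := by
        intro i
        rw [congrFun henv i]
        rcases i with _ | _ | i
        · simp only [cons_none]; omega
        · have := hrec t (by omega)
          simp only [cons_some, cons_none]; omega
        · have := hA i
          simp only [cons_some, hv]; omega
      have hKg : Kg * (x.length + (A + Kh * N + B * N) + 1) ≤ M := by
        refine le_trans (Nat.mul_le_mul_left _ ?_) ((Nat.le_add_left _ _).trans hM')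
        rw [add_mul, add_mul]; omega
      obtain ⟨τ1, f1, s1, q1, w1⟩ := hcg x _ M τ hbd hKg
      rw [henv] at s1 w1
      have hnext := hrec (t + 1) (by omega)
      have s1' : τ1.reg (b + 3) = recVal f g x v (t + 1) := s1
      obtain ⟨τ2, f2, s2, q2, w2⟩ := Exec.transfer (M := M) (x := x) τ1
        (show b + 3 ≠ b by omega) (by rw [s1']; omega)
      have t1 : τ2.reg (b + 1) = t := by
        rw [q2 _ (by omega) (by omega), q1 _ (by omega), hb1]
      have t2 : τ2.reg (b + 2) = n + 1 := by
        rw [q2 _ (by omega) (by omega), q1 _ (by omega), hb2]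
      let τ3 := τ2.set (b + 1) (τ2.reg (b + 1) + 1)
      have t3 : τ3.reg (b + 2) = n + 1 := by rw [Store.set_reg_ne _ _ (by omega), t2]
      let τ4 := τ3.set (b + 2) (τ3.reg (b + 2) - 1)
      obtain ⟨τ', f', s', q', w'⟩ := ih (t + 1) τ4 (by omega)
        (by rw [Store.set_reg_ne _ _ (by omega), Store.set_reg_ne _ _ (by omega), s2, s1'])
        (by rw [Store.set_reg_ne _ _ (by omega)]; simp [τ3, t1])
        (by simp [τ4, t3])
        (fun r hr => by
          rw [Store.set_reg_ne _ _ (by omega), Store.set_reg_ne _ _ (by omega),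
            q2 _ (by omega) (by omega), q1 _ (by omega), hp r hr])
      refine ⟨τ', .loopT (by simp [Test.eval, hb2]) (.seq f1 (.seq f2 (.seq
        (.inc τ2 _ (by omega)) (.dec τ3 _ (by omega))))) f', s', q', ?_⟩
      rw [w', show τ4.out = τ2.out from rfl, w2, w1, List.range'_succ]
      simp
  obtain ⟨τ, e3, r3, p3, u3⟩ := key (h x v) 0 (σ2.set (b + 1) 0) (by omega)
    (by rw [Store.set_reg_ne _ _ (by omega), p2 _ (by omega), r1]; rfl) (by simp)
    (by rw [Store.set_reg_ne _ _ (by omega), r2])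
    (fun r hr => by rw [Store.set_reg_ne _ _ (by omega), p2 _ (by omega), p1 _ hr])
  refine ⟨τ, .seq e1 (.seq e2 (.seq (.clear _ _) e3)), r3, p3, ?_⟩
  rw [u3, Store.set_out, u2, u1, hv]
  simp [List.append_assoc, List.range_eq_range']

/-- Test whether the input has letter `s` at a position. -/
theorem LFO.read {f : List Letter → (ι → ℕ) → ℕ} (hf : LF f) (s : Letter) :
    LF fun x v => if x[f x v]? = some s then 1 else 0 := by
  obtain ⟨K, hK, h⟩ := hf
  refine ⟨K + 1, fun x v A _ => ?_, fun loc b hb => ?_⟩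
  · rw [add_mul]; dsimp only; split <;> omega
  obtain ⟨c, hc⟩ := h loc b hb
  refine ⟨.seq c (.seq .rewind (.seq .inR (.seq (.loop (.nz b) (.seq (.dec b) .inR))
    (.ite (.sym fun c => match c with | .sym s' => s' == s | _ => false) (.inc b) .skip)))),
    fun x A M σ hA hM => ?_⟩
  rw [add_mul] at hM
  obtain ⟨σ1, e1, r1, p1, u1⟩ := hc x A M σ hA (by omega)
  simp only [List.append_nil] at u1
  have key : ∀ n (τ : Store Letter), τ.reg b = n → τ.pos ≤ x.length + 1 →
      Exec M x (.loop (.nz b) (.seq (.dec b) .inR)) τ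
        { τ.set b 0 with pos := min (τ.pos + n) (x.length + 1) } := by
    intro n
    induction n with
    | zero =>
      intro τ h0 hp
      have : ({ τ.set b 0 with pos := min (τ.pos + 0) (x.length + 1) } : Store Letter) = τ := by
        rw [Nat.add_zero, min_eq_left hp, ← h0]
        simp [Store.set]
      rw [this]
      exact .loopF (by simp [Test.eval, h0])
    | succ n ih =>
      intro τ h0 hp
      refine .loopT (by simp [Test.eval, h0]) (.seq (.dec τ b (by omega)) (.inR _)) ?_
      convert ih _ _ _ using 1
      · simp only [Store.set, Function.update_idem, Store.mk.injEq, true_and, and_true]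
        omega
      · simp [Store.set, h0]
      · simp
  have e2 := key _ { σ1 with pos := min (0 + 1) (x.length + 1) } rfl (by simp)
  simp only [r1] at e2
  set v : ι → ℕ := fun i => σ.reg (loc i) with hv
  set σ2 : Store Letter := { ({ σ1 with pos := min (0 + 1) (x.length + 1) } : Store Letter).set b 0
    with pos := min (min (0 + 1) (x.length + 1) + f x v) (x.length + 1) } with hσ2
  have hb2 : σ2.reg b = 0 := by simp [hσ2, Store.set]
  -- A value beyond the input leaves the head on the right end marker, in agreement with `x[f x v]?
  -- = none`.
  have hp2 : σ2.pos = min (f x v) x.length + 1 := by simp only [hσ2]; omega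
  have hr2 : ∀ r < b, σ2.reg r = σ.reg r := fun r hr => by
    rw [← p1 r hr]; simp [hσ2, Store.set, hr.ne]
  have ho2 : σ2.out = σ.out := by simp only [hσ2, Store.set]; exact u1
  have pre := fun τ h => Exec.seq e1 (.seq (.rewind σ1) (.seq (.inR { σ1 with pos := 0 })
    (.seq e2 (h : Exec M x (.ite (.sym fun c => match c with | .sym s' => s' == s | _ => false)
      (.inc b) .skip) σ2 τ))))
  have hread : readInput x σ2.pos =
      match x[f x v]? with | some s' => .sym s' | none => .rightEnd := by
    rw [hp2]
    simp only [readInput]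
    rcases lt_or_ge (f x v) x.length with hl | hl
    · rw [min_eq_left hl.le]
      cases x[f x v]? <;> rfl
    · rw [min_eq_right hl, List.getElem?_eq_none hl, List.getElem?_eq_none le_rfl]
  by_cases hs : x[f x v]? = some s
  · refine ⟨_, pre _ (.iteT ?_ (.inc σ2 b (by omega))), ?_, fun r hr => ?_, by simp [ho2]⟩
    · simp [Test.eval, hread, hs]
    · simp [hb2, hs]
    · rw [Store.set_reg_ne _ _ (by omega), hr2 r hr]
  · refine ⟨_, pre _ (.iteF ?_ (.skip σ2)), ?_, hr2, by simp [ho2]⟩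
    · simp only [Test.eval, hread]
      rcases hx : x[f x v]? with _ | s'
      · rfl
      · rw [hx] at hs
        simpa using hs
    · simp [hb2, hs]

theorem LFO.length : LF (ι := ι) fun x _ => x.length := by
  refine ⟨1, fun x v A h => by dsimp only; omega, fun loc b hb => ⟨.seq .rewind (.seq (.clear b) (.seq .inR
    (.loop (.sym fun c => match c with | .sym _ => true | _ => false)
      (.seq (.inc b) .inR)))), ?_⟩⟩
  intro x A M σ hA hM
  have key : ∀ n (τ : Store Letter), τ.pos = τ.reg b + 1 → τ.reg b + n = x.length →
      ∃ τ', Exec M x (.loop (.sym fun c => match c with | .sym _ => true | _ => false)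
        (.seq (.inc b) .inR)) τ τ' ∧ τ'.reg b = x.length ∧ (∀ r < b, τ'.reg r = τ.reg r) ∧
        τ'.out = τ.out := by
    intro n
    induction n with
    | zero =>
      intro τ h1 h2
      refine ⟨τ, .loopF ?_, h2, fun _ _ => rfl, rfl⟩
      simp [Test.eval, h1, readInput, show τ.reg b = x.length by omega]
    | succ n ih =>
      intro τ h1 h2
      obtain ⟨τ', f1, f2, f3, f4⟩ := ih
        { τ.set b (τ.reg b + 1) with pos := min (τ.pos + 1) (x.length + 1) }
        (by simp [Store.set]; omega) (by simp [Store.set]; omega)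
      refine ⟨τ', .loopT ?_ (.seq (.inc τ b (by omega)) (.inR _)) f1, f2, fun r hr => ?_, f4⟩
      · simp [Test.eval, h1, readInput, List.getElem?_eq_getElem (show τ.reg b < x.length by omega)]
      · rw [f3 r hr]; exact Store.set_reg_ne _ _ (by omega)
  obtain ⟨τ', f1, f2, f3, f4⟩ := key x.length
    { ({ σ with pos := 0 } : Store Letter).set b 0 with pos := min (0 + 1) (x.length + 1) }
    (by simp [Store.set]) (by simp [Store.set])
  refine ⟨τ', .seq (.rewind _) (.seq (.clear _ _) (.seq (.inR _) f1)), f2, fun r hr => ?_, ?_⟩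
  · rw [f3 r hr]; exact Store.set_reg_ne _ _ (by omega)
  · rw [f4]; simp [Store.set]

theorem LFO.letter (s : Letter) : OutP (ι := ι) fun _ _ => [s] := by
  refine ⟨0, fun x v A h => by simp, fun loc b hb => ⟨.seq (.clear b) (.out s), ?_⟩⟩
  intro x A M σ hA hM
  exact ⟨_, .seq (.clear σ b) (.out _ s), by simp, fun r hr => Store.set_reg_ne _ _ (by omega),
    by simp⟩

/-- Run one program after the other and keep the value of the second. -/
theorem LFO.append {f f' : List Letter → (ι → ℕ) → ℕ} {g g' : List Letter → (ι → ℕ) → List Letter}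
    (h : LFO f g) (h' : LFO f' g') : LFO f' fun x v => g x v ++ g' x v := by
  obtain ⟨K, -, h⟩ := h
  obtain ⟨K', hK', h'⟩ := h'
  refine ⟨K + K', fun x v A hA => (hK' x v A hA).trans (by gcongr; omega), fun loc b hb => ?_⟩
  obtain ⟨c, hc⟩ := h loc b hb
  obtain ⟨c', hc'⟩ := h' loc b hb
  refine ⟨.seq c c', fun x A M σ hA hM => ?_⟩
  rw [add_mul] at hM
  obtain ⟨σ1, e1, r1, p1, u1⟩ := hc x A M σ hA (by omega)
  have hv : (fun i => σ1.reg (loc i)) = fun i => σ.reg (loc i) := funext fun i => p1 _ (hb i)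
  obtain ⟨σ2, e2, r2, p2, u2⟩ := hc' x A M σ1 (fun i => by rw [p1 _ (hb i)]; exact hA i) (by omega)
  rw [hv] at r2 u2
  exact ⟨σ2, .seq e1 e2, r2, fun r hr => by rw [p2 r hr, p1 r hr], by rw [u2, u1]; simp⟩

theorem LFO.rename {f : List Letter → (ι → ℕ) → ℕ} {g} (h : LFO f g) (ρ : ι → κ) :
    LFO (fun x (v : κ → ℕ) => f x (fun i => v (ρ i))) (fun x v => g x (fun i => v (ρ i))) := by
  obtain ⟨K, hK, h⟩ := h
  refine ⟨K, fun x v A hA => hK x _ A fun i => hA _, fun loc b hb => ?_⟩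
  obtain ⟨c, hc⟩ := h (fun i => loc (ρ i)) b fun i => hb _
  exact ⟨c, fun x A M σ hA hM => hc x A M σ (fun i => hA _) hM⟩

/-- An output function without arguments is computed by a log-space transducer. -/
theorem LFO.exists_transducer {f : List Letter → (Empty → ℕ) → ℕ}
    {g : List Letter → (Empty → ℕ) → List Letter} (h : LFO f g) :
    ∃ M : Transducer Letter Letter, M.RunsInLogSpace ∧ ∀ x, M.Outputs x (g x Empty.elim) := by
  obtain ⟨K, -, h⟩ := h
  obtain ⟨c, hc⟩ := h Empty.elim 0 (fun i => i.elim)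
  refine LogSpace.exists_transducer c K _ fun x => ?_
  obtain ⟨σ, h1, -, -, h2⟩ := hc x 0 _ Store.init (fun i => i.elim) le_rfl
  refine ⟨σ, h1, ?_⟩
  rw [h2, show (fun i => Store.init.reg (Empty.elim i)) = Empty.elim from funext fun i => i.elim]
  simp [Store.init]

end LogSpace

/-! ### Closure properties of log-space functions and predicates -/

namespace LogSpace

open Classical in
/-- The indicator of a proposition. -/
noncomputable def ind (p : Prop) : ℕ := if p then 1 else 0

@[simp] theorem ind_pos {p : Prop} : 0 < ind p ↔ p := by unfold ind; split <;> simp_all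

theorem ind_of {p : Prop} (h : p) : ind p = 1 := if_pos h

theorem ind_of_not {p : Prop} (h : ¬ p) : ind p = 0 := if_neg h

variable {ι κ J : Type}

/-- Decidability in logarithmic space. -/
abbrev LP (φ : List Letter → (ι → ℕ) → Prop) : Prop := LF fun x v => ind (φ x v)

/-- Linear boundedness. -/
def LinBdd (f : List Letter → (ι → ℕ) → ℕ) : Prop :=
  ∃ K, ∀ x v A, (∀ i, v i ≤ A) → f x v ≤ K * (x.length + A + 1)

theorem LFO.linBdd {f : List Letter → (ι → ℕ) → ℕ} {g} (h : LFO f g) : LinBdd f :=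
  ⟨h.choose, h.choose_spec.1⟩

theorem LinBdd.add {f g : List Letter → (ι → ℕ) → ℕ} (hf : LinBdd f) (hg : LinBdd g) :
    LinBdd fun x v => f x v + g x v := by
  obtain ⟨K, hK⟩ := hf
  obtain ⟨L, hL⟩ := hg
  refine ⟨K + L, fun x v A hA => ?_⟩
  rw [add_mul]
  exact Nat.add_le_add (hK x v A hA) (hL x v A hA)

theorem LF.congr {f g : List Letter → (ι → ℕ) → ℕ} (h : LF f) (e : ∀ x v, f x v = g x v) :
    LF g := by
  rwa [show g = f from funext fun x => funext fun v => (e x v).symm]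

theorem LP.congr {φ ψ : List Letter → (ι → ℕ) → Prop} (h : LP φ) (e : ∀ x v, φ x v ↔ ψ x v) :
    LP ψ := LF.congr h fun x v => by rw [propext (e x v)]

theorem LFO.weaken {f : List Letter → (ι → ℕ) → ℕ} {g} (h : LFO f g) :
    LFO (fun x (w : Option ι → ℕ) => f x fun i => w (some i))
      (fun x w => g x fun i => w (some i)) := h.rename some

theorem LF.rename {f : List Letter → (ι → ℕ) → ℕ} (h : LF f) (ρ : ι → κ) :
    LF fun x (v : κ → ℕ) => f x fun i => v (ρ i) := LFO.rename h ρ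

theorem LF.weaken {f : List Letter → (ι → ℕ) → ℕ} (h : LF f) :
    LF fun x (w : Option ι → ℕ) => f x fun i => w (some i) := LFO.weaken h

theorem LP.rename {φ : List Letter → (ι → ℕ) → Prop} (h : LP φ) (ρ : ι → κ) :
    LP fun x (v : κ → ℕ) => φ x fun i => v (ρ i) := LFO.rename h ρ

theorem LP.weaken {φ : List Letter → (ι → ℕ) → Prop} (h : LP φ) :
    LP fun x (w : Option ι → ℕ) => φ x fun i => w (some i) := LFO.weaken h

/-- Bounded primitive recursion. -/
theorem LF.recur {f h ℓ : List Letter → (ι → ℕ) → ℕ} {g : List Letter → (Option (Option ι) → ℕ) → ℕ}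
    (r : List Letter → (ι → ℕ) → ℕ → ℕ) (hf : LF f) (hh : LF h) (hg : LF g)
    (h0 : ∀ x v, r x v 0 = f x v)
    (hs : ∀ x v i, i < h x v → r x v (i + 1) = g x (cons i (cons (r x v i) v)))
    (hℓ : LinBdd ℓ) (hB : ∀ x v, ∀ i ≤ h x v, r x v i ≤ ℓ x v) :
    LF fun x v => r x v (h x v) := by
  have e : ∀ x v, ∀ i ≤ h x v, recVal f g x v i = r x v i := by
    intro x v i
    induction i with
    | zero => exact fun _ => (h0 x v).symm
    | succ i ih => exact fun hi => by rw [hs x v i hi, ← ih (by omega)]; rfl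
  have := LFO.recursion hf hh hg (by
    obtain ⟨K, hK⟩ := hℓ
    refine ⟨K, fun x v A hA i hi => ?_⟩
    rw [e x v i hi]
    exact (hB x v i hi).trans (hK x v A hA))
  simp only [List.append_nil] at this
  refine LF.congr (f := fun x v => recVal f g x v (h x v)) ?_ (fun x v => e x v _ le_rfl)
  convert this using 3
  simp

theorem LF.add {f g : List Letter → (ι → ℕ) → ℕ} (hf : LF f) (hg : LF g) :
    LF fun x v => f x v + g x v :=
  LF.recur (fun x v i => f x v + i) hf hg (LFO.var (some none)).succ (fun _ _ => rfl)
    (fun _ _ _ _ => rfl) (hf.linBdd.add hg.linBdd) (fun _ _ _ hi => Nat.add_le_add_left hi _)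

theorem LF.sub {f g : List Letter → (ι → ℕ) → ℕ} (hf : LF f) (hg : LF g) :
    LF fun x v => f x v - g x v :=
  LF.recur (fun x v i => f x v - i) hf hg (LFO.var (some none)).pred (fun _ _ => rfl)
    (fun _ _ _ _ => rfl) hf.linBdd (fun _ _ _ _ => Nat.sub_le _ _)

theorem LF.const (n : ℕ) : LF (ι := ι) fun _ _ => n := by
  induction n with
  | zero => exact LFO.zero
  | succ n ih => exact ih.succ

/-- Substitution. -/
theorem LF.bind {f : List Letter → (Option ι → ℕ) → ℕ} {g : List Letter → (ι → ℕ) → ℕ}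
    (hf : LF f) (hg : LF g) : LF fun x v => f x (cons (g x v) v) := by
  -- Composition is a recursion with a single round: it starts with the value of the inner function
  -- and applies the outer one to it.
  have key := LF.recur (f := g) (h := fun _ _ => 1) (ℓ := fun x v => g x v + f x (cons (g x v) v))
    (g := fun x w => f x fun o => w (o.elim (some none) fun i => some (some i)))
    (fun x v i => if i = 0 then g x v else f x (cons (g x v) v)) hg (LF.const 1)
    (hf.rename fun o => o.elim (some none) fun i => some (some i)) (fun _ _ => rfl) ?_ ?_ ?_
  · simpa using key
  · intro x v i hi
    obtain rfl : i = 0 := by omega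
    simp only [Nat.zero_add, one_ne_zero, if_false, if_true]
    congr 1
    funext o
    cases o <;> rfl
  · obtain ⟨K, hK⟩ := hf.linBdd
    refine hg.linBdd.add ?_
    obtain ⟨L, hL⟩ := hg.linBdd
    refine ⟨K * (L + 1), fun x v A hA => (hK x _ (A + L * (x.length + A + 1)) ?_).trans ?_⟩
    · rintro (_ | i)
      · exact (hL x v A hA).trans (Nat.le_add_left _ _)
      · exact (hA i).trans (Nat.le_add_right _ _)
    · rw [mul_assoc]
      refine Nat.mul_le_mul_left _ ?_
      rw [add_mul]; omega
  · intro x v i _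
    split <;> omega

-- A recursion with `ind (φ x v)` rounds whose step ignores the previous value: no round leaves `g`,
-- one round yields `f`.
open Classical in
theorem LF.ite {φ : List Letter → (ι → ℕ) → Prop} {f g : List Letter → (ι → ℕ) → ℕ} (hφ : LP φ)
    (hf : LF f) (hg : LF g) : LF fun x v => if φ x v then f x v else g x v := by
  have := LF.recur (fun x v i => if 0 < i then f x v else g x v) hg hφ hf.weaken.weaken
    (fun _ _ => by simp) (fun _ _ i _ => by simp) (hf.linBdd.add hg.linBdd) (fun x v i _ => by
      split <;> omega)
  simpa using this

namespace LP

variable {φ ψ : List Letter → (ι → ℕ) → Prop} {f g : List Letter → (ι → ℕ) → ℕ}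

theorem not (h : LP φ) : LP fun x v => ¬ φ x v :=
  LF.congr ((LF.const 1).sub h) fun x v => by
    by_cases hp : φ x v
    · rw [ind_of hp, ind_of_not (not_not.2 hp)]
    · rw [ind_of_not hp, ind_of hp]

theorem and (h : LP φ) (h' : LP ψ) : LP fun x v => φ x v ∧ ψ x v :=
  LF.congr (LF.ite h h' (LF.const 0)) fun x v => by
    by_cases hp : φ x v <;> by_cases hp' : ψ x v <;> simp [hp, hp', ind]

theorem or (h : LP φ) (h' : LP ψ) : LP fun x v => φ x v ∨ ψ x v :=
  (h.not.and h'.not).not.congr fun x v => by tauto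

theorem imp (h : LP φ) (h' : LP ψ) : LP fun x v => φ x v → ψ x v :=
  (h.not.or h').congr fun x v => by tauto

theorem iff (h : LP φ) (h' : LP ψ) : LP fun x v => (φ x v ↔ ψ x v) :=
  ((h.imp h').and (h'.imp h)).congr fun x v => by tauto

theorem const (p : Prop) : LP (ι := ι) fun _ _ => p := LF.const _

theorem le (hf : LF f) (hg : LF g) : LP fun x v => f x v ≤ g x v :=
  LF.congr ((LF.const 1).sub (hf.sub hg)) fun x v => by
    by_cases hp : f x v ≤ g x v
    · rw [ind_of hp]; omega
    · rw [ind_of_not hp]; omega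

theorem lt (hf : LF f) (hg : LF g) : LP fun x v => f x v < g x v := le hf.succ hg

theorem eq (hf : LF f) (hg : LF g) : LP fun x v => f x v = g x v :=
  ((le hf hg).and (le hg hf)).congr fun x v => by omega

theorem letterAt (hf : LF f) (s : Letter) : LP fun x v => x[f x v]? = some s :=
  LF.congr (hf.read s) fun x v => by
    by_cases hp : x[f x v]? = some s
    · rw [ind_of hp, if_pos hp]
    · rw [ind_of_not hp, if_neg hp]

end LP

-- Bounded quantifiers arise by comparing such a count with zero; the column sums of a binary
-- product are counts of this kind as well.
open Classical in
theorem LF.count {φ : List Letter → (ι → ℕ) → ℕ → Prop} {f : List Letter → (ι → ℕ) → ℕ}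
    (hφ : LP fun x (w : Option ι → ℕ) => φ x (fun i => w (some i)) (w none)) (hf : LF f) :
    LF fun x v => Nat.count (φ x v) (f x v) :=
  LF.recur (ι := ι) (h := f) (ℓ := f) (f := fun _ _ => 0) (fun x v i => Nat.count (φ x v) i)
    (LF.const 0) hf (LF.add (LFO.var (some none)) (hφ.rename (ι := Option ι)
      (κ := Option (Option ι)) fun o => o.elim none fun i => some (some i)))
    (fun _ _ => Nat.count_zero _) (fun x v i _ => by
      rw [Nat.count_succ]
      rfl)
    hf.linBdd fun x v i hi => (Nat.count_le _).trans hi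

namespace LP

variable {φ : List Letter → (ι → ℕ) → ℕ → Prop} {f : List Letter → (ι → ℕ) → ℕ}

open Classical in
theorem ex (hf : LF f) (hφ : LP fun x (w : Option ι → ℕ) => φ x (fun i => w (some i)) (w none)) :
    LP fun x v => ∃ i < f x v, φ x v i :=
  (LP.lt (LF.const 0) (LF.count hφ hf)).congr fun x v => by
    rw [Nat.pos_iff_ne_zero, Ne, Nat.count_iff_forall_not]
    push Not
    rfl

theorem all (hf : LF f) (hφ : LP fun x (w : Option ι → ℕ) => φ x (fun i => w (some i)) (w none)) :
    LP fun x v => ∀ i < f x v, φ x v i :=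
  (ex (φ := fun x v i => ¬ φ x v i) hf hφ.not).not.congr fun x v => by push Not; rfl

theorem bind {φ : List Letter → (ι → ℕ) → ℕ → Prop}
    (hφ : LP fun x (w : Option ι → ℕ) => φ x (fun i => w (some i)) (w none)) (hf : LF f) :
    LP fun x v => φ x v (f x v) := LF.bind hφ hf

end LP

/-! ### Bounded minimisation, finite lookup tables and search for vectors -/

open Classical in
/-- The least number below `n` that satisfies `p`, or `n` if there is none. -/
noncomputable def find (p : ℕ → Prop) : ℕ → ℕ
  | 0 => 0
  | n + 1 => if p (find p n) then find p n else find p n + 1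

theorem find_le (p : ℕ → Prop) (n : ℕ) : find p n ≤ n := by
  induction n with
  | zero => rfl
  | succ n ih => rw [find]; split <;> omega

theorem not_of_lt_find {p : ℕ → Prop} {n i : ℕ} (h : i < find p n) : ¬ p i := by
  induction n with
  | zero => simp [find] at h
  | succ n ih =>
    rw [find] at h
    split at h
    · exact ih h
    · rcases Nat.lt_succ_iff_lt_or_eq.1 h with h | rfl
      · exact ih h
      · assumption

theorem find_spec_or {p : ℕ → Prop} (n : ℕ) : p (find p n) ∨ find p n = n := by
  induction n with
  | zero => exact Or.inr rfl
  | succ n ih =>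
    by_cases hp : p (find p n)
    · left; rw [find, if_pos hp]; exact hp
    · right; rw [find, if_neg hp]; have := ih.resolve_left hp; omega

theorem find_spec {p : ℕ → Prop} {n : ℕ} (h : ∃ i < n, p i) : find p n < n ∧ p (find p n) := by
  obtain ⟨i, hi, hp⟩ := h
  have h1 : find p n < n := by
    by_contra h
    exact not_of_lt_find (show i < find p n by omega) hp
  exact ⟨h1, (find_spec_or n).resolve_right h1.ne⟩

theorem find_eq {p : ℕ → Prop} {n i : ℕ} (hi : i < n) (hp : p i) (h : ∀ j < i, ¬ p j) :
    find p n = i := by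
  obtain ⟨h1, h2⟩ := find_spec ⟨i, hi, hp⟩
  rcases lt_trichotomy (find p n) i with h3 | h3 | h3
  · exact absurd h2 (h _ h3)
  · exact h3
  · exact absurd hp (not_of_lt_find h3)

/-- The recursion keeps a candidate as soon as it satisfies the property and increases it otherwise,
so the candidate is the only state. -/
theorem LF.find {φ : List Letter → (ι → ℕ) → ℕ → Prop} {f : List Letter → (ι → ℕ) → ℕ} (hf : LF f)
    (hφ : LP fun x (w : Option ι → ℕ) => φ x (fun i => w (some i)) (w none)) :
    LF fun x v => find (φ x v) (f x v) := by
  have hr : LP fun x (w : Option (Option ι) → ℕ) =>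
      φ x (fun i => w (some (some i))) (w (some none)) :=
    hφ.rename (κ := Option (Option ι)) fun o => o.elim (some none) fun i => some (some i)
  exact LF.recur (ι := ι) (h := f) (ℓ := f) (f := fun _ _ => 0) (fun x v i => LogSpace.find (φ x v) i)
    (LF.const 0) hf (LF.ite hr (LFO.var (some none)) (LFO.var (some none)).succ)
    (fun _ _ => rfl) (fun x v i _ => by rw [LogSpace.find]; rfl)
    hf.linBdd fun x v i hi => (find_le _ _).trans hi

theorem LF.div_two {f : List Letter → (ι → ℕ) → ℕ} (hf : LF f) : LF fun x v => f x v / 2 := by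
  refine LF.congr (LF.find (φ := fun x v i => f x v ≤ i + i + 1) hf.succ
    (LP.le hf.weaken ((LFO.var none).add (LFO.var none)).succ)) fun x v => ?_
  exact find_eq (by omega) (by omega) (fun j hj => by omega)

theorem LP.odd {f : List Letter → (ι → ℕ) → ℕ} (hf : LF f) : LP fun x v => f x v % 2 = 1 :=
  (LP.eq hf (hf.div_two.add hf.div_two).succ).congr fun x v => by omega

namespace LP

theorem forall_mem {φ : J → List Letter → (ι → ℕ) → Prop} (l : List J) (h : ∀ j ∈ l, LP (φ j)) :
    LP fun x v => ∀ j ∈ l, φ j x v := by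
  induction l with
  | nil => exact (const True).congr fun x v => by simp
  | cons a l ih =>
    exact ((h a (by simp)).and (ih fun j hj => h j (by simp [hj]))).congr fun x v => by simp

theorem forall_fin [Finite J] {φ : J → List Letter → (ι → ℕ) → Prop} (h : ∀ j, LP (φ j)) :
    LP fun x v => ∀ j, φ j x v := by
  have := Fintype.ofFinite J
  exact (forall_mem Finset.univ.toList fun j _ => h j).congr fun x v => by simp

theorem exists_fin [Finite J] {φ : J → List Letter → (ι → ℕ) → Prop} (h : ∀ j, LP (φ j)) :
    LP fun x v => ∃ j, φ j x v :=
  (forall_fin fun j => (h j).not).not.congr fun x v => by push Not; rfl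

/-- A property that is determined by finitely many tests is decidable if the tests are. -/
theorem of_determined [Finite J] {ψ : J → List Letter → (ι → ℕ) → Prop} (h : ∀ j, LP (ψ j))
    {φ : List Letter → (ι → ℕ) → Prop}
    (hφ : ∀ x v x' v', (∀ j, ψ j x v ↔ ψ j x' v') → φ x v → φ x' v') : LP φ := by
  -- The set `E` of tests that succeed ranges over a finite type. Whether `φ` holds somewhere with
  -- pattern `E` is a fixed proposition, hence a constant function. The machine is a lookup table
  -- that exists classically, and no procedure for `φ` is needed.
  refine (exists_fin (J := Set J) fun E => (const (∃ x v, (∀ j, ψ j x v ↔ j ∈ E) ∧ φ x v)).and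
    (forall_fin fun j => (h j).iff (const (j ∈ E)))).congr fun x v => ⟨?_, fun hv => ?_⟩
  · rintro ⟨E, ⟨x', v', h1, h2⟩, h3⟩
    exact hφ x' v' x v (fun j => (h1 j).trans (h3 j).symm) h2
  · exact ⟨{j | ψ j x v}, ⟨x, v, fun j => Iff.rfl, hv⟩, fun j => Iff.rfl⟩

end LP

/-- A bounded search for a vector. -/
theorem LP.exVec_fin (m : ℕ) {ι : Type} {φ : List Letter → (ι → ℕ) → (Fin m → ℕ) → Prop}
    {f : List Letter → (ι → ℕ) → ℕ} (hf : LF f)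
    (hφ : LP fun x (w : ι ⊕ Fin m → ℕ) => φ x (fun i => w (.inl i)) (fun j => w (.inr j))) :
    LP (fun x v => ∃ s : Fin m → ℕ, (∀ j, s j < f x v) ∧ φ x v s) ∧
    ∃ g : Fin m → List Letter → (ι → ℕ) → ℕ, (∀ j, LF (g j)) ∧
      ∀ x v, (∃ s : Fin m → ℕ, (∀ j, s j < f x v) ∧ φ x v s) →
        (∀ j, g j x v < f x v) ∧ φ x v fun j => g j x v := by
  induction m generalizing ι with
  | zero =>
    have e : ∀ x v (s : Fin 0 → ℕ), φ x v s ↔ φ x v Fin.elim0 := fun x v s => by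
      rw [Subsingleton.elim s Fin.elim0]
    constructor
    · refine (LP.rename (κ := ι) hφ (Sum.elim id fun j => j.elim0)).congr fun x v => ?_
      constructor
      · exact fun h => ⟨_, fun j => j.elim0, h⟩
      · rintro ⟨s, -, h⟩
        exact (e _ _ _).2 ((e _ _ _).1 h)
    · refine ⟨fun j => j.elim0, fun j => j.elim0, ?_⟩
      rintro x v ⟨s, -, h⟩
      exact ⟨fun j => j.elim0, (e _ _ _).2 ((e _ _ _).1 h)⟩
  | succ m ih =>
    obtain ⟨h1, g, h2, h3⟩ := ih (ι := Option ι)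
      (φ := fun x w s => φ x (fun i => w (some i)) (Fin.cons (w none) s)) hf.weaken (by
        refine (LP.rename (κ := Option ι ⊕ Fin m) hφ (Sum.elim (fun i => .inl (some i))
          (Fin.cons (.inl none) fun j => .inr j))).congr fun x w => ?_
        apply iff_of_eq
        congr 1
        funext j
        refine Fin.cases ?_ (fun j => ?_) j <;> simp)
    let P : List Letter → (ι → ℕ) → ℕ → Prop := fun x v i =>
      ∃ s : Fin m → ℕ, (∀ j, s j < f x v) ∧ φ x v (Fin.cons i s)
    have hP : ∀ x v, (∃ s : Fin (m + 1) → ℕ, (∀ j, s j < f x v) ∧ φ x v s) ↔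
        ∃ i < f x v, P x v i := by
      intro x v
      constructor
      · rintro ⟨s, hs, h⟩
        exact ⟨s 0, hs 0, fun j => s j.succ, fun j => hs _, by
          rwa [show (Fin.cons (s 0) fun j => s j.succ) = s from Fin.cons_self_tail s]⟩
      · rintro ⟨i, hi, s, hs, h⟩
        exact ⟨Fin.cons i s, fun j => by refine Fin.cases ?_ (fun j => ?_) j <;> simp [hi, hs], h⟩
    refine ⟨(LP.ex (φ := P) hf h1).congr fun x v => (hP x v).symm, ?_⟩
    have hi := LF.find (φ := P) hf h1
    -- The first coordinate is the least one that extends to a solution; it is then substituted into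
    -- the selectors for the remaining coordinates.
    refine ⟨Fin.cons (fun x v => find (P x v) (f x v)) fun j x v =>
      g j x (cons (find (P x v) (f x v)) v), ?_, fun x v hs => ?_⟩
    · intro j
      refine Fin.cases ?_ (fun j => ?_) j
      · exact hi
      · exact (h2 j).bind hi
    · obtain ⟨a1, a2⟩ := find_spec ((hP x v).1 hs)
      obtain ⟨b1, b2⟩ := h3 x (cons (find (P x v) (f x v)) v) a2
      constructor
      · intro j
        refine Fin.cases ?_ (fun j => ?_) j
        · exact a1
        · exact b1 j
      · have e : (fun j => (Fin.cons (fun x v => find (P x v) (f x v)) fun j x v =>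
            g j x (cons (find (P x v) (f x v)) v) : Fin (m + 1) → List Letter → (ι → ℕ) → ℕ) j x v) =
            Fin.cons (find (P x v) (f x v)) fun j => g j x (cons (find (P x v) (f x v)) v) := by
          funext j
          refine Fin.cases ?_ (fun j => ?_) j <;> simp
        rw [e]
        exact b2

theorem LP.exVec [Finite J] {φ : List Letter → (ι → ℕ) → (J → ℕ) → Prop}
    {f : List Letter → (ι → ℕ) → ℕ} (hf : LF f)
    (hφ : LP fun x (w : ι ⊕ J → ℕ) => φ x (fun i => w (.inl i)) (fun j => w (.inr j))) :
    LP (fun x v => ∃ s : J → ℕ, (∀ j, s j < f x v) ∧ φ x v s) ∧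
    ∃ g : J → List Letter → (ι → ℕ) → ℕ, (∀ j, LF (g j)) ∧
      ∀ x v, (∃ s : J → ℕ, (∀ j, s j < f x v) ∧ φ x v s) →
        (∀ j, g j x v < f x v) ∧ φ x v fun j => g j x v := by
  let e := Finite.equivFin J
  obtain ⟨h1, g, h2, h3⟩ := LP.exVec_fin (Nat.card J) (φ := fun x v s => φ x v fun j => s (e j)) hf
    (hφ.rename (κ := ι ⊕ Fin (Nat.card J)) (Sum.map id e))
  have hs : ∀ x v, (∃ s : Fin (Nat.card J) → ℕ, (∀ j, s j < f x v) ∧ φ x v fun j => s (e j)) ↔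
      ∃ s : J → ℕ, (∀ j, s j < f x v) ∧ φ x v s := fun x v =>
    ⟨fun ⟨s, a, b⟩ => ⟨fun j => s (e j), fun j => a _, b⟩,
      fun ⟨s, a, b⟩ => ⟨fun j => s (e.symm j), fun j => a _, by simpa using b⟩⟩
  refine ⟨h1.congr hs, fun j => g (e j), fun j => h2 _, fun x v h => ?_⟩
  obtain ⟨a, b⟩ := h3 x v ((hs x v).2 h)
  exact ⟨fun j => a _, b⟩

/-! ## Outputs -/

theorem OutP.weaken {g : List Letter → (ι → ℕ) → List Letter} (h : OutP g) :
    OutP fun x (w : Option ι → ℕ) => g x fun i => w (some i) := LFO.weaken h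

theorem OutP.congr {f g : List Letter → (ι → ℕ) → List Letter} (h : OutP f)
    (e : ∀ x v, f x v = g x v) : OutP g := by
  rwa [show g = f from funext fun x => funext fun v => (e x v).symm]

theorem OutP.nil : OutP (ι := ι) fun _ _ => [] := LFO.zero

theorem OutP.append {f g : List Letter → (ι → ℕ) → List Letter} (hf : OutP f) (hg : OutP g) :
    OutP fun x v => f x v ++ g x v := LFO.append hf hg

theorem OutP.flatMap {g : J → List Letter → (ι → ℕ) → List Letter} (l : List J)
    (h : ∀ j, OutP (g j)) : OutP fun x v => l.flatMap fun j => g j x v := by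
  induction l with
  | nil => exact OutP.nil
  | cons a l ih => exact ((h a).append ih).congr fun x v => by simp

theorem OutP.loop {f : List Letter → (ι → ℕ) → ℕ} {g : List Letter → (ι → ℕ) → ℕ → List Letter}
    (hf : LF f) (hg : OutP fun x (w : Option ι → ℕ) => g x (fun i => w (some i)) (w none)) :
    OutP fun x v => (List.range (f x v)).flatMap (g x v) := by
  have h0 : ∀ x (v : ι → ℕ) i, recVal (fun _ _ => 0) (fun _ _ => 0) x v i = 0 := by
    intro x v i; cases i <;> rfl
  have := LFO.recursion (f := fun _ _ => 0) LFO.zero hf (hg.rename (κ := Option (Option ι))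
    fun o => o.elim none fun i => some (some i)) ⟨0, fun x v A _ i _ => by rw [h0]; simp⟩
  simp only [h0] at this
  exact OutP.congr this fun x v => by simp

-- Two loops, with `ind (φ x v)` and `ind (¬ φ x v)` rounds, exactly one of which runs.
open Classical in
theorem OutP.ite {φ : List Letter → (ι → ℕ) → Prop} {f g : List Letter → (ι → ℕ) → List Letter}
    (hφ : LP φ) (hf : OutP f) (hg : OutP g) : OutP fun x v => if φ x v then f x v else g x v :=
  ((OutP.loop (g := fun x v _ => f x v) hφ hf.weaken).append
    (OutP.loop (g := fun x v _ => g x v) hφ.not hg.weaken)).congr fun x v => by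
    by_cases hp : φ x v <;> simp [hp, ind]

end LogSpace

namespace LogSpace

variable {ι κ J : Type}

/-! ## Strings of bits in the input -/

/-- The maximal run of bits at the beginning of a string. -/
def word : List Letter → List Bool
  | .bit b :: y => b :: word y
  | _ => []

def IsBit (o : Option Letter) : Prop := o = some (.bit true) ∨ o = some (.bit false)

theorem word_append (w : List Bool) {z : List Letter} (hz : ¬ IsBit z.head?) :
    word (encodeName w ++ z) = w := by
  induction w with
  | nil =>
    rcases z with _ | ⟨s, z⟩
    · rfl
    · cases s with
      | bit b => cases b <;> simp [IsBit] at hz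
      | _ => rfl
  | cons b w ih => simpa [encodeName, word] using ih

theorem getElem?_of_lt_word {y : List Letter} {i : ℕ} (hi : i < (word y).length) :
    y[i]? = some (.bit (word y)[i]) := by
  induction y generalizing i with
  | nil => simp [word] at hi
  | cons s y ih =>
    cases s with
    | bit b =>
      rcases i with _ | i
      · simp [word]
      · simpa [word] using ih (by simpa [word] using hi)
    | _ => simp [word] at hi

theorem not_isBit_word (y : List Letter) : ¬ IsBit y[(word y).length]? := by
  induction y with
  | nil => simp [word, IsBit]
  | cons s y ih =>
    cases s with
    | bit b => simpa [word] using ih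
    | _ => simp [word, IsBit]

theorem length_word_le (y : List Letter) : (word y).length ≤ y.length := by
  induction y with
  | nil => simp [word]
  | cons s y ih =>
    cases s with
    | bit b => simpa [word] using ih
    | _ => simp [word]

theorem LF.length_word {f : List Letter → (ι → ℕ) → ℕ} (hf : LF f) :
    LF fun x v => (word (x.drop (f x v))).length := by
  refine LF.congr (LF.find (φ := fun x v i => ¬ IsBit x[f x v + i]?) LFO.length.succ
    (LP.not ((LP.letterAt (hf.weaken.add (LFO.var none)) _).or
      (LP.letterAt (hf.weaken.add (LFO.var none)) _)))) fun x v => ?_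
  have h1 := length_word_le (x.drop (f x v))
  rw [List.length_drop] at h1
  refine find_eq (by omega) ?_ fun j hj => ?_
  · simpa using not_isBit_word (x.drop (f x v))
  · have := getElem?_of_lt_word hj
    rw [List.getElem?_drop] at this
    rw [this, not_not, IsBit]
    cases (word (x.drop (f x v)))[j] <;> simp

theorem eq_of_bits {u w : List Bool} (h : u.length = w.length)
    (h' : ∀ i < u.length, (u[i]? = some true ↔ w[i]? = some true)) : u = w := by
  refine List.ext_getElem h fun i h1 h2 => ?_
  have := h' i h1
  rw [List.getElem?_eq_getElem h1, List.getElem?_eq_getElem h2] at this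
  rw [Bool.eq_iff_iff]
  simpa using this

/-- Functions with strings as values, whose length and whose bits are computable. -/
def NF (N : List Letter → (ι → ℕ) → List Bool) : Prop :=
  LF (fun x v => (N x v).length) ∧
    LP fun x (w : Option ι → ℕ) => (N x fun i => w (some i))[w none]? = some true

namespace NF

variable {N N' : List Letter → (ι → ℕ) → List Bool}

theorem rename (h : NF N) (ρ : ι → κ) : NF fun x (v : κ → ℕ) => N x fun i => v (ρ i) :=
  ⟨LFO.rename h.1 ρ, LP.rename (κ := Option κ) h.2 (Option.map ρ)⟩

theorem weaken (h : NF N) : NF fun x (w : Option ι → ℕ) => N x fun i => w (some i) := h.rename some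

theorem congr (h : NF N) (e : ∀ x v, N x v = N' x v) : NF N' := by
  rwa [show N' = N from funext fun x => funext fun v => (e x v).symm]

theorem const (w : List Bool) : NF (ι := ι) fun _ _ => w := by
  refine ⟨LF.const _, ?_⟩
  refine (LP.exists_fin (J := Fin w.length) (φ := fun j _ v => v none = j ∧ w[j] = true)
    fun j => (LP.eq (LFO.var none) (LF.const _)).and (LP.const _)).congr fun x v => ?_
  rw [List.getElem?_eq_some_iff]
  constructor
  · rintro ⟨j, h1, h2⟩
    exact ⟨h1 ▸ j.2, by simpa [h1] using h2⟩
  · rintro ⟨h1, h2⟩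
    exact ⟨⟨_, h1⟩, rfl, h2⟩

open Classical in
theorem ite {φ : List Letter → (ι → ℕ) → Prop} (hφ : LP φ) (h : NF N) (h' : NF N') :
    NF fun x v => if φ x v then N x v else N' x v := by
  refine ⟨LF.congr (LF.ite hφ h.1 h'.1) fun x v => by dsimp only; split <;> rfl,
    ((hφ.weaken.and h.2).or (hφ.weaken.not.and h'.2)).congr fun x v => ?_⟩
  dsimp only
  split <;> simp [*]

theorem word {f : List Letter → (ι → ℕ) → ℕ} (hf : LF f) :
    NF fun x v => word (x.drop (f x v)) := by
  refine ⟨hf.length_word, ?_⟩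
  refine ((LP.lt (LFO.var none) hf.length_word.weaken).and
    (LP.letterAt (hf.weaken.add (LFO.var none)) (.bit true))).congr fun x w => ?_
  rw [← List.getElem?_drop, List.getElem?_eq_some_iff (i := w none) (l := LogSpace.word _)]
  constructor
  · rintro ⟨h1, h2⟩
    refine ⟨h1, ?_⟩
    rw [getElem?_of_lt_word h1] at h2
    simpa using h2
  · rintro ⟨h1, h2⟩
    exact ⟨h1, by rw [getElem?_of_lt_word h1, h2]⟩

theorem replicate {f : List Letter → (ι → ℕ) → ℕ} (hf : LF f) :
    NF fun x v => List.replicate (f x v) true :=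
  ⟨LF.congr hf fun _ _ => by simp, (LP.lt (LFO.var none) hf.weaken).congr fun x v => by
    simp [List.getElem?_replicate]⟩

theorem getD (l : List (List Bool)) {f : List Letter → (ι → ℕ) → ℕ} (hf : LF f) :
    NF fun x v => l.getD (f x v) [] := by
  induction l generalizing f with
  | nil => exact (const []).congr fun x v => by simp
  | cons a l ih =>
    refine (ite (LP.eq hf (LF.const 0)) (const a) (ih hf.pred)).congr fun x v => ?_
    rcases f x v with _ | n <;> simp

theorem eq (h : NF N) (h' : NF N') : LP fun x v => N x v = N' x v := by
  refine ((LP.eq h.1 h'.1).and (LP.all (φ := fun x v i => ((N x v)[i]? = some true ↔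
    (N' x v)[i]? = some true)) h.1 (h.2.iff h'.2))).congr fun x v => ?_
  constructor
  · rintro ⟨h1, h2⟩
    exact eq_of_bits h1 h2
  · intro h
    simp [h]

theorem out (h : NF N) : OutP fun x v => encodeName (N x v) := by
  refine OutP.congr (OutP.loop (g := fun x v i => if (N x v)[i]? = some true then [.bit true]
    else [.bit false]) h.1 (OutP.congr (OutP.ite h.2 (LFO.letter (.bit true))
      (LFO.letter (.bit false))) fun x v => by split <;> rfl)) fun x v => ?_
  generalize N x v = w
  induction w with
  | nil => rfl
  | cons b w ih =>
    rw [List.length_cons, List.range_succ_eq_map, List.flatMap_cons, List.flatMap_map]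
    simp only [List.getElem?_cons_succ, ih]
    cases b <;> simp [encodeName]

end NF

/-! ## Numbers that are given by their binary digits -/

def val : List Bool → ℕ
  | [] => 0
  | b :: w => Nat.bit b (val w)

theorem testBit_val (w : List Bool) (i : ℕ) : (val w).testBit i ↔ w[i]? = some true := by
  induction w generalizing i with
  | nil => simp [val]
  | cons b w ih =>
    rcases i with _ | i
    · simp [val]
    · simpa [val, Nat.testBit_bit_succ] using ih i

theorem val_bits (n : ℕ) : val n.bits = n := by
  induction n using Nat.strong_induction_on with
  | _ n ih =>
    obtain ⟨m, rfl | rfl⟩ := Nat.even_or_odd' n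
    · rcases Nat.eq_zero_or_pos m with rfl | hm
      · rfl
      · rw [Nat.bit0_bits m (by omega), val, ih m (by omega)]; simp
    · rw [Nat.bit1_bits, val, ih m (by omega)]; simp

theorem val_lt (w : List Bool) : val w < 2 ^ w.length := by
  induction w with
  | nil => simp [val]
  | cons b w ih =>
    rw [val, Nat.bit_val, List.length_cons, pow_succ]
    cases b <;> simp <;> omega

theorem sum_testBit (A n : ℕ) :
    ∑ i ∈ Finset.range n, (if A.testBit i then 1 else 0) * 2 ^ i = A % 2 ^ n := by
  induction n with
  | zero => simp [Nat.mod_one]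
  | succ n ih =>
    rw [Finset.sum_range_succ, ih, Nat.mod_pow_succ, Nat.testBit_eq_decide_div_mod_eq]
    rcases Nat.mod_two_eq_zero_or_one (A / 2 ^ n) with h | h <;> simp [h]

/-- A column sum of the schoolbook multiplication of `A` and `B`. -/
def colSum (A B j : ℕ) : ℕ := Nat.count (fun i => A.testBit i ∧ B.testBit (j - i)) (j + 1)

/-- The carry into column `j` of the multiplication. By `carry_le` it is at most `j`, so it fits
into a counter although the product does not. -/
def carry (A B : ℕ) : ℕ → ℕ
  | 0 => 0
  | j + 1 => (carry A B j + colSum A B j) / 2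

theorem carry_le (A B j : ℕ) : carry A B j ≤ j := by
  induction j with
  | zero => rfl
  | succ j ih =>
    have : colSum A B j ≤ j + 1 := Nat.count_le _
    rw [carry]; omega

/-- The digits of `A` and `B` are the coefficients of two polynomials with these values at 2, and
the column sums are the coefficients of their product. Columns beyond the degree contribute nothing,
so every large `m` is allowed. -/
theorem mul_eq_sum_colSum (A B : ℕ) :
    ∃ n, ∀ m ≥ n, A * B = ∑ j ∈ Finset.range m, colSum A B j * 2 ^ j := by
  let p : ℕ → ℕ → Polynomial ℕ := fun A n =>
    ∑ i ∈ Finset.range n, Polynomial.monomial i (if A.testBit i then 1 else 0)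
  have hp : ∀ A, ∃ n, (p A n).eval 2 = A ∧ ∀ i, (p A n).coeff i = if A.testBit i then 1 else 0 := by
    intro A
    refine ⟨A.size, ?_, fun i => ?_⟩
    · simp only [p, Polynomial.eval_finsetSum, Polynomial.eval_monomial, sum_testBit]
      exact Nat.mod_eq_of_lt (Nat.lt_size_self A)
    · simp only [p, Polynomial.finsetSum_coeff, Polynomial.coeff_monomial, Finset.sum_ite_eq',
        Finset.mem_range]
      split
      · rfl
      · rw [if_neg]
        have : A < 2 ^ i := (Nat.lt_size_self A).trans_le (Nat.pow_le_pow_right (by simp) (by omega))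
        simp [Nat.testBit_lt_two_pow this]
  obtain ⟨n, h1, h2⟩ := hp A
  obtain ⟨n', h1', h2'⟩ := hp B
  refine ⟨(p A n * p B n').natDegree + 1, fun m hm => ?_⟩
  have := Polynomial.eval_eq_sum_range' (p := p A n * p B n') hm 2
  rw [Polynomial.eval_mul, h1, h1'] at this
  rw [this]
  refine Finset.sum_congr rfl fun j _ => ?_
  rw [Polynomial.coeff_mul, Finset.Nat.sum_antidiagonal_eq_sum_range_succ_mk, colSum,
    Nat.count_eq_card_filter_range, Finset.card_filter]
  congr 1
  refine Finset.sum_congr rfl fun i _ => ?_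
  rw [h2, h2']
  by_cases ha : A.testBit i <;> by_cases hb : B.testBit (j - i) <;> simp [ha, hb]

/-- The carry into column `j` is the sum of the lower columns divided by `2 ^ j`, and the higher
columns contribute an even multiple of `2 ^ j`. The digit is therefore the parity of carry plus
column sum. -/
theorem testBit_mul (A B j : ℕ) :
    (A * B).testBit j ↔ (carry A B j + colSum A B j) % 2 = 1 := by
  have hc : ∀ j, carry A B j = (∑ i ∈ Finset.range j, colSum A B i * 2 ^ i) / 2 ^ j := by
    intro j
    induction j with
    | zero => simp [carry]
    | succ j ih =>
      rw [carry, ih, Finset.sum_range_succ, pow_succ, ← Nat.div_div_eq_div_mul,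
        Nat.add_mul_div_right _ _ (by positivity)]
  obtain ⟨n, hn⟩ := mul_eq_sum_colSum A B
  have h := hn (n + (j + 1)) (by omega)
  rw [add_comm, Finset.sum_range_add] at h
  have h2 : ∑ i ∈ Finset.range n, colSum A B (j + 1 + i) * 2 ^ (j + 1 + i) =
      (2 * ∑ i ∈ Finset.range n, colSum A B (j + 1 + i) * 2 ^ i) * 2 ^ j := by
    rw [Finset.mul_sum, Finset.sum_mul]
    refine Finset.sum_congr rfl fun i _ => ?_
    ring
  rw [Nat.testBit_eq_decide_div_mod_eq, decide_eq_true_iff, h, h2,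
    Nat.add_mul_div_right _ _ (by positivity), Finset.sum_range_succ,
    Nat.add_mul_div_right _ _ (by positivity), ← hc]
  omega

/-- The order is decided at the highest digit where the numbers differ, which is the top digit of `A
^^^ B`. -/
theorem lt_iff_testBit {A B ℓ : ℕ} (hA : A < 2 ^ ℓ) (hB : B < 2 ^ ℓ) :
    B < A ↔ ∃ j < ℓ, (A.testBit j ∧ ¬ B.testBit j) ∧ ∀ k < ℓ, j < k →
      (A.testBit k ↔ B.testBit k) := by
  have big : ∀ {n}, n < 2 ^ ℓ → ∀ k, ℓ ≤ k → n.testBit k = false := fun h k hk =>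
    Nat.testBit_lt_two_pow (h.trans_le (Nat.pow_le_pow_right (by simp) hk))
  constructor
  · intro h
    obtain ⟨j, h1, h2⟩ := Nat.exists_most_significant_bit (n := A ^^^ B) (by
      rw [Ne, Nat.xor_eq_zero_iff]; omega)
    have h3 : ∀ k, j < k → A.testBit k = B.testBit k := by
      intro k hk
      have := h2 k hk
      rw [Nat.testBit_xor] at this
      simpa using this
    rw [Nat.testBit_xor] at h1
    have hj : A.testBit j = true ∧ B.testBit j = false := by
      rcases ha : A.testBit j <;> rcases hb : B.testBit j <;> simp [ha, hb] at h1 ⊢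
      exact absurd (Nat.lt_of_testBit j ha hb h3) (by omega)
    refine ⟨j, ?_, ⟨hj.1, by simp [hj.2]⟩, fun k _ hk => by rw [h3 k hk]⟩
    by_contra hl
    have := big hA j (by omega)
    simp [hj.1] at this
  · rintro ⟨j, hj, ⟨h1, h2⟩, h3⟩
    refine Nat.lt_of_testBit j (by simpa using h2) h1 fun k hk => ?_
    rcases lt_or_ge k ℓ with hl | hl
    · exact (Bool.eq_iff_iff.2 (h3 k hl hk)).symm
    · rw [big hA k hl, big hB k hl]

/-- Functions with possibly large numbers as values, whose binary digits are computable. -/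
def BN (A : List Letter → (ι → ℕ) → ℕ) : Prop :=
  (LP fun x (w : Option ι → ℕ) => (A x fun i => w (some i)).testBit (w none)) ∧
    ∃ ℓ, LF ℓ ∧ ∀ x v, A x v < 2 ^ ℓ x v

namespace BN

variable {A B : List Letter → (ι → ℕ) → ℕ}

theorem val {N : List Letter → (ι → ℕ) → List Bool} (h : NF N) : BN fun x v => val (N x v) :=
  ⟨h.2.congr fun _ _ => (testBit_val _ _).symm, _, h.1, fun _ _ => val_lt _⟩

theorem testBit (h : BN A) {f : List Letter → (ι → ℕ) → ℕ} (hf : LF f) :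
    LP fun x v => (A x v).testBit (f x v) := LP.bind (φ := fun x v i => (A x v).testBit i) h.1 hf

theorem weaken (h : BN A) : BN fun x (w : Option ι → ℕ) => A x fun i => w (some i) := by
  obtain ⟨h1, ℓ, h2, h3⟩ := h
  exact ⟨LP.rename (κ := Option (Option ι)) h1 (Option.map some), _, h2.weaken, fun x w => h3 x _⟩

theorem le (hA : BN A) (hB : BN B) : LP fun x v => A x v ≤ B x v := by
  obtain ⟨ℓ, h2, h3⟩ := hA.2
  obtain ⟨ℓ', h2', h3'⟩ := hB.2
  have hℓ := h2.add h2'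
  refine (LP.not (LP.ex (φ := fun x v j => ((A x v).testBit j ∧ ¬ (B x v).testBit j) ∧
    ∀ k < ℓ x v + ℓ' x v, j < k → ((A x v).testBit k ↔ (B x v).testBit k)) hℓ
      ((hA.1.and hB.1.not).and (LP.all (φ := fun x w k => w none < k →
        ((A x fun i => w (some i)).testBit k ↔ (B x fun i => w (some i)).testBit k)) hℓ.weaken
        ((LP.lt (LFO.var (some none)) (LFO.var none)).imp
          ((hA.weaken.weaken.testBit (LFO.var none)).iff
            (hB.weaken.weaken.testBit (LFO.var none)))))))).congr fun x v => ?_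
  rw [← not_lt, not_iff_not]
  refine (lt_iff_testBit ?_ ?_).symm
  · exact (h3 x v).trans_le (Nat.pow_le_pow_right (by simp) (by omega))
  · exact (h3' x v).trans_le (Nat.pow_le_pow_right (by simp) (by omega))

theorem mul (hA : BN A) (hB : BN B) : BN fun x v => A x v * B x v := by
  obtain ⟨ℓ, h2, h3⟩ := hA.2
  obtain ⟨ℓ', h2', h3'⟩ := hB.2
  have hcol : LF fun x (w : Option ι → ℕ) =>
      colSum (A x fun i => w (some i)) (B x fun i => w (some i)) (w none) := by
    refine LF.congr (LF.count (φ := fun x (w : Option ι → ℕ) i =>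
      (A x fun i => w (some i)).testBit i ∧ (B x fun i => w (some i)).testBit (w none - i))
      (LP.and (hA.weaken.weaken.testBit (LFO.var none))
        (hB.weaken.weaken.testBit (LF.sub (LFO.var (some none)) (LFO.var none))))
      (LFO.var none).succ) fun x w => ?_
    unfold colSum
    congr!
  have hcarry : LF fun x (w : Option ι → ℕ) =>
      carry (A x fun i => w (some i)) (B x fun i => w (some i)) (w none) := by
    refine LF.recur (ι := Option ι) (h := fun _ w => w none) (ℓ := fun _ w => w none)
      (f := fun _ _ => 0) (fun x w j => carry (A x fun i => w (some i)) (B x fun i => w (some i)) j)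
      (LF.const 0) (LFO.var none)
      (LF.div_two (LF.add (LFO.var (some none)) (hcol.rename (κ := Option (Option (Option ι)))
        fun o => o.elim none fun i => some (some (some i))))) (fun _ _ => rfl)
      (fun x w j _ => ?_) (LFO.var none).linBdd fun x w j hj => (carry_le _ _ _).trans hj
    rfl
  refine ⟨(LP.odd (hcarry.add hcol)).congr fun x w => (testBit_mul _ _ _).symm,
    _, h2.add h2', fun x v => ?_⟩
  rw [pow_add]
  exact Nat.mul_lt_mul'' (h3 x v) (h3' x v)

end BN

end LogSpace

/-! ## Classical semantics with propositions as truth values -/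

/-- Assertions without degrees. -/
inductive GFact
  | concept (B : BasicConcept) (a : IndName)
  | role (P : RoleName) (a b : IndName)

def Assertion.fact : Assertion → GFact
  | .concept B a _ => .concept B a
  | .role P a b _ => .role P a b

def GFact.map (f : IndName → IndName) : GFact → GFact
  | .concept B a => .concept B (f a)
  | .role P a b => .role P (f a) (f b)

structure CInt where
  Dom : Type
  nonempty : Nonempty Dom
  ind : IndName → Dom
  con : ConceptName → Dom → Prop
  rol : RoleName → Dom → Dom → Prop

namespace CInt

variable (J : CInt)

def br : BasicRole → J.Dom → J.Dom → Prop
  | .name P, x, y => J.rol P x y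
  | .inv P, x, y => J.rol P y x

def bc : BasicConcept → J.Dom → Prop
  | .name A, x => J.con A x
  | .ex Q, x => ∃ y, J.br Q x y

def Sat : FuzzyAxiom → Prop
  | .concept B (.pos C) _ => ∀ x, J.bc B x → J.bc C x
  | .concept B (.neg C) _ => ∀ x, J.bc B x → ¬ J.bc C x
  | .role Q (.pos R) _ => ∀ x y, J.br Q x y → J.br R x y
  | .role Q (.neg R) _ => ∀ x y, J.br Q x y → ¬ J.br R x y

def SatFact : GFact → Prop
  | .concept B a => J.bc B (J.ind a)
  | .role P a b => J.rol P (J.ind a) (J.ind b)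

variable {n m : ℕ}

def tv (a : Fin n → IndName) (π : Fin m → J.Dom) : Term n m → J.Dom
  | .ans i => J.ind (a i)
  | .ex j => π j
  | .ind b => J.ind b

def HoldsAtom (a : Fin n → IndName) (π : Fin m → J.Dom) : QAtom n m → Prop
  | .concept B t => J.bc B (J.tv a π t)
  | .role P t₁ t₂ => J.rol P (J.tv a π t₁) (J.tv a π t₂)

def Holds (q : CQ n) (a : Fin n → IndName) : Prop :=
  ∃ π : Fin q.m → J.Dom, ∀ κ ∈ q.atoms, J.HoldsAtom a π κ

end CInt

variable {n : ℕ}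

def Entails (T : Set FuzzyAxiom) (A : Set GFact) (q : CQ n) (a : Fin n → IndName) : Prop :=
  ∀ J : CInt, (∀ τ ∈ T, J.Sat τ) → (∀ φ ∈ A, J.SatFact φ) → J.Holds q a

namespace Ontology

/-- The axioms of degree at least `θ`. -/
def tboxGE (O : Ontology) (θ : Degree) : Set FuzzyAxiom := {τ | τ ∈ O.tbox ∧ θ ≤ τ.degree}

/-- The assertions of degree at least `θ`, without their degrees. -/
def aboxGE (O : Ontology) (θ : Degree) : Set GFact :=
  {φ | ∃ α ∈ O.abox, θ ≤ α.degree ∧ α.fact = φ}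

end Ontology

theorem toUnit_le {d e : Degree} : toUnit d ≤ toUnit e ↔ d ≤ e := by
  rw [← Subtype.coe_le_coe, ← Subtype.coe_le_coe]
  simp only [toUnit]
  exact_mod_cast Iff.rfl

theorem toUnit_lt {d e : Degree} : toUnit d < toUnit e ↔ d < e := by
  rw [← not_le, ← not_le, toUnit_le]

theorem toUnit_zero : toUnit 0 = 0 := by ext; simp [toUnit]

theorem toUnit_one : toUnit 1 = 1 := by ext; simp [toUnit]

/-! ## Strict cuts of fuzzy interpretations -/

namespace Interpretation

variable (I : Interpretation) {t : unitInterval}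

/-- The classical interpretation given by the degrees above `t`. -/
def above (t : unitInterval) : CInt where
  Dom := I.Dom
  nonempty := I.nonempty
  ind := I.ind
  con A x := t < I.con A x
  rol P x y := t < I.rol P x y

theorem above_br (Q : BasicRole) (x y : I.Dom) :
    (I.above t).br Q x y ↔ t < I.basicRole Q x y := by cases Q <;> rfl

/-- A supremum exceeds `t` exactly if some member does. For non-strict cuts this fails when the
supremum is not attained, which is why the cuts are strict. -/
theorem above_bc (B : BasicConcept) (x : I.Dom) : (I.above t).bc B x ↔ t < I.basicConcept B x := by
  cases B with
  | name A => rfl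
  | ex Q =>
    simp only [CInt.bc, basicConcept, lt_iSup_iff]
    exact exists_congr fun y => I.above_br Q x y

/-- Residuation: `d ≤ godelImp b c` gives `min d b ≤ c`. -/
theorem lt_of_imp {d b c : unitInterval} (h : d ≤ godelImp b c) (hd : t < d) (hb : t < b) :
    t < c := by
  unfold godelImp at h
  split at h
  · exact hb.trans_le ‹_›
  · exact hd.trans_le h

/-- Gödel negation is zero on all positive degrees, so a negation above `t` forces `c = 0`. -/
theorem not_lt_of_imp_neg {d b c : unitInterval} (h : d ≤ godelImp b (godelNeg c)) (hd : t < d)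
    (hb : t < b) : ¬ t < c := by
  have := lt_of_imp h hd hb
  unfold godelNeg godelImp at this
  split at this
  · exact fun h => not_lt_bot (h.trans_le ‹_›)
  · exact absurd this not_lt_bot

theorem above_sat {τ : FuzzyAxiom} (h : I.SatisfiesAxiom τ) (ht : t < toUnit τ.degree) :
    (I.above t).Sat τ := by
  rcases τ with ⟨B, C | C, d⟩ | ⟨Q, R | R, d⟩
  · exact fun x hx => (I.above_bc C x).2 (lt_of_imp (h x) ht ((I.above_bc B x).1 hx))
  · exact fun x hx hx' => not_lt_of_imp_neg (h x) ht ((I.above_bc B x).1 hx) ((I.above_bc C x).1 hx')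
  · exact fun x y hx => (I.above_br R x y).2 (lt_of_imp (h x y) ht ((I.above_br Q x y).1 hx))
  · exact fun x y hx hx' => not_lt_of_imp_neg (h x y) ht ((I.above_br Q x y).1 hx)
      ((I.above_br R x y).1 hx')

theorem above_satFact {α : Assertion} (h : I.SatisfiesAssertion α) (ht : t < toUnit α.degree) :
    (I.above t).SatFact α.fact := by
  rcases α with ⟨B, a, d⟩ | ⟨P, a, b, d⟩
  · exact (I.above_bc B _).2 (ht.trans_le h)
  · exact ht.trans_le h

/-- The bound `t < 1` is needed for the empty conjunction, whose degree is 1. -/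
theorem above_holds (q : CQ n) (a : Fin n → IndName) (ht : t < 1) :
    (I.above t).Holds q a ↔ t < q.degreeIn I a := by
  simp only [CInt.Holds, CQ.degreeIn, lt_iSup_iff, CQ.matchDegree]
  refine exists_congr fun π => ?_
  rw [Finset.lt_inf_iff ht]
  refine forall₂_congr fun κ _ => ?_
  have hv : ∀ s, (I.above t).tv a π s = q.termValue I a π s := by rintro (_ | _ | _) <;> rfl
  cases κ with
  | concept B s => simp only [CInt.HoldsAtom, CQ.atomValue, hv]; exact I.above_bc B _
  | role P s₁ s₂ => simp only [CInt.HoldsAtom, CQ.atomValue, hv]; rfl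

theorem above_model {O : Ontology} (h : I.IsModel O) {θ : Degree} (ht : t < toUnit θ) :
    (∀ τ ∈ O.tboxGE θ, (I.above t).Sat τ) ∧ ∀ φ ∈ O.aboxGE θ, (I.above t).SatFact φ := by
  constructor
  · rintro τ ⟨h1, h2⟩
    exact I.above_sat (h.1 τ h1) (ht.trans_le (toUnit_le.2 h2))
  · rintro φ ⟨α, h1, h2, rfl⟩
    exact I.above_satFact (h.2 α h1) (ht.trans_le (toUnit_le.2 h2))

end Interpretation

/-- Cuts are sound. -/
theorem Entails.entailsGE {O : Ontology} {q : CQ n} {a : Fin n → IndName} {θ : Degree}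
    (h : Entails (O.tboxGE θ) (O.aboxGE θ) q a) : O.EntailsGE q a (toUnit θ) := by
  intro I hI
  refine le_of_forall_lt fun t ht => ?_
  obtain ⟨h1, h2⟩ := I.above_model hI ht
  exact (I.above_holds q a (ht.trans_le le_top)).1 (h _ h1 h2)

/-! ## Combining a fuzzy model with a classical countermodel -/

open Classical in
/-- Keep `v` if `p` holds, and lower it to `e` otherwise. -/
noncomputable def lower (p : Prop) (v e : unitInterval) : unitInterval := if p then v else min v e

theorem lower_le (p : Prop) (v e : unitInterval) : lower p v e ≤ v := by
  unfold lower; split <;> simp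

theorem min_le_lower (p : Prop) (v e : unitInterval) : min v e ≤ lower p v e := by
  unfold lower; split <;> simp

theorem le_imp_of_le {d x y : unitInterval} (h : d ≤ y) : d ≤ godelImp x y := by
  unfold godelImp; split
  · exact unitInterval.le_one d
  · exact h

theorem le_imp_of_le' {d x y : unitInterval} (h : x ≤ y) : d ≤ godelImp x y := by
  rw [godelImp, if_pos h]; exact unitInterval.le_one d

/-- If `d ≤ e`, capping at `e` cannot push the conclusion below `d`. If `e ≤ d` and `p → r`, the
only delicate case is that both sides are capped and `d ≤ c`: then `e ≤ c`, so the conclusion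
becomes `e`, which dominates the capped premise. -/
theorem le_imp_lower {d b c e : unitInterval} {p r : Prop} (h : d ≤ godelImp b c)
    (he : d ≤ e ∨ ((p → r) ∧ e ≤ d)) : d ≤ godelImp (lower p b e) (lower r c e) := by
  by_cases hr : r
  · rw [show lower r c e = c from if_pos hr]
    unfold godelImp at h
    split at h
    · exact le_imp_of_le' ((lower_le _ _ _).trans ‹_›)
    · exact le_imp_of_le h
  rw [show lower r c e = min c e from if_neg hr]
  by_cases hp : p
  · rw [show lower p b e = b from if_pos hp]
    have he : d ≤ e := he.resolve_right fun h => hr (h.1 hp)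
    unfold godelImp at h
    split at h
    · rcases le_total b e with hbe | hbe
      · exact le_imp_of_le' (le_min ‹_› hbe)
      · exact le_imp_of_le (he.trans (le_min (hbe.trans ‹_›) le_rfl))
    · exact le_imp_of_le (le_min h he)
  · rw [show lower p b e = min b e from if_neg hp]
    unfold godelImp at h
    split at h
    · exact le_imp_of_le' (min_le_min_right _ ‹_›)
    · rcases he with he | ⟨-, he⟩
      · exact le_imp_of_le (le_min h he)
      · exact le_imp_of_le' (le_min ((min_le_right _ _).trans (he.trans h)) (min_le_right _ _))

/-- No relation between `d`, `e`, `p` and `r` is required: either `c` is zero and remains so after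
lowering, or its negation is zero, and then `b` or `d` is zero already. This is why the countermodel
plays no role for negative axioms. -/
theorem le_imp_neg_lower {d b c e : unitInterval} {p r : Prop} (h : d ≤ godelImp b (godelNeg c)) :
    d ≤ godelImp (lower p b e) (godelNeg (lower r c e)) := by
  by_cases hc : c ≤ 0
  · have : godelNeg (lower r c e) = 1 := if_pos ((lower_le _ _ _).trans hc)
    rw [this]
    exact le_imp_of_le' (unitInterval.le_one _)
  · rw [show godelNeg c = 0 from if_neg hc] at h
    unfold godelImp at h
    split at h
    · exact le_imp_of_le' (((lower_le _ _ _).trans ‹_›).trans bot_le)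
    · exact le_imp_of_le (h.trans bot_le)

namespace Interpretation

/-- A product is taken because `K` and `J` have unrelated domains. `K` contributes the degrees and
the negative axioms, `J` the failure of the query. -/
noncomputable def combine (K : Interpretation) (J : CInt) (e : unitInterval) : Interpretation where
  Dom := K.Dom × J.Dom
  nonempty := by have := K.nonempty; have := J.nonempty; infer_instance
  ind a := (K.ind a, J.ind a)
  con A x := lower (J.con A x.2) (K.con A x.1) e
  rol P x y := lower (J.rol P x.2 y.2) (K.rol P x.1 y.1) e

variable (K : Interpretation) (J : CInt) (e : unitInterval)

theorem combine_basicRole (Q : BasicRole) (x y : K.Dom × J.Dom) :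
    (K.combine J e).basicRole Q x y = lower (J.br Q x.2 y.2) (K.basicRole Q x.1 y.1) e := by
  cases Q <;> rfl

/-- If `J` has a `Q`-successor, pairing it with the elements of `K` attains all degrees of `K`
unlowered. Otherwise every degree is capped at `e`, and the cap distributes over the supremum. -/
theorem combine_basicConcept (B : BasicConcept) (x : K.Dom × J.Dom) :
    (K.combine J e).basicConcept B x = lower (J.bc B x.2) (K.basicConcept B x.1) e := by
  cases B with
  | name A => rfl
  | ex Q =>
    have hQ := K.combine_basicRole J e Q x
    show (⨆ y : K.Dom × J.Dom, (K.combine J e).basicRole Q x y) = _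
    simp only [hQ, CInt.bc, basicConcept]
    have hJ := J.nonempty
    by_cases h : ∃ y, J.br Q x.2 y
    · rw [lower, if_pos h]
      obtain ⟨y, hy⟩ := h
      refine le_antisymm (iSup_le fun z => (lower_le _ _ _).trans
        (le_iSup (fun z => K.basicRole Q x.1 z) z.1)) (iSup_le fun z => ?_)
      refine le_trans ?_ (le_iSup (fun z : K.Dom × J.Dom =>
        lower (J.br Q x.2 z.2) (K.basicRole Q x.1 z.1) e) (z, y))
      simp only
      rw [lower, if_pos hy]
    · rw [lower, if_neg h]
      push Not at h
      simp only [lower, h, if_false]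
      refine le_antisymm (iSup_le fun z => min_le_min_right _
        (le_iSup (fun z => K.basicRole Q x.1 z) z.1)) ?_
      show (⨆ y, K.basicRole Q x.1 y) ⊓ e ≤ _
      rw [iSup_inf_eq]
      exact iSup_le fun z => le_iSup (fun z : K.Dom × J.Dom => min (K.basicRole Q x.1 z.1) e)
        (z, hJ.some)

variable {K J e}

theorem combine_satisfiesAxiom {τ : FuzzyAxiom} (h : K.SatisfiesAxiom τ)
    (he : toUnit τ.degree ≤ e ∨ (J.Sat τ ∧ e ≤ toUnit τ.degree)) :
    (K.combine J e).SatisfiesAxiom τ := by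
  rcases τ with ⟨B, C | C, d⟩ | ⟨Q, R | R, d⟩
  · intro x
    exact (le_imp_lower (h x.1) (he.imp_right fun h => ⟨h.1 x.2, h.2⟩)).trans_eq (congrArg₂ godelImp
      (K.combine_basicConcept J e B x) (K.combine_basicConcept J e C x)).symm
  · intro x
    exact (le_imp_neg_lower (h x.1)).trans_eq (congrArg₂ godelImp
      (K.combine_basicConcept J e B x) (congrArg godelNeg (K.combine_basicConcept J e C x))).symm
  · intro x y
    exact (le_imp_lower (h x.1 y.1) (he.imp_right fun h => ⟨h.1 x.2 y.2, h.2⟩)).trans_eq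
      (congrArg₂ godelImp (K.combine_basicRole J e Q x y) (K.combine_basicRole J e R x y)).symm
  · intro x y
    exact (le_imp_neg_lower (h x.1 y.1)).trans_eq (congrArg₂ godelImp
      (K.combine_basicRole J e Q x y) (congrArg godelNeg (K.combine_basicRole J e R x y))).symm

theorem combine_satisfiesAssertion {α : Assertion} (h : K.SatisfiesAssertion α)
    (he : toUnit α.degree ≤ e ∨ J.SatFact α.fact) : (K.combine J e).SatisfiesAssertion α := by
  have key : ∀ {d v : unitInterval} {p : Prop}, d ≤ v → d ≤ e ∨ p → d ≤ lower p v e := by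
    rintro d v p h (h' | h')
    · exact (le_min h h').trans (min_le_lower _ _ _)
    · rwa [lower, if_pos h']
  rcases α with ⟨B, a, d⟩ | ⟨P, a, b, d⟩
  · exact (key h he).trans_eq (K.combine_basicConcept J e B (K.ind a, J.ind a)).symm
  · exact key h he

/-- The second components of a match form a match in `J`. Some atom fails there, and its degree in
the product has been lowered to at most `e`. -/
theorem combine_degreeIn {q : CQ n} {a : Fin n → IndName} (h : ¬ J.Holds q a) :
    q.degreeIn (K.combine J e) a ≤ e := by
  refine iSup_le fun π => ?_
  simp only [CInt.Holds] at h
  push Not at h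
  obtain ⟨κ, hκ, h⟩ := h fun j => (π j).2
  refine (Finset.inf_le hκ).trans ?_
  have hv : ∀ s, (q.termValue (K.combine J e) a π s).2 = J.tv a (fun j => (π j).2) s := by
    rintro (_ | _ | _) <;> rfl
  cases κ with
  | concept B s =>
    simp only [CInt.HoldsAtom, ← hv] at h
    exact (K.combine_basicConcept J e B _).trans_le ((if_neg h).trans_le (min_le_right _ _))
  | role P s₁ s₂ =>
    simp only [CInt.HoldsAtom, ← hv] at h
    exact (if_neg h).trans_le (min_le_right _ _)

end Interpretation

/-- The degree of an answer is the highest degree whose cut entails the query. -/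
theorem mem_answers {O : Ontology} (hO : O.Consistent) {q : CQ n} {a : Fin n → IndName} {r : Degree}
    (h : r = 0 ∨ Entails (O.tboxGE r) (O.aboxGE r) q a)
    (h' : ∀ s ∈ O.degrees, r < s → ¬ Entails (O.tboxGE s) (O.aboxGE s) q a) :
    (a, toUnit r) ∈ q.answers O := by
  constructor
  · rcases h with rfl | h
    · intro I _
      rw [toUnit_zero]
      exact bot_le
    · exact h.entailsGE
  · intro d hd hent
    obtain ⟨K, hK⟩ := hO
    have hr : r < 1 := by
      rw [← toUnit_lt, toUnit_one]
      exact hd.trans_le (unitInterval.le_one d)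
    -- Since `1` always counts as a degree of `O`, there is a least degree `s` above `r`. No degree
    -- of `O` lies strictly between, so the cut at `s` contains everything of degree greater than
    -- `r`.
    have hne : (O.degrees.filter (r < ·)).Nonempty :=
      ⟨1, by simp [Ontology.degrees, hr]⟩
    obtain ⟨hs1, hs2⟩ := Finset.mem_filter.1 (Finset.min'_mem _ hne)
    have hmin := fun t ht => Finset.min'_le (O.degrees.filter (r < ·)) t ht
    set s := (O.degrees.filter (r < ·)).min' hne
    have hn := h' s hs1 hs2
    simp only [Entails] at hn
    push Not at hn
    obtain ⟨J, hT, hA, hq⟩ := hn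
    have hm : (K.combine J (toUnit r)).IsModel O := by
      constructor
      · intro τ hτ
        refine Interpretation.combine_satisfiesAxiom (hK.1 τ hτ) ?_
        rcases le_or_gt τ.degree r with h | h
        · exact Or.inl (toUnit_le.2 h)
        · refine Or.inr ⟨hT τ ⟨hτ, hmin _ (Finset.mem_filter.2 ⟨?_, h⟩)⟩, toUnit_le.2 h.le⟩
          exact Finset.mem_union_right _ (Finset.mem_union_left _ (Finset.mem_image_of_mem _ hτ))
      · intro α hα
        refine Interpretation.combine_satisfiesAssertion (hK.2 α hα) ?_
        rcases le_or_gt α.degree r with h | h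
        · exact Or.inl (toUnit_le.2 h)
        · refine Or.inr (hA _ ⟨α, hα, hmin _ (Finset.mem_filter.2 ⟨?_, h⟩), rfl⟩)
          exact Finset.mem_union_right _ (Finset.mem_union_right _ (Finset.mem_image_of_mem _ hα))
    exact absurd ((hent _ hm).trans (Interpretation.combine_degreeIn hq)) (not_le.2 hd)

/-- Degrees of answers are unique. -/
theorem answers_unique {O : Ontology} {q : CQ n} {a : Fin n → IndName} {d e : unitInterval}
    (hd : (a, d) ∈ q.answers O) (he : (a, e) ∈ q.answers O) : d = e := by
  rcases lt_trichotomy d e with h | h | h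
  · exact absurd he.1 (hd.2 e h)
  · exact h
  · exact absurd hd.1 (he.2 d h)

variable {n : ℕ}

/-! ## Classical interpretations -/

open Classical in
/-- An interpretation with truth values in `Prop` as one with degrees `0` and `1`. -/
noncomputable def CInt.toInterpretation (J : CInt) : Interpretation where
  Dom := J.Dom
  nonempty := J.nonempty
  ind := J.ind
  con A x := if J.con A x then 1 else 0
  rol P x y := if J.rol P x y then 1 else 0

theorem CInt.toInterpretation_isClassical (J : CInt) : J.toInterpretation.IsClassical := by
  constructor
  · intro A x
    simp only [toInterpretation]
    split <;> simp
  · intro P x y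
    simp only [toInterpretation]
    split <;> simp

open Classical in
theorem CInt.above_toInterpretation (J : CInt) : J.toInterpretation.above 0 = J := by
  cases J with
  | mk D ne ind con rol =>
    have hcon : (fun A x => 0 < if con A x then (1 : unitInterval) else 0) = con := by
      funext A x
      by_cases h : con A x <;> simp [h]
    have hrol : (fun P x y => 0 < if rol P x y then (1 : unitInterval) else 0) = rol := by
      funext P x y
      by_cases h : rol P x y <;> simp [h]
    simp only [Interpretation.above, toInterpretation, hcon, hrol]

namespace Interpretation

variable {I : Interpretation}

theorem IsClassical.basicRole (h : I.IsClassical) {Q : BasicRole} {x y : I.Dom}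
    (hx : 0 < I.basicRole Q x y) : I.basicRole Q x y = 1 := by
  cases Q with
  | name P => exact (h.2 P x y).resolve_left hx.ne'
  | inv P => exact (h.2 P y x).resolve_left hx.ne'

theorem IsClassical.basicConcept (h : I.IsClassical) {B : BasicConcept} {x : I.Dom}
    (hx : 0 < I.basicConcept B x) : I.basicConcept B x = 1 := by
  cases B with
  | name A => exact (h.1 A x).resolve_left hx.ne'
  | ex Q =>
    simp only [Interpretation.basicConcept, lt_iSup_iff] at hx
    obtain ⟨y, hy⟩ := hx
    refine le_antisymm (unitInterval.le_one _) ?_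
    rw [← h.basicRole hy]
    exact le_iSup (fun y => I.basicRole Q x y) y

theorem IsClassical.above_eq (h : I.IsClassical) {t : unitInterval} (ht : t < 1) :
    I.above t = I.above 0 := by
  have key : ∀ v : unitInterval, v = 0 ∨ v = 1 → (t < v ↔ 0 < v) := by
    rintro v (rfl | rfl)
    · simp
    · simp [ht]
  simp only [above, CInt.mk.injEq, heq_eq_eq, true_and]
  exact ⟨funext fun A => funext fun x => propext (key _ (h.1 A x)),
    funext fun P => funext fun x => funext fun y => propext (key _ (h.2 P x y))⟩

theorem le_imp_of_classical {d b c : unitInterval} (hc : 0 < c → c = 1) (h : 0 < b → 0 < c) :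
    d ≤ godelImp b c := by
  by_cases hb : 0 < b
  · exact le_imp_of_le' ((le_top : b ≤ (1 : unitInterval)).trans_eq (hc (h hb)).symm)
  · exact le_imp_of_le' ((not_lt.1 hb).trans bot_le)

theorem le_imp_neg_of_classical {d b c : unitInterval} (h : 0 < b → ¬ 0 < c) :
    d ≤ godelImp b (godelNeg c) := by
  by_cases hb : 0 < b
  · have : godelNeg c = 1 := if_pos (not_lt.1 (h hb))
    rw [this]
    exact le_imp_of_le' (unitInterval.le_one b)
  · exact le_imp_of_le' ((not_lt.1 hb).trans bot_le)

theorem IsClassical.satisfiesAxiom (h : I.IsClassical) {τ : FuzzyAxiom} (hτ : (I.above 0).Sat τ) :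
    I.SatisfiesAxiom τ := by
  rcases τ with ⟨B, C | C, d⟩ | ⟨Q, R | R, d⟩
  · exact fun x => le_imp_of_classical h.basicConcept fun hx =>
      (I.above_bc C x).1 (hτ x ((I.above_bc B x).2 hx))
  · exact fun x => le_imp_neg_of_classical fun hx hx' =>
      hτ x ((I.above_bc B x).2 hx) ((I.above_bc C x).2 hx')
  · exact fun x y => le_imp_of_classical h.basicRole fun hx =>
      (I.above_br R x y).1 (hτ x y ((I.above_br Q x y).2 hx))
  · exact fun x y => le_imp_neg_of_classical fun hx hx' =>
      hτ x y ((I.above_br Q x y).2 hx) ((I.above_br R x y).2 hx')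

theorem IsClassical.satisfiesAssertion (h : I.IsClassical) {α : Assertion}
    (hα : (I.above 0).SatFact α.fact) : I.SatisfiesAssertion α := by
  rcases α with ⟨B, a, d⟩ | ⟨P, a, b, d⟩
  · exact (le_top : _ ≤ (1 : unitInterval)).trans_eq (h.basicConcept ((I.above_bc B _).1 hα)).symm
  · exact (le_top : _ ≤ (1 : unitInterval)).trans_eq ((h.2 _ _ _).resolve_left
      (show 0 < I.rol P (I.ind a) (I.ind b) from hα).ne').symm

end Interpretation

theorem CInt.sat_toClassical (J : CInt) (τ : FuzzyAxiom) : J.Sat τ.toClassical ↔ J.Sat τ := by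
  rcases τ with ⟨B, C | C, d⟩ | ⟨Q, R | R, d⟩ <;> rfl

theorem Assertion.fact_toClassical (α : Assertion) : α.toClassical.fact = α.fact := by
  cases α <;> rfl

/-- `CInt.toInterpretation` and `Interpretation.above 0` translate between the two forms of
classical interpretations. As `θ` is positive, discarding the degree 0 in `Ontology.classical`
removes nothing from the cut. -/
theorem classicallyEntails_iff {O : Ontology} {θ : Degree} (hθ : 0 < θ) {q : CQ n}
    {a : Fin n → IndName} :
    (O.cut θ).classical.ClassicallyEntails q a ↔ Entails (O.tboxGE θ) (O.aboxGE θ) q a := by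
  have hT : ∀ τ, τ ∈ (O.cut θ).classical.tbox ↔ ∃ τ' ∈ O.tboxGE θ, τ'.toClassical = τ := by
    intro τ
    simp only [Ontology.classical, Ontology.cut, Finset.mem_image, Finset.mem_filter,
      Ontology.tboxGE, Set.mem_ofPred_eq]
    exact exists_congr fun τ' => and_congr_left fun _ => and_iff_left_of_imp fun h => hθ.trans_le h.2
  have hA : ∀ α, α ∈ (O.cut θ).classical.abox ↔
      ∃ α' ∈ O.abox, θ ≤ α'.degree ∧ α'.toClassical = α := by
    intro α
    simp only [Ontology.classical, Ontology.cut, Finset.mem_image, Finset.mem_filter]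
    constructor
    · rintro ⟨α', ⟨⟨h1, h2⟩, -⟩, h3⟩
      exact ⟨α', h1, h2, h3⟩
    · rintro ⟨α', h1, h2, h3⟩
      exact ⟨α', ⟨⟨h1, h2⟩, hθ.trans_le h2⟩, h3⟩
  constructor
  · intro h J hJT hJA
    have := h J.toInterpretation J.toInterpretation_isClassical ⟨fun τ hτ => ?_, fun α hα => ?_⟩
    · rw [← J.above_toInterpretation, Interpretation.above_holds _ _ _ zero_lt_one]
      exact this ▸ zero_lt_one
    · obtain ⟨τ', h1, rfl⟩ := (hT τ).1 hτ
      refine J.toInterpretation_isClassical.satisfiesAxiom ?_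
      rw [J.above_toInterpretation, CInt.sat_toClassical]
      exact hJT τ' h1
    · obtain ⟨α', h1, h2, rfl⟩ := (hA α).1 hα
      refine J.toInterpretation_isClassical.satisfiesAssertion ?_
      rw [J.above_toInterpretation, Assertion.fact_toClassical]
      exact hJA _ ⟨α', h1, h2, rfl⟩
  · intro h I hI hM
    refine le_antisymm (unitInterval.le_one _) (le_of_forall_lt fun t ht => ?_)
    rw [← Interpretation.above_holds I q a ht, hI.above_eq ht]
    refine h _ (fun τ hτ => ?_) ?_
    · rw [← CInt.sat_toClassical]
      refine I.above_sat (hM.1 _ ((hT _).2 ⟨τ, hτ, rfl⟩)) ?_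
      rw [show τ.toClassical.degree = 1 by cases τ <;> rfl, toUnit_one]
      exact zero_lt_one
    · rintro φ ⟨α, h1, h2, rfl⟩
      rw [← Assertion.fact_toClassical]
      refine I.above_satFact (hM.2 _ ((hA _).2 ⟨α, h1, h2, rfl⟩)) ?_
      rw [show α.toClassical.degree = 1 by cases α <;> rfl, toUnit_one]
      exact zero_lt_one

/-- In a strictly decreasing list of degrees the entry `0` can only be the last one, so the entry
that is returned without a test is the default value `0`. -/
theorem degreeLoop_spec (O : Ontology) (q : CQ n) (a : Fin n → IndName) (l : List Degree)
    (hl : l.Pairwise (· > ·)) (h0 : (0 : Degree) ∈ l) :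
    (degreeLoop O q a l = 0 ∨ Entails (O.tboxGE (degreeLoop O q a l))
      (O.aboxGE (degreeLoop O q a l)) q a) ∧
    ∀ s ∈ l, degreeLoop O q a l < s → ¬ Entails (O.tboxGE s) (O.aboxGE s) q a := by
  induction l with
  | nil => simp at h0
  | cons d l ih =>
    cases l with
    | nil =>
      obtain rfl : 0 = d := by simpa using h0
      refine ⟨Or.inl rfl, fun s hs h => ?_⟩
      obtain rfl : s = 0 := by simpa using hs
      exact absurd h (lt_irrefl _)
    | cons e l =>
      rw [List.pairwise_cons] at hl
      have hd : 0 < d := lt_of_le_of_lt (e.2.1 : 0 ≤ e) (hl.1 e (by simp))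
      by_cases hc : (O.cut d).classical.ClassicallyEntails q a
      · rw [degreeLoop, if_pos hc]
        refine ⟨Or.inr ((classicallyEntails_iff hd).1 hc), fun s hs h => ?_⟩
        rcases List.mem_cons.1 hs with rfl | hs
        · exact absurd h (lt_irrefl _)
        · exact absurd h (hl.1 s hs).le.not_gt
      · rw [degreeLoop, if_neg hc]
        obtain ⟨h1, h2⟩ := ih hl.2 ((List.mem_cons.1 h0).resolve_left hd.ne)
        refine ⟨h1, fun s hs h => ?_⟩
        rcases List.mem_cons.1 hs with rfl | hs
        · rwa [← classicallyEntails_iff hd]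
        · exact h2 s hs h

theorem iterativeDegree_mem_answers {O : Ontology} (hO : O.Consistent) (q : CQ n)
    (a : Fin n → IndName) : (a, toUnit (iterativeDegree O q a)) ∈ q.answers O := by
  obtain ⟨h1, h2⟩ := degreeLoop_spec O q a (O.degrees.sort (· ≥ ·))
    (by
      have h := Finset.pairwise_sort O.degrees (· ≥ ·)
      have h' := Finset.sort_nodup O.degrees (· ≥ ·)
      exact (h.and h').imp fun h => lt_of_le_of_ne h.1 (Ne.symm h.2))
    (by simp [Ontology.degrees])
  exact mem_answers hO h1 fun s hs => h2 s ((Finset.mem_sort _).2 hs)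

/-! ## Signatures and renamings -/

def BasicRole.rname : BasicRole → RoleName
  | .name P => P
  | .inv P => P

/-- A set of concept names and role names. -/
structure Signature where
  con : Set ConceptName
  rol : Set RoleName

namespace Signature

variable (S : Signature)

def Concept : BasicConcept → Prop
  | .name A => A ∈ S.con
  | .ex Q => Q.rname ∈ S.rol

def Fact : GFact → Prop
  | .concept B _ => S.Concept B
  | .role P _ _ => P ∈ S.rol

def Axiom : FuzzyAxiom → Prop
  | .concept B (.pos C) _ => S.Concept B ∧ S.Concept C
  | .concept B (.neg C) _ => S.Concept B ∧ S.Concept C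
  | .role Q (.pos R) _ => Q.rname ∈ S.rol ∧ R.rname ∈ S.rol
  | .role Q (.neg R) _ => Q.rname ∈ S.rol ∧ R.rname ∈ S.rol

def Atom {m : ℕ} : QAtom n m → Prop
  | .concept B _ => S.Concept B
  | .role P _ _ => P ∈ S.rol

end Signature

def QAtom.consts {m : ℕ} : QAtom n m → Set IndName
  | .concept _ t => {c | t = .ind c}
  | .role _ t₁ t₂ => {c | t₁ = .ind c ∨ t₂ = .ind c}

/-- Rename the individuals, and make all names outside of the signature true everywhere. -/
def CInt.pull (J : CInt) (S : Signature) (f : IndName → IndName) : CInt where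
  Dom := J.Dom
  nonempty := J.nonempty
  ind a := J.ind (f a)
  con A x := A ∈ S.con → J.con A x
  rol P x y := P ∈ S.rol → J.rol P x y

section Pull

variable {J : CInt} {S : Signature} {f : IndName → IndName}

theorem CInt.pull_br {Q : BasicRole} (hQ : Q.rname ∈ S.rol) (x y : J.Dom) :
    (J.pull S f).br Q x y ↔ J.br Q x y := by
  cases Q <;> exact forall_prop_of_true hQ

theorem CInt.pull_bc {B : BasicConcept} (hB : S.Concept B) (x : J.Dom) :
    (J.pull S f).bc B x ↔ J.bc B x := by
  cases B with
  | name A => exact forall_prop_of_true hB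
  | ex Q => exact exists_congr fun y => CInt.pull_br hB x y

theorem CInt.pull_sat {τ : FuzzyAxiom} (hτ : S.Axiom τ) (h : J.Sat τ) : (J.pull S f).Sat τ := by
  rcases τ with ⟨B, C | C, d⟩ | ⟨Q, R | R, d⟩
  · exact fun x hx => (pull_bc (J := J) (f := f) hτ.2 x).2
      (h x ((pull_bc (J := J) (f := f) hτ.1 x).1 hx))
  · exact fun x hx hx' =>
      h x ((pull_bc (J := J) (f := f) hτ.1 x).1 hx) ((pull_bc (J := J) (f := f) hτ.2 x).1 hx')
  · exact fun x y hx => (pull_br (J := J) (f := f) hτ.2 x y).2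
      (h x y ((pull_br (J := J) (f := f) hτ.1 x y).1 hx))
  · exact fun x y hx hx' =>
      h x y ((pull_br (J := J) (f := f) hτ.1 x y).1 hx) ((pull_br (J := J) (f := f) hτ.2 x y).1 hx')

theorem CInt.pull_satFact {φ : GFact} (h : S.Fact φ → J.SatFact (φ.map f)) :
    (J.pull S f).SatFact φ := by
  cases φ with
  | concept B a =>
    by_cases hB : S.Concept B
    · exact (pull_bc hB _).2 (h hB)
    · rcases B with A | (P | P)
      · exact fun hA => absurd hA hB
      · exact ⟨J.nonempty.some, fun hP => absurd hP hB⟩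
      · exact ⟨J.nonempty.some, fun hP => absurd hP hB⟩
  | role P a b => exact fun hP => h hP

end Pull

/-- Entailment is preserved by renamings that fix the individuals of the query, and does not depend
on facts outside of the signature. -/
theorem Entails.map {S : Signature} {T T' : Set FuzzyAxiom} {A A' : Set GFact} {q : CQ n}
    {a : Fin n → IndName} (h : Entails T A q a) (f : IndName → IndName) (hST : ∀ τ ∈ T, S.Axiom τ)
    (hSq : ∀ κ ∈ q.atoms, S.Atom κ) (hf : ∀ κ ∈ q.atoms, ∀ c ∈ κ.consts, f c = c) (hT : T ⊆ T')
    (hA : ∀ φ ∈ A, S.Fact φ → φ.map f ∈ A') : Entails T' A' q fun i => f (a i) := by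
  intro J hJT hJA
  -- A model of the renamed facts is pulled back along `f` without changing its domain, so the match
  -- found there is also a match in `J`.
  obtain ⟨π, hπ⟩ := h (J.pull S f) (fun τ hτ => CInt.pull_sat (hST τ hτ) (hJT τ (hT hτ)))
    (fun φ hφ => CInt.pull_satFact fun hS => hJA _ (hA φ hφ hS))
  refine ⟨π, fun κ hκ => ?_⟩
  have hv : ∀ t : Term n q.m, (∀ c, t = .ind c → f c = c) →
      (J.pull S f).tv a π t = J.tv (fun i => f (a i)) π t := by
    rintro (i | j | b) ht
    · rfl
    · rfl
    · exact congrArg J.ind (ht b rfl)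
  have h1 := hπ κ hκ
  have h2 := hSq κ hκ
  have h3 := hf κ hκ
  cases κ with
  | concept B t =>
    simp only [CInt.HoldsAtom] at h1 ⊢
    rw [hv t fun c hc => h3 c hc] at h1
    exact (CInt.pull_bc h2 _).1 h1
  | role P t₁ t₂ =>
    simp only [CInt.HoldsAtom] at h1 ⊢
    rw [hv t₁ fun c hc => h3 c (Or.inl hc), hv t₂ fun c hc => h3 c (Or.inr hc)] at h1
    exact h1 h2

/-! ## Locality of entailment -/

/-- An amalgamation: the individuals are shared, and for every fact `φ` in `A` there is a copy of
the product of `K` with the interpretations `J i`. A fact is true if it is true for some `φ` in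
`K` and in all `J i` with `R i φ`. -/
def amalgam {ι : Type} (A : Set GFact) (K : CInt) (J : ι → CInt) (R : ι → GFact → Prop) : CInt where
  Dom := IndName ⊕ A × K.Dom × ∀ i, (J i).Dom
  nonempty := ⟨.inl []⟩
  ind := .inl
  con C u := ∃ (φ : A) (d : K.Dom × ∀ i, (J i).Dom),
    (u = .inr (φ, d) ∨ ∃ a, u = .inl a ∧ d = (K.ind a, fun i => (J i).ind a)) ∧
      K.con C d.1 ∧ ∀ i, R i φ → (J i).con C (d.2 i)
  rol P u v := ∃ (φ : A) (d e : K.Dom × ∀ i, (J i).Dom),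
    (u = .inr (φ, d) ∨ ∃ a, u = .inl a ∧ d = (K.ind a, fun i => (J i).ind a)) ∧
    (v = .inr (φ, e) ∨ ∃ a, v = .inl a ∧ e = (K.ind a, fun i => (J i).ind a)) ∧
      K.rol P d.1 e.1 ∧ ∀ i, R i φ → (J i).rol P (d.2 i) (e.2 i)

section Amalgam

variable {ι : Type} {A : Set GFact} {K : CInt} {J : ι → CInt} {R : ι → GFact → Prop}

/-- In the copy for `φ`, the element `u` is represented by `d`. -/
def At (A : Set GFact) (K : CInt) (J : ι → CInt) (φ : A)
    (u : IndName ⊕ A × K.Dom × ∀ i, (J i).Dom) (d : K.Dom × ∀ i, (J i).Dom) : Prop :=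
  u = .inr (φ, d) ∨ ∃ a, u = .inl a ∧ d = (K.ind a, fun i => (J i).ind a)

theorem amalgam_br {Q : BasicRole} {u v} : (amalgam A K J R).br Q u v ↔
    ∃ φ d e, At A K J φ u d ∧ At A K J φ v e ∧ K.br Q d.1 e.1 ∧
      ∀ i, R i φ → (J i).br Q (d.2 i) (e.2 i) := by
  cases Q with
  | name P => rfl
  | inv P =>
    constructor
    · rintro ⟨φ, d, e, h1, h2, h3⟩; exact ⟨φ, e, d, h2, h1, h3⟩
    · rintro ⟨φ, d, e, h1, h2, h3⟩; exact ⟨φ, e, d, h2, h1, h3⟩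

/-- A successor is assembled inside the copy of the same fact `φ`. Components `J i` without `R i φ`
impose no condition there and contribute an arbitrary element. -/
theorem amalgam_bc {B : BasicConcept} {u} : (amalgam A K J R).bc B u ↔
    ∃ φ d, At A K J φ u d ∧ K.bc B d.1 ∧ ∀ i, R i φ → (J i).bc B (d.2 i) := by
  cases B with
  | name C => rfl
  | ex Q =>
    constructor
    · rintro ⟨v, hv⟩
      obtain ⟨φ, d, e, h1, -, h3, h4⟩ := amalgam_br.1 hv
      exact ⟨φ, d, h1, ⟨_, h3⟩, fun i hi => ⟨_, h4 i hi⟩⟩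
    · rintro ⟨φ, d, h1, ⟨y, hy⟩, h3⟩
      have : ∀ i, ∃ z, R i φ → (J i).br Q (d.2 i) z := by
        intro i
        by_cases hi : R i φ
        · obtain ⟨z, hz⟩ := h3 i hi
          exact ⟨z, fun _ => hz⟩
        · exact ⟨(J i).nonempty.some, fun h => absurd h hi⟩
      choose z hz using this
      exact ⟨.inr (φ, (y, z)), amalgam_br.2 ⟨φ, d, (y, z), h1, Or.inl rfl, hy, hz⟩⟩

/-- The projection of the amalgam to a component. -/
def projK : (IndName ⊕ A × K.Dom × ∀ i, (J i).Dom) → K.Dom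
  | .inl a => K.ind a
  | .inr (_, d) => d.1

def projJ (i : ι) : (IndName ⊕ A × K.Dom × ∀ i, (J i).Dom) → (J i).Dom
  | .inl a => (J i).ind a
  | .inr (_, d) => d.2 i

theorem At.eq_projK {φ : A} {u d} (h : At A K J φ u d) : d.1 = projK u := by
  rcases h with rfl | ⟨a, rfl, rfl⟩ <;> rfl

theorem At.eq_projJ {φ : A} {u d} (h : At A K J φ u d) (i : ι) : d.2 i = projJ i u := by
  rcases h with rfl | ⟨a, rfl, rfl⟩ <;> rfl

theorem amalgam_br_projK {Q : BasicRole} {u v} (h : (amalgam A K J R).br Q u v) :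
    K.br Q (projK u) (projK v) := by
  obtain ⟨φ, d, e, h1, h2, h3, -⟩ := amalgam_br.1 h
  rwa [h1.eq_projK, h2.eq_projK] at h3

theorem amalgam_bc_projK {B : BasicConcept} {u} (h : (amalgam A K J R).bc B u) :
    K.bc B (projK u) := by
  obtain ⟨φ, d, h1, h3, -⟩ := amalgam_bc.1 h
  rwa [h1.eq_projK] at h3

/-- A positive inclusion has a single premise, which holds through one copy, and the conclusion
follows in the same copy. The two sides of a negative inclusion may hold through different copies;
the projection to `K` excludes this, and it is the reason for the factor `K`. -/
theorem amalgam_sat {τ : FuzzyAxiom} (hK : K.Sat τ) (hJ : ∀ i, (J i).Sat τ) :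
    (amalgam A K J R).Sat τ := by
  rcases τ with ⟨B, C | C, d⟩ | ⟨Q, P | P, d⟩
  · intro u hu
    obtain ⟨φ, d, h1, h2, h3⟩ := amalgam_bc.1 hu
    exact amalgam_bc.2 ⟨φ, d, h1, hK _ h2, fun i hi => hJ i _ (h3 i hi)⟩
  · exact fun u hu hu' => hK _ (amalgam_bc_projK hu) (amalgam_bc_projK hu')
  · intro u v hu
    obtain ⟨φ, d, e, h1, h1', h2, h3⟩ := amalgam_br.1 hu
    exact amalgam_br.2 ⟨φ, d, e, h1, h1', hK _ _ h2, fun i hi => hJ i _ _ (h3 i hi)⟩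
  · exact fun u v hu hu' => hK _ _ (amalgam_br_projK hu) (amalgam_br_projK hu')

/-- A fact is true through its own copy, where only those `J i` with `R i φ` are consulted. -/
theorem amalgam_satFact {φ : GFact} (hφ : φ ∈ A) (hK : K.SatFact φ)
    (hJ : ∀ i, R i φ → (J i).SatFact φ) : (amalgam A K J R).SatFact φ := by
  cases φ with
  | concept B a =>
    exact amalgam_bc.2 ⟨⟨_, hφ⟩, (K.ind a, fun i => (J i).ind a), Or.inr ⟨a, rfl, rfl⟩, hK, hJ⟩
  | role P a b =>
    exact ⟨⟨_, hφ⟩, (K.ind a, fun i => (J i).ind a), (K.ind b, fun i => (J i).ind b),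
      Or.inr ⟨a, rfl, rfl⟩, Or.inr ⟨b, rfl, rfl⟩, hK, hJ⟩

/-- Every query atom that is true in the amalgam has a fact that makes it true in the components. -/
theorem amalgam_holdsAtom {m : ℕ} {a : Fin n → IndName} {π} {κ : QAtom n m}
    (h : (amalgam A K J R).HoldsAtom a π κ) :
    ∃ φ : A, ∀ i, R i φ → (J i).HoldsAtom a (fun j => projJ i (π j)) κ := by
  have hv : ∀ i t, projJ i ((amalgam A K J R).tv a π t) =
      (J i).tv a (fun j => projJ i (π j)) t := by rintro i (_ | _ | _) <;> rfl
  cases κ with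
  | concept B t =>
    obtain ⟨φ, d, h1, -, h3⟩ := amalgam_bc.1 h
    refine ⟨φ, fun i hi => ?_⟩
    have := h3 i hi
    rwa [h1.eq_projJ, hv] at this
  | role P t₁ t₂ =>
    obtain ⟨φ, d, e, h1, h2, -, h3⟩ := h
    refine ⟨φ, fun i hi => ?_⟩
    have := h3 i hi
    rwa [At.eq_projJ h1, At.eq_projJ h2, hv, hv] at this

end Amalgam

/-- If the ontology is consistent, every certain answer follows from at most one fact for each atom
of the query. -/
theorem Entails.exists_range {T : Set FuzzyAxiom} {A : Set GFact} {q : CQ n} {a : Fin n → IndName}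
    (h : Entails T A q a) {K : CInt} (hKT : ∀ τ ∈ T, K.Sat τ) (hKA : ∀ φ ∈ A, K.SatFact φ) :
    ∃ f : {κ // κ ∈ q.atoms} → GFact, (∀ κ, f κ ∈ A) ∧ Entails T (Set.range f) q a := by
  by_contra hcon
  push Not at hcon
  have hJ : ∀ f : {κ // κ ∈ q.atoms} → A, ∃ J : CInt, (∀ τ ∈ T, J.Sat τ) ∧
      (∀ κ, J.SatFact (f κ)) ∧ ¬ J.Holds q a := by
    intro f
    have := hcon (fun κ => f κ) fun κ => (f κ).2
    simp only [Entails] at this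
    push Not at this
    obtain ⟨J, h1, h2, h3⟩ := this
    exact ⟨J, h1, fun κ => h2 _ ⟨κ, rfl⟩, h3⟩
  choose J h1 h2 h3 using hJ
  -- The index set consists of all choices `f` of one fact for each query atom; `J f` satisfies the
  -- chosen facts but not the query.
  obtain ⟨π, hπ⟩ := h (amalgam A K J fun f φ => ∃ κ, (f κ : GFact) = φ)
    (fun τ hτ => amalgam_sat (hKT τ hτ) fun f => h1 f τ hτ)
    (fun φ hφ => amalgam_satFact hφ (hKA φ hφ) fun f ⟨κ, hκ⟩ => hκ ▸ h2 f κ)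
  -- The match in the amalgam itself selects a fact for each atom. For this very choice `f`, the
  -- projection to `J f` satisfies all atoms: a contradiction.
  choose f hf using fun κ : {κ // κ ∈ q.atoms} => amalgam_holdsAtom (hπ κ.1 κ.2)
  exact h3 f ⟨fun j => projJ f (π j), fun κ hκ => hf ⟨κ, hκ⟩ f ⟨⟨κ, hκ⟩, rfl⟩⟩

namespace LogSpace

variable {ι κ J : Type} {n : ℕ}

/-! ## Fractions in binary -/

/-- A fraction, given by the binary digits of its numerator and denominator. -/
abbrev Fraction := List Bool × List Bool

def Fraction.le (F G : Fraction) : Prop := val F.1 * val G.2 ≤ val G.1 * val F.2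

def fraction (d : Degree) : Fraction := ((d : ℚ).num.toNat.bits, (d : ℚ).den.bits)

theorem fraction_le {d e : Degree} : (fraction d).le (fraction e) ↔ d ≤ e := by
  have key : ∀ d : Degree, (((d : ℚ).num.toNat : ℕ) : ℤ) = (d : ℚ).num :=
    fun d => Int.toNat_of_nonneg (Rat.num_nonneg.2 d.2.1)
  rw [← Subtype.coe_le_coe, Rat.le_iff, ← key d, ← key e]
  simp only [Fraction.le, fraction, val_bits]
  norm_cast

theorem fraction_fst_eq_nil {d : Degree} : (fraction d).1 = [] ↔ d = 0 := by
  constructor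
  · intro h
    have h1 : val (fraction d).1 = 0 := by rw [h]; rfl
    rw [fraction, val_bits, Int.toNat_eq_zero] at h1
    exact Subtype.ext (le_antisymm (Rat.num_nonpos.1 h1) d.2.1)
  · rintro rfl
    rfl

theorem encodeDegree_eq (d : Degree) :
    encodeDegree d = encodeName (fraction d).1 ++ Letter.sep :: encodeName (fraction d).2 := rfl

def FF (F : List Letter → (ι → ℕ) → Fraction) : Prop :=
  NF (fun x v => (F x v).1) ∧ NF fun x v => (F x v).2

namespace FF

variable {F G : List Letter → (ι → ℕ) → Fraction}

theorem congr (h : FF F) (e : ∀ x v, F x v = G x v) : FF G := by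
  rwa [show G = F from funext fun x => funext fun v => (e x v).symm]

theorem const (F : Fraction) : FF (ι := ι) fun _ _ => F := ⟨NF.const _, NF.const _⟩

theorem rename (h : FF F) (ρ : ι → κ) : FF fun x (v : κ → ℕ) => F x fun i => v (ρ i) :=
  ⟨NF.rename h.1 ρ, NF.rename h.2 ρ⟩

theorem le (hF : FF F) (hG : FF G) : LP fun x v => (F x v).le (G x v) :=
  ((BN.val hF.1).mul (BN.val hG.2)).le ((BN.val hG.1).mul (BN.val hF.2))

open Classical in
theorem ite {φ : List Letter → (ι → ℕ) → Prop} (hφ : LP φ) (h : FF F) (h' : FF G) :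
    FF fun x v => if φ x v then F x v else G x v :=
  ⟨(NF.ite hφ h.1 h'.1).congr fun x v => by dsimp only; split <;> rfl,
    (NF.ite hφ h.2 h'.2).congr fun x v => by dsimp only; split <;> rfl⟩

theorem getD (l : List Fraction) {f : List Letter → (ι → ℕ) → ℕ} (hf : LF f) :
    FF fun x v => l.getD (f x v) ([], []) := by
  constructor
  · refine (NF.getD (l.map Prod.fst) hf).congr fun x v => ?_
    rw [show ([] : List Bool) = Prod.fst (([], []) : Fraction) from rfl, List.getD_map]
  · refine (NF.getD (l.map Prod.snd) hf).congr fun x v => ?_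
    rw [show ([] : List Bool) = Prod.snd (([], []) : Fraction) from rfl, List.getD_map]

end FF

/-! ## Suffixes of the input -/

/-- Functions whose values are suffixes of the input with a computable starting point. -/
def SF (Y : List Letter → (ι → ℕ) → List Letter) : Prop := ∃ f, LF f ∧ ∀ x v, Y x v = x.drop (f x v)

/-- The part after the next letter that is not a bit. -/
def skip (y : List Letter) : List Letter := y.drop ((word y).length + 1)

theorem skip_append (w : List Bool) (s : Letter) {z : List Letter} (hs : ¬ IsBit (some s)) :
    skip (encodeName w ++ s :: z) = z := by
  rw [skip, word_append w (by exact hs), show w.length + 1 = (encodeName w ++ [s]).length by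
    simp [encodeName], show encodeName w ++ s :: z = encodeName w ++ [s] ++ z by simp]
  exact List.drop_left

namespace SF

variable {Y : List Letter → (ι → ℕ) → List Letter}

theorem drop {f : List Letter → (ι → ℕ) → ℕ} (hf : LF f) : SF fun x v => x.drop (f x v) :=
  ⟨f, hf, fun _ _ => rfl⟩

theorem tail (h : SF Y) : SF fun x v => (Y x v).tail := by
  obtain ⟨f, hf, h⟩ := h
  exact ⟨_, hf.succ, fun x v => by simp only [h, List.tail_drop]⟩

theorem skip (h : SF Y) : SF fun x v => skip (Y x v) := by
  obtain ⟨f, hf, h⟩ := h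
  exact ⟨_, hf.add hf.length_word.succ, fun x v => by
    simp only [h, LogSpace.skip, List.drop_drop]⟩

theorem iterate_skip (h : SF Y) (i : ℕ) : SF fun x v => LogSpace.skip^[i] (Y x v) := by
  induction i with
  | zero => exact h
  | succ i ih => simpa only [Function.iterate_succ_apply'] using ih.skip

theorem word (h : SF Y) : NF fun x v => word (Y x v) := by
  obtain ⟨f, hf, h⟩ := h
  exact (NF.word hf).congr fun x v => by rw [h]

theorem head (h : SF Y) (s : Letter) : LP fun x v => (Y x v).head? = some s := by
  obtain ⟨f, hf, h⟩ := h
  exact (LP.letterAt hf s).congr fun x v => by rw [h, List.head?_drop]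

end SF

/-! ## Reading assertions -/

/-- The predicate of a fact. -/
abbrev Pred := BasicConcept ⊕ RoleName

def _root_.Signature.Pred (S : Signature) : Pred → Prop
  | .inl B => S.Concept B
  | .inr P => P ∈ S.rol

/-- The second name is ignored for concepts, so both kinds of assertions can be read from fields 0
and 1, although field 1 of a concept assertion is a numerator. -/
def Pred.fact : Pred → IndName → IndName → GFact
  | .inl B, a, _ => .concept B a
  | .inr P, a, b => .role P a b

theorem Pred.map_fact (k : Pred) (a b : IndName) (f : IndName → IndName) :
    (k.fact a b).map f = k.fact (f a) (f b) := by cases k <;> rfl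

theorem Pred.fact_mem {S : Signature} (k : Pred) (a b : IndName) :
    S.Fact (k.fact a b) ↔ S.Pred k := by cases k <;> rfl

/-- The predicate of the assertion at the beginning of a string. -/
def pred (y : List Letter) : Option Pred :=
  match y.head? with
  | some .nameTag => some (.inl (.name (word y.tail)))
  | some .exTag => some (.inl (.ex (.name (word y.tail))))
  | some .exInvTag => some (.inl (.ex (.inv (word y.tail))))
  | some .roleTag => some (.inr (word y.tail))
  | _ => none

/-- The fields that follow the predicate. -/
def field (i : ℕ) (y : List Letter) : List Bool := word (skip^[i + 1] y.tail)

/-- The degree of the assertion at the beginning of a string. -/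
def degreeOf (y : List Letter) : Fraction :=
  if y.head? = some .roleTag then (field 2 y, field 3 y) else (field 1 y, field 2 y)

namespace SF

variable {Y : List Letter → (ι → ℕ) → List Letter}

theorem field (h : SF Y) (i : ℕ) : NF fun x v => field i (Y x v) := (h.tail.iterate_skip _).word

theorem degreeOf (h : SF Y) : FF fun x v => degreeOf (Y x v) := by
  refine FF.congr (FF.ite (F := fun x v => (LogSpace.field 2 (Y x v), LogSpace.field 3 (Y x v)))
    (G := fun x v => (LogSpace.field 1 (Y x v), LogSpace.field 2 (Y x v)))
    (h.head .roleTag) ⟨h.field 2, h.field 3⟩ ⟨h.field 1, h.field 2⟩) fun x v => ?_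
  simp only [LogSpace.degreeOf]
  split <;> rfl

theorem pred_eq (h : SF Y) (k : Pred) : LP fun x v => pred (Y x v) = some k := by
  have hw := fun A => h.tail.word.eq (NF.const A)
  rcases k with (A | (P | P)) | P
  · refine ((h.head .nameTag).and (hw A)).congr fun x v => ?_
    rcases Y x v with _ | ⟨(_ | _ | _ | _ | _ | _ | _ | _), y⟩ <;> simp [pred]
  · refine ((h.head .exTag).and (hw P)).congr fun x v => ?_
    rcases Y x v with _ | ⟨(_ | _ | _ | _ | _ | _ | _ | _), y⟩ <;> simp [pred]
  · refine ((h.head .exInvTag).and (hw P)).congr fun x v => ?_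
    rcases Y x v with _ | ⟨(_ | _ | _ | _ | _ | _ | _ | _), y⟩ <;> simp [pred]
  · refine ((h.head .roleTag).and (hw P)).congr fun x v => ?_
    rcases Y x v with _ | ⟨(_ | _ | _ | _ | _ | _ | _ | _), y⟩ <;> simp [pred]

theorem pred_isSome (h : SF Y) : LP fun x v => (pred (Y x v)).isSome := by
  refine ((h.head .nameTag).or ((h.head .exTag).or ((h.head .exInvTag).or
    (h.head .roleTag)))).congr fun x v => ?_
  rcases Y x v with _ | ⟨(_ | _ | _ | _ | _ | _ | _ | _), y⟩ <;> simp [pred]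

end SF

/-- The assertion `α` stands at the beginning of the string `y`. -/
def Reads (y : List Letter) (α : Assertion) : Prop :=
  (∃ k, pred y = some k ∧ k.fact (field 0 y) (field 1 y) = α.fact) ∧
    degreeOf y = fraction α.degree

/-- The assertions that can be read at some position of `x` are those in `L`. -/
def Codes (x : List Letter) (L : List Assertion) : Prop :=
  (∀ s, (pred (x.drop s)).isSome → ∃ α ∈ L, Reads (x.drop s) α) ∧
    ∀ α ∈ L, ∃ s < x.length, Reads (x.drop s) α

theorem reads_append (α : Assertion) {z : List Letter} (hz : ¬ IsBit z.head?) :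
    Reads (encodeAssertion α ++ z) α := by
  have hs : ¬ IsBit (some Letter.sep) := by simp [IsBit]
  have hw := fun (w : List Bool) (u : List Letter) =>
    word_append w (z := .sep :: u) (by exact hs)
  rcases α with ⟨A | (P | P), a, d⟩ | ⟨P, a, b, d⟩ <;>
  · refine ⟨⟨_, rfl, ?_⟩, ?_⟩ <;>
    simp [encodeAssertion, encodeBasicConcept, encodeDegree_eq, field, degreeOf, Pred.fact,
      Assertion.fact, Assertion.degree, skip_append, hs, word_append, hz, hw]

/-- Tags occur only as first letters of encoded assertions, so nothing is read at an inner position.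
-/
theorem pred_drop_of_lt (α : Assertion) (z : List Letter) {s : ℕ} (hs : 0 < s)
    (h : s < (encodeAssertion α).length) : pred ((encodeAssertion α ++ z).drop s) = none := by
  obtain ⟨t, rfl⟩ : ∃ t, s = t + 1 := ⟨s - 1, by omega⟩
  have hmem : ∀ e ∈ (encodeAssertion α).tail, e = .sep ∨ ∃ b, e = .bit b := by
    rcases α with ⟨A | (P | P), a, d⟩ | ⟨P, a, b, d⟩ <;>
    · simp only [encodeAssertion, encodeBasicConcept, encodeDegree, encodeName, List.cons_append,
        List.tail_cons, List.mem_append, List.mem_cons, List.mem_map]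
      aesop
  have h1 : (encodeAssertion α ++ z)[t + 1]? = (encodeAssertion α).tail[t]? := by
    rw [List.getElem?_append_left h, List.getElem?_tail]
  have h2 : t < (encodeAssertion α).tail.length := by simp; omega
  rw [List.getElem?_eq_getElem h2] at h1
  rw [pred, List.head?_drop, h1]
  rcases hmem _ (List.getElem_mem h2) with h3 | ⟨b, h3⟩ <;> rw [h3]

theorem not_isBit_encodeABox (L : List Assertion) {z : List Letter} (hz : ¬ IsBit z.head?) :
    ¬ IsBit (encodeABox L ++ z).head? := by
  cases L with
  | nil => exact hz
  | cons α L =>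
    rcases α with ⟨A | (P | P), a, d⟩ | ⟨P, a, b, d⟩ <;>
    simp [encodeABox, encodeAssertion, encodeBasicConcept, IsBit]

/-- The rest `z` must neither prolong the last denominator nor contain something that could be read
as an assertion. -/
theorem codes_append (L : List Assertion) {z : List Letter} (hz : ¬ IsBit z.head?)
    (hz' : ∀ s, pred (z.drop s) = none) : Codes (encodeABox L ++ z) L := by
  induction L with
  | nil => exact ⟨fun s h => by simp [encodeABox, hz'] at h, by simp⟩
  | cons α L ih =>
    have e : encodeABox (α :: L) ++ z = encodeAssertion α ++ (encodeABox L ++ z) := by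
      simp [encodeABox]
    rw [e]
    have h0 := reads_append α (not_isBit_encodeABox L hz)
    have hd : ∀ s, (encodeAssertion α ++ (encodeABox L ++ z)).drop ((encodeAssertion α).length + s)
        = (encodeABox L ++ z).drop s := fun s => by
        rw [← List.drop_drop, List.drop_left]
    have hpos : 0 < (encodeAssertion α).length := by
      rcases α with ⟨A | (P | P), a, d⟩ | ⟨P, a, b, d⟩ <;>
      simp [encodeAssertion, encodeBasicConcept]
    constructor
    · intro s hs
      rcases lt_or_ge s (encodeAssertion α).length with h | h
      · rcases Nat.eq_zero_or_pos s with rfl | h'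
        · exact ⟨α, by simp, h0⟩
        · rw [pred_drop_of_lt α _ h' h] at hs
          simp at hs
      · obtain ⟨t, rfl⟩ := Nat.exists_eq_add_of_le h
        rw [hd] at hs ⊢
        obtain ⟨β, h1, h2⟩ := ih.1 t hs
        exact ⟨β, List.mem_cons_of_mem _ h1, h2⟩
    · intro β hβ
      rcases List.mem_cons.1 hβ with rfl | hβ
      · exact ⟨0, by simp; omega, h0⟩
      · obtain ⟨s, h1, h2⟩ := ih.2 β hβ
        exact ⟨(encodeAssertion α).length + s, by simp at h1 ⊢; omega, by rwa [hd]⟩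

end LogSpace

namespace LogSpace

variable {ι κ J : Type} {n : ℕ}

/-! ## Testing entailment from few facts -/

theorem _root_.Signature.finite_pred {S : Signature} (hc : S.con.Finite) (hr : S.rol.Finite) :
    {k | S.Pred k}.Finite := by
  refine ((((hc.image fun A => Sum.inl (.name A)).union
    (hr.image fun P => Sum.inl (.ex (.name P)))).union
    (hr.image fun P => Sum.inl (.ex (.inv P)))).union (hr.image Sum.inr)).subset ?_
  rintro ((A | (P | P)) | P) hk
  · exact Or.inl (Or.inl (Or.inl ⟨A, hk, rfl⟩))
  · exact Or.inl (Or.inl (Or.inr ⟨P, hk, rfl⟩))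
  · exact Or.inl (Or.inr ⟨P, hk, rfl⟩)
  · exact Or.inr ⟨P, hk, rfl⟩

def _root_.CQ.consts (q : CQ n) : Set IndName := {c | ∃ κ ∈ q.atoms, c ∈ κ.consts}

theorem _root_.CQ.finite_consts (q : CQ n) : q.consts.Finite := by
  have : q.consts = ⋃ κ ∈ q.atoms, κ.consts := by
    ext c
    simp [CQ.consts]
  rw [this]
  refine Set.Finite.biUnion q.atoms.finite_toSet fun κ _ => ?_
  cases κ with
  | concept B t =>
    refine Set.Subsingleton.finite fun c hc d hd => ?_
    simpa using hc.symm.trans hd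
  | role P t₁ t₂ =>
    refine (Set.Subsingleton.finite (s := {c | t₁ = .ind c}) fun c hc d hd => ?_).union
      (Set.Subsingleton.finite (s := {c | t₂ = .ind c}) fun c hc d hd => ?_)
    · simpa using hc.symm.trans hd
    · simpa using hc.symm.trans hd

/-- A signature that covers a TBox and a query. -/
structure _root_.Signature.Covers (S : Signature) (T : Finset FuzzyAxiom) (q : CQ n) : Prop where
  finite_con : S.con.Finite
  finite_rol : S.rol.Finite
  tbox : ∀ τ ∈ T, S.Axiom τ
  query : ∀ κ ∈ q.atoms, S.Atom κ

variable (T : Finset FuzzyAxiom) (q : CQ n) (S : Signature)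

/-- The axioms of degree at least `F`. -/
def tboxCut (F : Fraction) : Set FuzzyAxiom := {τ | τ ∈ T ∧ F.le (fraction τ.degree)}

/-- The facts of degree at least `F` at the beginning of the strings `Y j`, as far as they belong to
the signature. -/
def facts (Y : J → List Letter) (F : Fraction) : Set GFact :=
  {φ | ∃ j k, S.Pred k ∧ pred (Y j) = some k ∧ F.le (degreeOf (Y j)) ∧
    φ = k.fact (field 0 (Y j)) (field 1 (Y j))}

variable {T q S}

/-- Finitely many tests determine the verdict: which axioms and facts reach the degree, which
predicates of the signature the facts have, and which of the names involved coincide. Two inputs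
with the same outcomes differ by a renaming, under which entailment is invariant. -/
theorem LP.entails [Finite J] (hS : S.Covers T q) {F : List Letter → (ι → ℕ) → Fraction}
    {Y : J → List Letter → (ι → ℕ) → List Letter} {N : Fin n → List Letter → (ι → ℕ) → List Bool}
    (hF : FF F) (hY : ∀ j, SF (Y j)) (hN : ∀ i, NF (N i)) :
    LP fun x v => Entails (tboxCut T (F x v)) (facts S (fun j => Y j x v) (F x v)) q
      fun i => N i x v := by
  have : Finite {k // S.Pred k} := (Signature.finite_pred hS.finite_con hS.finite_rol).to_subtype
  have : Finite q.consts := q.finite_consts.to_subtype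
  let ν : (J ⊕ J) ⊕ (Fin n ⊕ q.consts) → List Letter → (ι → ℕ) → List Bool :=
    Sum.elim (Sum.elim (fun j x v => field 0 (Y j x v)) fun j x v => field 1 (Y j x v))
      (Sum.elim N fun c _ _ => c)
  have hν : ∀ s, NF (ν s) := by
    rintro ((j | j) | (i | c))
    exacts [(hY j).field 0, (hY j).field 1, hN i, NF.const _]
  refine LP.of_determined (J := ({τ // τ ∈ T} ⊕ J) ⊕ (J × {k // S.Pred k} ⊕
      ((J ⊕ J) ⊕ (Fin n ⊕ q.consts)) × ((J ⊕ J) ⊕ (Fin n ⊕ q.consts))))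
    (ψ := Sum.elim (Sum.elim (fun τ x v => (F x v).le (fraction τ.1.degree))
        fun j x v => (F x v).le (degreeOf (Y j x v)))
      (Sum.elim (fun p x v => pred (Y p.1 x v) = some p.2.1) fun p x v => ν p.1 x v = ν p.2 x v))
    ?_ ?_
  · rintro ((τ | j) | (p | p))
    · exact hF.le (FF.const _)
    · exact hF.le (hY j).degreeOf
    · exact (hY _).pred_eq _
    · exact (hν _).eq (hν _)
  · intro x v x' v' h hE
    have h1 := fun τ : {τ // τ ∈ T} => h (.inl (.inl τ))
    have h2 := fun j : J => h (.inl (.inr j))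
    have h3 := fun (j : J) (k : {k // S.Pred k}) => h (.inr (.inl (j, k)))
    have h4 := fun s t => h (.inr (.inr (s, t)))
    simp only [Sum.elim_inl, Sum.elim_inr] at h1 h2 h3 h4
    classical
    -- Each name of the first input is sent to its counterpart in the second one; equal coincidences
    -- make the choice of `s` irrelevant. The constants of the query belong to `ν`, so `f` fixes
    -- them.
    let f : IndName → IndName := fun w => if hw : ∃ s, ν s x v = w then ν hw.choose x' v' else w
    have hf : ∀ s, f (ν s x v) = ν s x' v' := by
      intro s
      have hw : ∃ t, ν t x v = ν s x v := ⟨s, rfl⟩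
      simp only [f, dif_pos hw]
      exact (h4 _ _).1 hw.choose_spec
    have key := hE.map f (S := S) (T' := tboxCut T (F x' v'))
      (A' := facts S (fun j => Y j x' v') (F x' v')) (fun τ hτ => hS.tbox τ hτ.1) hS.query
      (fun κ hκ c hc => hf (.inr (.inr ⟨c, κ, hκ, hc⟩)))
      (fun τ hτ => ⟨hτ.1, (h1 ⟨τ, hτ.1⟩).1 hτ.2⟩) ?_
    · have : (fun i => f (N i x v)) = fun i => N i x' v' := funext fun i => hf (.inr (.inl i))
      rwa [this] at key
    · rintro φ ⟨j, k, hk, hp, hd, rfl⟩ -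
      refine ⟨j, k, hk, (h3 j ⟨k, hk⟩).1 hp, (h2 j).1 hd, ?_⟩
      rw [Pred.map_fact]
      exact congrArg₂ k.fact (hf (.inl (.inl j))) (hf (.inl (.inr j)))

variable (T q S)

/-- Entailment from the facts at a bounded number of positions of the input. -/
def EntailsAt (x : List Letter) (F : Fraction) (a : Fin n → IndName) : Prop :=
  ∃ s : {κ // κ ∈ q.atoms} → ℕ, (∀ j, s j < x.length) ∧
    Entails (tboxCut T F) (facts S (fun j => x.drop (s j)) F) q a

variable {T q S}

theorem LP.entailsAt (hS : S.Covers T q) {F : List Letter → (ι → ℕ) → Fraction}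
    {N : Fin n → List Letter → (ι → ℕ) → List Bool} (hF : FF F) (hN : ∀ i, NF (N i)) :
    LP fun x v => EntailsAt T q S x (F x v) fun i => N i x v :=
  (LP.exVec (J := {κ // κ ∈ q.atoms}) (φ := fun x v s => Entails (tboxCut T (F x v))
    (facts S (fun j => x.drop (s j)) (F x v)) q fun i => N i x v) LFO.length
    (LP.entails hS (hF.rename Sum.inl) (fun j => SF.drop (LFO.var (Sum.inr j)))
      fun i => (hN i).rename Sum.inl)).1

/-- From right to left this is locality; the strict 0-cut of a fuzzy model is the model that
locality asks for, and `θ > 0` ensures that it satisfies the cut. Left to right is monotonicity.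
Facts outside the signature may be dropped in either direction. -/
theorem entailsAt_iff (hS : S.Covers T q) {x : List Letter} {L : List Assertion} (hx : Codes x L)
    (hO : (Ontology.mk T L.toFinset).Consistent) {θ : Degree} (hθ : 0 < θ) (a : Fin n → IndName) :
    EntailsAt T q S x (fraction θ) a ↔
      Entails ((Ontology.mk T L.toFinset).tboxGE θ) ((Ontology.mk T L.toFinset).aboxGE θ) q a := by
  have hT : tboxCut T (fraction θ) = (Ontology.mk T L.toFinset).tboxGE θ := by
    ext τ
    exact and_congr_right fun _ => fraction_le
  constructor
  · rintro ⟨s, -, h⟩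
    rw [hT] at h
    refine h.map id (S := S) (fun τ hτ => hS.tbox τ hτ.1) hS.query (fun _ _ _ _ => rfl) subset_rfl ?_
    rintro φ ⟨j, k, -, hp, hd, rfl⟩ -
    obtain ⟨α, hα, ⟨k', hp', hk'⟩, hd'⟩ := hx.1 (s j) (by rw [hp]; rfl)
    obtain rfl : k = k' := Option.some.inj (hp.symm.trans hp')
    exact ⟨α, by simpa using hα, fraction_le.1 (hd' ▸ hd), by rw [Pred.map_fact]; exact hk'.symm⟩
  · intro h
    obtain ⟨I, hI⟩ := hO
    obtain ⟨h1, h2⟩ := I.above_model (θ := θ) hI (t := 0) (by rw [← toUnit_zero]; exact toUnit_lt.2 hθ)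
    obtain ⟨f, hf, hE⟩ := h.exists_range h1 h2
    have : ∀ κ, ∃ s < x.length, ∃ k, pred (x.drop s) = some k ∧
        (fraction θ).le (degreeOf (x.drop s)) ∧
        f κ = k.fact (field 0 (x.drop s)) (field 1 (x.drop s)) := by
      intro κ
      obtain ⟨α, hα, hd, hφ⟩ := hf κ
      obtain ⟨s, hs, ⟨k, hp, hk⟩, hd'⟩ := hx.2 α (by simpa using hα)
      exact ⟨s, hs, k, hp, by rw [hd']; exact fraction_le.2 hd, by rw [hk, hφ]⟩
    choose s hs k hp hd hk using this
    refine ⟨s, hs, ?_⟩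
    rw [hT]
    refine hE.map id (S := S) (fun τ hτ => hS.tbox τ hτ.1) hS.query (fun _ _ _ _ => rfl) subset_rfl ?_
    rintro φ ⟨κ, rfl⟩ hφ
    rw [hk κ, Pred.map_fact]
    refine ⟨κ, k κ, ?_, hp κ, hd κ, rfl⟩
    rwa [hk κ, Pred.fact_mem] at hφ

/-! ## Computing degrees of answers -/

variable (T)

noncomputable def tboxDegrees : List Fraction :=
  (insert 0 (insert 1 (T.image FuzzyAxiom.degree))).toList.map fraction

open Classical in
/-- An enumeration of the degrees of the axioms and of the assertions in the input. -/
noncomputable def degreeAt (x : List Letter) (d : ℕ) : Fraction :=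
  if d < (tboxDegrees T).length then (tboxDegrees T).getD d ([], [])
  else if (pred (x.drop (d - (tboxDegrees T).length))).isSome then
    degreeOf (x.drop (d - (tboxDegrees T).length)) else fraction 0

theorem FF.degreeAt {f : List Letter → (ι → ℕ) → ℕ} (hf : LF f) :
    FF fun x v => degreeAt T x (f x v) := by
  have h := SF.drop (hf.sub (LF.const (tboxDegrees T).length))
  refine (FF.ite (LP.lt hf (LF.const (tboxDegrees T).length)) (FF.getD (tboxDegrees T) hf)
    (FF.ite h.pred_isSome h.degreeOf (FF.const (fraction 0)))).congr fun x v => ?_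
  simp only [LogSpace.degreeAt]
  split_ifs <;> rfl

variable {T}

/-- No index is invalid: one that points to no assertion denotes 0, which counts as a degree of
every ontology. -/
theorem exists_degreeAt_eq {x : List Letter} {L : List Assertion} (hx : Codes x L) (d : ℕ) :
    ∃ r ∈ (Ontology.mk T L.toFinset).degrees, degreeAt T x d = fraction r := by
  unfold degreeAt
  split_ifs with h1 h2
  · rw [List.getD_eq_getElem _ _ h1]
    have := List.getElem_mem h1
    simp only [tboxDegrees, List.mem_map, Finset.mem_toList] at this
    obtain ⟨r, hr, h⟩ := this
    refine ⟨r, ?_, h.symm⟩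
    simp only [Finset.mem_insert] at hr
    simp only [Ontology.degrees, Finset.mem_union, Finset.mem_insert, Finset.mem_singleton]
    tauto
  · obtain ⟨α, hα, -, hd⟩ := hx.1 _ h2
    refine ⟨α.degree, ?_, hd⟩
    simp only [Ontology.degrees, Finset.mem_union, Finset.mem_image]
    exact Or.inr (Or.inr ⟨α, by simpa using hα, rfl⟩)
  · exact ⟨0, by simp [Ontology.degrees], rfl⟩

theorem exists_lt_degreeAt_eq {x : List Letter} {L : List Assertion} (hx : Codes x L) {r : Degree}
    (hr : r ∈ (Ontology.mk T L.toFinset).degrees) :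
    ∃ d < (tboxDegrees T).length + x.length, degreeAt T x d = fraction r := by
  by_cases h : fraction r ∈ tboxDegrees T
  · obtain ⟨d, hd, he⟩ := List.getElem_of_mem h
    refine ⟨d, by omega, ?_⟩
    rw [degreeAt, if_pos hd, List.getD_eq_getElem _ _ hd, he]
  · have h' : ∀ s : Degree, s ∈ insert 0 (insert 1 (T.image FuzzyAxiom.degree)) → s ≠ r := by
      rintro s hs rfl
      exact h (List.mem_map.2 ⟨s, Finset.mem_toList.2 hs, rfl⟩)
    simp only [Ontology.degrees, Finset.mem_union, Finset.mem_insert, Finset.mem_singleton] at hr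
    rcases hr with (rfl | rfl) | hr | hr
    · exact absurd rfl (h' _ (by simp))
    · exact absurd rfl (h' _ (by simp))
    · exact absurd rfl (h' _ (by simp [hr]))
    · obtain ⟨α, hα, rfl⟩ := Finset.mem_image.1 hr
      obtain ⟨s, hs, ⟨k, hk, -⟩, hd⟩ := hx.2 α (by simpa using hα)
      refine ⟨(tboxDegrees T).length + s, by omega, ?_⟩
      rw [degreeAt, if_neg (by omega), Nat.add_sub_cancel_left, if_pos (by rw [hk]; rfl), hd]

variable (T q S)

/-- The degree of `a` is the one with index `d`. -/
def IsDegreeAt (x : List Letter) (a : Fin n → IndName) (d : ℕ) : Prop :=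
  ((degreeAt T x d).1 = [] ∨ EntailsAt T q S x (degreeAt T x d) a) ∧
    ∀ e < (tboxDegrees T).length + x.length, EntailsAt T q S x (degreeAt T x e) a →
      (degreeAt T x e).le (degreeAt T x d)

variable {T q S}

theorem LP.isDegreeAt (hS : S.Covers T q) {N : Fin n → List Letter → (ι → ℕ) → List Bool}
    {f : List Letter → (ι → ℕ) → ℕ} (hN : ∀ i, NF (N i)) (hf : LF f) :
    LP fun x v => IsDegreeAt T q S x (fun i => N i x v) (f x v) := by
  have hd := FF.degreeAt T hf
  refine ((hd.1.eq (NF.const [])).or (LP.entailsAt hS hd hN)).and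
    (LP.all (φ := fun x v e => EntailsAt T q S x (degreeAt T x e) (fun i => N i x v) →
      (degreeAt T x e).le (degreeAt T x (f x v))) ((LF.const _).add LFO.length)
      ((LP.entailsAt hS (FF.degreeAt T (LFO.var none)) fun i => (hN i).weaken).imp
        (FF.le (FF.degreeAt T (LFO.var none)) (FF.degreeAt T hf.weaken))))

/-- The degree of `a`, in terms of the cuts. -/
def _root_.Ontology.IsCutDegree (O : Ontology) (q : CQ n) (a : Fin n → IndName) (r : Degree) :
    Prop :=
  (r = 0 ∨ Entails (O.tboxGE r) (O.aboxGE r) q a) ∧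
    ∀ s ∈ O.degrees, r < s → ¬ Entails (O.tboxGE s) (O.aboxGE s) q a

theorem _root_.Ontology.exists_isCutDegree (O : Ontology) (q : CQ n) (a : Fin n → IndName) :
    ∃ r ∈ O.degrees, O.IsCutDegree q a r := by
  classical
  obtain ⟨r, h1, h2⟩ := Finset.exists_max_image
    (O.degrees.filter fun r => r = 0 ∨ Entails (O.tboxGE r) (O.aboxGE r) q a) id
    ⟨0, by simp [Ontology.degrees]⟩
  rw [Finset.mem_filter] at h1
  exact ⟨r, h1.1, h1.2, fun s hs hrs hE =>
    (h2 s (Finset.mem_filter.2 ⟨hs, Or.inr hE⟩)).not_gt hrs⟩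

theorem isDegreeAt_iff (hS : S.Covers T q) {x : List Letter} {L : List Assertion} (hx : Codes x L)
    (hO : (Ontology.mk T L.toFinset).Consistent) {a : Fin n → IndName} {d : ℕ} {r : Degree}
    (hd : degreeAt T x d = fraction r) :
    IsDegreeAt T q S x a d ↔ (Ontology.mk T L.toFinset).IsCutDegree q a r := by
  have hr : 0 ≤ r := r.2.1
  rw [IsDegreeAt, Ontology.IsCutDegree, hd, fraction_fst_eq_nil]
  refine and_congr ?_ ⟨fun h s hs hrs hE => ?_, fun h e _ hE => ?_⟩
  -- At degree 0 the first alternative holds on both sides, so `entailsAt_iff` is only needed for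
  -- positive degrees.
  · rcases hr.eq_or_lt with h | h
    · simp [h.symm]
    · rw [entailsAt_iff hS hx hO h]
  · obtain ⟨e, he, hes⟩ := exists_lt_degreeAt_eq hx hs
    have := h e he
    rw [hes, entailsAt_iff hS hx hO (hr.trans_lt hrs), fraction_le] at this
    exact (this hE).not_gt hrs
  · obtain ⟨s, hs, hes⟩ := exists_degreeAt_eq (T := T) hx e
    rw [hes] at hE ⊢
    rw [fraction_le]
    by_contra hrs
    rw [not_le] at hrs
    exact h s hs hrs ((entailsAt_iff hS hx hO (hr.trans_lt hrs) a).1 hE)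

end LogSpace

/-! ## The signature of a TBox and a query -/

def BasicConcept.conceptNames : BasicConcept → Finset ConceptName
  | .name A => {A}
  | .ex _ => ∅

def BasicConcept.roleNames : BasicConcept → Finset RoleName
  | .name _ => ∅
  | .ex Q => {Q.rname}

def FuzzyAxiom.conceptNames : FuzzyAxiom → Finset ConceptName
  | .concept B (.pos C) _ => B.conceptNames ∪ C.conceptNames
  | .concept B (.neg C) _ => B.conceptNames ∪ C.conceptNames
  | .role _ _ _ => ∅

def FuzzyAxiom.roleNames : FuzzyAxiom → Finset RoleName
  | .concept B (.pos C) _ => B.roleNames ∪ C.roleNames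
  | .concept B (.neg C) _ => B.roleNames ∪ C.roleNames
  | .role Q (.pos R) _ => {Q.rname, R.rname}
  | .role Q (.neg R) _ => {Q.rname, R.rname}

def QAtom.conceptNames {n m : ℕ} : QAtom n m → Finset ConceptName
  | .concept B _ => B.conceptNames
  | .role _ _ _ => ∅

def QAtom.roleNames {n m : ℕ} : QAtom n m → Finset RoleName
  | .concept B _ => B.roleNames
  | .role P _ _ => {P}

def signatureOf {n : ℕ} (T : Finset FuzzyAxiom) (q : CQ n) : Signature where
  con := ↑(T.biUnion FuzzyAxiom.conceptNames ∪ q.atoms.biUnion QAtom.conceptNames)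
  rol := ↑(T.biUnion FuzzyAxiom.roleNames ∪ q.atoms.biUnion QAtom.roleNames)

theorem Signature.concept_of_subset {S : Signature} {B : BasicConcept}
    (h : ∀ A ∈ B.conceptNames, A ∈ S.con) (h' : ∀ P ∈ B.roleNames, P ∈ S.rol) : S.Concept B := by
  cases B with
  | name A => exact h A (Finset.mem_singleton_self A)
  | ex Q => exact h' _ (Finset.mem_singleton_self _)

theorem signatureOf_covers {n : ℕ} (T : Finset FuzzyAxiom) (q : CQ n) :
    (signatureOf T q).Covers T q := by
  refine ⟨Finset.finite_toSet _, Finset.finite_toSet _, fun τ hτ => ?_, fun κ hκ => ?_⟩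
  · have hc : ∀ A ∈ τ.conceptNames, A ∈ (signatureOf T q).con := fun A hA =>
      Finset.mem_union_left _ (Finset.mem_biUnion.2 ⟨τ, hτ, hA⟩)
    have hr : ∀ P ∈ τ.roleNames, P ∈ (signatureOf T q).rol := fun P hP =>
      Finset.mem_union_left _ (Finset.mem_biUnion.2 ⟨τ, hτ, hP⟩)
    rcases τ with ⟨B, C | C, d⟩ | ⟨Q, R | R, d⟩
    all_goals simp only [FuzzyAxiom.conceptNames, FuzzyAxiom.roleNames, Finset.mem_union,
      Finset.mem_insert, Finset.mem_singleton] at hc hr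
    · exact ⟨Signature.concept_of_subset (fun A h => hc A (.inl h)) fun P h => hr P (.inl h),
        Signature.concept_of_subset (fun A h => hc A (.inr h)) fun P h => hr P (.inr h)⟩
    · exact ⟨Signature.concept_of_subset (fun A h => hc A (.inl h)) fun P h => hr P (.inl h),
        Signature.concept_of_subset (fun A h => hc A (.inr h)) fun P h => hr P (.inr h)⟩
    · exact ⟨hr _ (.inl rfl), hr _ (.inr rfl)⟩
    · exact ⟨hr _ (.inl rfl), hr _ (.inr rfl)⟩
  · have hc : ∀ A ∈ κ.conceptNames, A ∈ (signatureOf T q).con := fun A hA =>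
      Finset.mem_union_right _ (Finset.mem_biUnion.2 ⟨κ, hκ, hA⟩)
    have hr : ∀ P ∈ κ.roleNames, P ∈ (signatureOf T q).rol := fun P hP =>
      Finset.mem_union_right _ (Finset.mem_biUnion.2 ⟨κ, hκ, hP⟩)
    cases κ with
    | concept B t => exact Signature.concept_of_subset hc hr
    | role P t₁ t₂ => exact hr P (Finset.mem_singleton_self P)

namespace LogSpace

variable {ι κ J : Type} {n : ℕ} {T : Finset FuzzyAxiom} {q : CQ n} {S : Signature}

/-! ## The degree of a given answer -/

theorem FF.out {F : List Letter → (ι → ℕ) → Fraction} (hF : FF F) :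
    OutP fun x v => encodeName (F x v).1 ++ Letter.sep :: encodeName (F x v).2 :=
  (hF.1.out.append ((LFO.letter .sep).append hF.2.out)).congr fun x v => by simp

theorem mem_encodeTuple {a : Fin n → IndName} {e : Letter} (h : e ∈ encodeTuple a) :
    e = .tupleTag ∨ ∃ b, e = .bit b := by
  simp only [encodeTuple, encodeName, List.mem_flatMap, List.mem_cons, List.mem_map] at h
  obtain ⟨w, -, h | ⟨b, -, h⟩⟩ := h
  · exact Or.inl h
  · exact Or.inr ⟨b, h.symm⟩

theorem codes_append_encodeTuple (L : List Assertion) (a : Fin n → IndName) :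
    Codes (encodeABox L ++ encodeTuple a) L := by
  refine codes_append L ?_ fun s => ?_
  · rw [encodeTuple]
    cases List.ofFn a <;> simp [IsBit]
  · rw [pred, List.head?_drop]
    rcases h : (encodeTuple a)[s]? with _ | e
    · rfl
    · rcases mem_encodeTuple (List.mem_of_getElem? h) with rfl | ⟨b, rfl⟩ <;> rfl

theorem codes_encodeABox (L : List Assertion) : Codes (encodeABox L) L := by
  have := codes_append L (z := []) (by simp [IsBit]) (by simp [pred])
  rwa [List.append_nil] at this

/-- Hence the first `tupleTag` of the input marks the end of the ABox. -/
theorem tupleTag_notMem_encodeABox (L : List Assertion) : Letter.tupleTag ∉ encodeABox L := by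
  intro h
  obtain ⟨α, -, h⟩ := List.mem_flatMap.1 h
  rcases α with ⟨A | (P | P), a, d⟩ | ⟨P, a, b, d⟩ <;>
  simp [encodeAssertion, encodeBasicConcept, encodeDegree, encodeName] at h

theorem word_iterate_skip_flatMap (l : List (List Bool)) (i : ℕ) (hi : i < l.length) :
    word (skip^[i] (l.flatMap fun w => Letter.tupleTag :: encodeName w).tail) = l[i] := by
  induction l generalizing i with
  | nil => simp at hi
  | cons w l ih =>
    rw [List.flatMap_cons, List.cons_append, List.tail_cons]
    rcases i with _ | i
    · rw [Function.iterate_zero, id, word_append, List.getElem_cons_zero]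
      cases l <;> simp [IsBit]
    · have hi' : i < l.length := by simpa using hi
      rw [Function.iterate_succ_apply, List.getElem_cons_succ, ← ih i hi']
      cases l with
      | nil => simp at hi'
      | cons w' l =>
        rw [List.flatMap_cons, List.cons_append, skip_append _ _ (by simp [IsBit]), List.tail_cons]

noncomputable def tupleStart (x : List Letter) : ℕ := find (fun p => x[p]? = some .tupleTag) x.length

/-- The components of the tuple at the end of the input. -/
noncomputable def tupleAt (x : List Letter) (i : ℕ) : List Bool :=
  word (skip^[i] (x.drop (tupleStart x)).tail)

theorem NF.tupleAt (i : ℕ) : NF (ι := ι) fun x _ => tupleAt x i :=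
  ((SF.drop (LF.find (φ := fun x _ p => x[p]? = some .tupleTag) LFO.length
    (LP.letterAt (LFO.var none) _))).tail.iterate_skip i).word

theorem tupleAt_append (L : List Assertion) (a : Fin n → IndName) (i : Fin n) :
    tupleAt (encodeABox L ++ encodeTuple a) i = a i := by
  have hn : 0 < n := i.pos
  have hs : tupleStart (encodeABox L ++ encodeTuple a) = (encodeABox L).length := by
    have h0 : (encodeTuple a)[0]? = some .tupleTag := by
      obtain ⟨m, rfl⟩ : ∃ m, n = m + 1 := ⟨n - 1, by omega⟩
      simp [encodeTuple]
    refine find_eq ?_ ?_ fun j hj h => ?_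
    · have := (List.getElem?_eq_some_iff.1 h0).1
      rw [List.length_append]
      omega
    · rw [List.getElem?_append_right le_rfl, Nat.sub_self, h0]
    · rw [List.getElem?_append_left hj] at h
      exact tupleTag_notMem_encodeABox L (List.mem_of_getElem? h)
  rw [tupleAt, hs, List.drop_left, encodeTuple, word_iterate_skip_flatMap _ _ (by simp)]
  simp

theorem _root_.Ontology.IsCutDegree.mem_answers {O : Ontology} (hO : O.Consistent) {a : Fin n → IndName}
    {r : Degree} (h : O.IsCutDegree q a r) : (a, toUnit r) ∈ q.answers O :=
  _root_.mem_answers hO h.1 h.2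

theorem exists_isDegreeAt (hS : S.Covers T q) {x : List Letter} {L : List Assertion}
    (hx : Codes x L) (hO : (Ontology.mk T L.toFinset).Consistent) (a : Fin n → IndName) :
    ∃ d < (tboxDegrees T).length + x.length, IsDegreeAt T q S x a d := by
  obtain ⟨r, hr, h⟩ := (Ontology.mk T L.toFinset).exists_isCutDegree q a
  obtain ⟨d, hd, e⟩ := exists_lt_degreeAt_eq hx hr
  exact ⟨d, hd, (isDegreeAt_iff hS hx hO e).2 h⟩

/-- The machine searches for an index of the right degree and prints the fraction found there. Its
digits are copied from the input or from a constant of the machine, so no reduction to lowest terms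
is required. -/
theorem solvable_degree (T : Finset FuzzyAxiom) (q : CQ n) :
    SolvableInLogSpace
      (X := List Assertion × (Fin n → IndName)) (Y := Degree)
      (fun x => encodeABox x.1 ++ encodeTuple x.2) encodeDegree
      (fun x => (Ontology.mk T x.1.toFinset).Consistent)
      (fun x d => (x.2, toUnit d) ∈ q.answers (Ontology.mk T x.1.toFinset)) := by
  have hS := signatureOf_covers T q
  have hd : LF (ι := Empty) fun x _ => find (IsDegreeAt T q (signatureOf T q) x fun i : Fin n =>
      tupleAt x i) ((tboxDegrees T).length + x.length) :=
    LF.find (φ := fun x _ d => IsDegreeAt T q (signatureOf T q) x (fun i : Fin n => tupleAt x i) d)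
      ((LF.const _).add LFO.length)
      (LP.isDegreeAt hS (N := fun i x _ => tupleAt x i) (fun i => NF.tupleAt i) (LFO.var none))
  obtain ⟨M, hM, hM'⟩ := LFO.exists_transducer (FF.degreeAt T hd).out
  refine ⟨M, hM, fun ⟨L, a⟩ hO => ?_⟩
  have hx := codes_append_encodeTuple L a
  have ha : (fun i : Fin n => tupleAt (encodeABox L ++ encodeTuple a) i) = a :=
    funext (tupleAt_append L a)
  have hM' := hM' (encodeABox L ++ encodeTuple a)
  rw [ha] at hM'
  obtain ⟨-, h⟩ := find_spec (exists_isDegreeAt hS hx hO a)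
  obtain ⟨r, -, e⟩ := exists_degreeAt_eq (T := T) hx
    (find (IsDegreeAt T q (signatureOf T q) (encodeABox L ++ encodeTuple a) a)
      ((tboxDegrees T).length + (encodeABox L ++ encodeTuple a).length))
  refine ⟨r, ((isDegreeAt_iff hS hx hO e).1 h).mem_answers hO, ?_⟩
  rw [e] at hM'
  exact hM'

end LogSpace

namespace LogSpace

variable {ι κ J : Type} {n : ℕ} {T : Finset FuzzyAxiom} {q : CQ n} {S : Signature}

/-! ## Pointers to individual names -/

/-- The individual names that occur in the query or in the input. -/
def Known (q : CQ n) (x : List Letter) (w : IndName) : Prop :=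
  w ∈ q.consts ∨ ∃ p ≤ x.length, w = word (x.drop p)

variable (q)

noncomputable def constList : List IndName := q.finite_consts.toFinset.toList

open Classical in
/-- An enumeration of the known names and of some new names. -/
noncomputable def nameAt (x : List Letter) (ν : ℕ) : IndName :=
  if ν < (constList q).length then (constList q).getD ν []
  else if ν - (constList q).length ≤ x.length then word (x.drop (ν - (constList q).length))
  else List.replicate (ν - (constList q).length + (constList q).flatten.length) true

theorem NF.nameAt {f : List Letter → (ι → ℕ) → ℕ} (hf : LF f) :
    NF fun x v => nameAt q x (f x v) := by
  have h := hf.sub (LF.const (constList q).length)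
  refine (NF.ite (LP.lt hf (LF.const (constList q).length)) (NF.getD (constList q) hf)
    (NF.ite (LP.le h LFO.length) (NF.word h)
      (NF.replicate (h.add (LF.const (constList q).flatten.length))))).congr fun x v => ?_
  simp only [LogSpace.nameAt]
  split_ifs <;> rfl

variable {q}

theorem exists_nameAt_eq {x : List Letter} {w : IndName} (hw : Known q x w) :
    ∃ ν < (constList q).length + x.length + 1, nameAt q x ν = w := by
  rcases hw with hw | ⟨p, hp, rfl⟩
  · have : w ∈ constList q := by simpa [constList] using hw
    obtain ⟨ν, hν, e⟩ := List.getElem_of_mem this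
    exact ⟨ν, by omega, by rw [nameAt, if_pos hν, List.getD_eq_getElem _ _ hν, e]⟩
  · refine ⟨(constList q).length + p, by omega, ?_⟩
    rw [nameAt, if_neg (by omega), Nat.add_sub_cancel_left, if_pos hp]

theorem nameAt_new (q : CQ n) (x : List Letter) (t : ℕ) :
    nameAt q x ((constList q).length + x.length + 1 + t) =
      List.replicate (x.length + 1 + t + (constList q).flatten.length) true := by
  rw [nameAt, if_neg (by omega), if_neg (by omega)]
  congr 1
  omega

/-- Of the new names only distinctness is used; it would do no harm if one of them were known. -/
theorem nameAt_new_injective (q : CQ n) (x : List Letter) : Function.Injective fun t =>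
    nameAt q x ((constList q).length + x.length + 1 + t) := by
  intro s t h
  simp only [nameAt_new] at h
  have := congrArg List.length h
  simp only [List.length_replicate] at this
  omega

theorem known_word {x y : List Letter} (h : y <:+ x) : Known q x (word y) := by
  obtain ⟨t, rfl⟩ := h
  exact Or.inr ⟨t.length, by simp, by rw [List.drop_left]⟩

theorem iterate_skip_suffix (y : List Letter) (i : ℕ) : skip^[i] y <:+ y := by
  induction i with
  | zero => exact List.suffix_rfl
  | succ i ih =>
    rw [Function.iterate_succ_apply']
    exact (List.drop_suffix _ _).trans ih

theorem known_field (x : List Letter) (s i : ℕ) : Known q x (field i (x.drop s)) :=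
  known_word ((iterate_skip_suffix _ _).trans ((List.tail_suffix _).trans (List.drop_suffix _ _)))

/-- Replacing unknown names does not decrease the degree. -/
theorem isCutDegree_map_le (hS : S.Covers T q) {x : List Letter} {L : List Assertion}
    (hx : Codes x L) {a : Fin n → IndName} {r r' : Degree} {f : IndName → IndName}
    (hf : ∀ w, Known q x w → f w = w)
    (hr : r ∈ (Ontology.mk T L.toFinset).degrees)
    (h : (Ontology.mk T L.toFinset).IsCutDegree q a r)
    (h' : (Ontology.mk T L.toFinset).IsCutDegree q (fun i => f (a i)) r') : r ≤ r' := by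
  by_contra hlt
  rw [not_le] at hlt
  have h0 : r ≠ 0 := (lt_of_le_of_lt (show 0 ≤ r' from r'.2.1) hlt).ne'
  -- The renaming fixes the constants of the query and all names in the ABox, so it maps the cut at
  -- `r` to itself and transports the entailment.
  refine h'.2 r hr hlt ((h.1.resolve_left h0).map f (S := S) (fun τ hτ => hS.tbox τ hτ.1) hS.query
    (fun κ hκ c hc => hf c (Or.inl ⟨κ, hκ, hc⟩)) subset_rfl ?_)
  rintro φ ⟨α, hα, hd, rfl⟩ -
  obtain ⟨s, -, ⟨k, -, hk⟩, -⟩ := hx.2 α (by simpa using hα)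
  refine ⟨α, hα, hd, ?_⟩
  rw [← hk, Pred.map_fact, hf _ (known_field x s 0), hf _ (known_field x s 1)]

/-! ## Top-`k` answers -/

/-- Greedy choice: a maximal element of the remainder is added in each round. -/
theorem exists_top {X Y : Type} [DecidableEq X] [LinearOrder Y] (P : Finset X) (ρ : X → Y) {ℓ : ℕ}
    (hℓ : ℓ ≤ P.card) : ∃ s ⊆ P, s.card = ℓ ∧ ∀ u ∈ P, u ∉ s → ∀ p ∈ s, ρ u ≤ ρ p := by
  induction ℓ with
  | zero => exact ⟨∅, by simp, rfl, by simp⟩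
  | succ ℓ ih =>
    obtain ⟨s, hs, hc, hm⟩ := ih (by omega)
    have hne : (P \ s).Nonempty := by
      rw [← Finset.card_pos, Finset.card_sdiff_of_subset hs]
      omega
    obtain ⟨m, h1, h2⟩ := Finset.exists_max_image (P \ s) ρ hne
    rw [Finset.mem_sdiff] at h1
    refine ⟨insert m s, Finset.insert_subset h1.1 hs, by rw [Finset.card_insert_of_notMem h1.2, hc],
      fun u hu hus p hp => ?_⟩
    rw [Finset.mem_insert, not_or] at hus
    rcases Finset.mem_insert.1 hp with rfl | hp
    · exact h2 u (Finset.mem_sdiff.2 ⟨hu, hus.2⟩)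
    · exact hm u hu hus.2 p hp

/-- The number of listed answers. -/
def listLength (n k : ℕ) : ℕ := if n = 0 then min k 1 else k

theorem listLength_le (n k : ℕ) : listLength n k ≤ k := by
  unfold listLength; split <;> omega

variable (T q)

/-- A bound for the pointers to names and degrees. -/
noncomputable def poolSize (k : ℕ) (x : List Letter) : ℕ :=
  ((constList q).length + (tboxDegrees T).length + k * n + 2) + x.length

variable (S)

/-- The pointers `w` describe a list of `ℓ` answers with the highest degrees. -/
def IsTopList (k ℓ : ℕ) (x : List Letter) (w : Fin ℓ × Fin n ⊕ Fin ℓ → ℕ) : Prop :=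
  ((∀ j j', j ≠ j' → ∃ i, nameAt q x (w (.inl (j, i))) ≠ nameAt q x (w (.inl (j', i)))) ∧
    ∀ j, IsDegreeAt T q S x (fun i => nameAt q x (w (.inl (j, i)))) (w (.inr j))) ∧
  ¬ ∃ u : Option (Fin n) → ℕ, (∀ i, u i < poolSize T q k x) ∧
    IsDegreeAt T q S x (fun i => nameAt q x (u (some i))) (u none) ∧
    (∀ j, ∃ i, nameAt q x (w (.inl (j, i))) ≠ nameAt q x (u (some i))) ∧
    ¬ ∀ j, (degreeAt T x (u none)).le (degreeAt T x (w (.inr j)))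

variable {T q S}

theorem LF.poolSize (k : ℕ) : LF (ι := ι) fun x _ => poolSize T q k x :=
  (LF.const _).add LFO.length

theorem LP.isTopList (hS : S.Covers T q) (k ℓ : ℕ) :
    LP fun x (w : Fin ℓ × Fin n ⊕ Fin ℓ → ℕ) => IsTopList T q S k ℓ x w := by
  have hN : ∀ p, NF fun x (w : Fin ℓ × Fin n ⊕ Fin ℓ → ℕ) => nameAt q x (w p) :=
    fun p => NF.nameAt q (LFO.var p)
  have hN1 : ∀ p, NF fun x (w : (Fin ℓ × Fin n ⊕ Fin ℓ) ⊕ Option (Fin n) → ℕ) =>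
    nameAt q x (w p) := fun p => NF.nameAt q (LFO.var p)
  refine ((LP.forall_fin fun j => LP.forall_fin fun j' => LP.imp (LP.const _)
    (LP.exists_fin fun i => ((hN _).eq (hN _)).not)).and
    (LP.forall_fin fun j => LP.isDegreeAt hS (fun i => hN _) (LFO.var _))).and (LP.not ?_)
  refine (LP.exVec (J := Option (Fin n)) (φ := fun x (w : Fin ℓ × Fin n ⊕ Fin ℓ → ℕ) u =>
    IsDegreeAt T q S x (fun i => nameAt q x (u (some i))) (u none) ∧
    (∀ j, ∃ i, nameAt q x (w (.inl (j, i))) ≠ nameAt q x (u (some i))) ∧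
    ¬ ∀ j, (degreeAt T x (u none)).le (degreeAt T x (w (.inr j)))) (LF.poolSize k) ?_).1
  refine (LP.isDegreeAt hS (fun i => hN1 _) (LFO.var _)).and
    ((LP.forall_fin fun j => LP.exists_fin fun i => ((hN1 _).eq (hN1 _)).not).and
      (LP.not (LP.forall_fin fun j => FF.le (FF.degreeAt T (LFO.var _)) (FF.degreeAt T (LFO.var _)))))

open Classical in
/-- All tuples of names with pointers. -/
noncomputable def pool (T : Finset FuzzyAxiom) (q : CQ n) (k : ℕ) (x : List Letter) :
    Finset (Fin n → IndName) :=
  Fintype.piFinset fun _ => (Finset.range (poolSize T q k x)).image (nameAt q x)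

theorem mem_pool {k : ℕ} {x : List Letter} {a : Fin n → IndName} :
    a ∈ pool T q k x ↔ ∀ i, ∃ ν < poolSize T q k x, nameAt q x ν = a i := by
  simp [pool]

/-- Without answer variables the empty tuple is the only one. Otherwise the constant tuples over the
first `k` new names are distinct members of the pool. -/
theorem listLength_le_card_pool (T : Finset FuzzyAxiom) (q : CQ n) (k : ℕ) (x : List Letter) :
    listLength n k ≤ (pool T q k x).card := by
  classical
  rcases Nat.eq_zero_or_pos n with rfl | hn
  · have : 0 < (pool T q k x).card := Finset.card_pos.2 ⟨fun i => i.elim0, mem_pool.2 fun i => i.elim0⟩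
    simp only [listLength, if_true]
    omega
  · have hk : k ≤ k * n := Nat.le_mul_of_pos_right k hn
    rw [listLength, if_neg hn.ne']
    have hinj : Function.Injective fun (t : ℕ) (_ : Fin n) =>
        nameAt q x ((constList q).length + x.length + 1 + t) :=
      fun s t h => nameAt_new_injective q x (congrFun h ⟨0, hn⟩)
    refine ((Finset.card_range k).symm.trans (Finset.card_image_of_injective _ hinj).symm).trans_le
      (Finset.card_le_card fun a ha => ?_)
    obtain ⟨t, ht, rfl⟩ := Finset.mem_image.1 ha
    rw [Finset.mem_range] at ht
    exact mem_pool.2 fun i => ⟨_, by unfold poolSize; omega, rfl⟩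

/-- The best tuples of the finite pool are taken, together with pointers to their names and degrees.
-/
theorem exists_isTopList (hS : S.Covers T q) {x : List Letter} {L : List Assertion}
    (hx : Codes x L) (hO : (Ontology.mk T L.toFinset).Consistent) (k : ℕ) :
    ∃ w, (∀ p, w p < poolSize T q k x) ∧ IsTopList T q S k (listLength n k) x w := by
  classical
  choose ρ hρ hρ' using fun a => (Ontology.mk T L.toFinset).exists_isCutDegree q a
  obtain ⟨s, hs, hc, hm⟩ := exists_top (pool T q k x) ρ (listLength_le_card_pool T q k x)
  let e := s.equivFinOfCardEq hc
  choose ν hν hν' using fun j i => mem_pool.1 (hs (e.symm j).2) i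
  choose d hd hd' using fun r : (Ontology.mk T L.toFinset).degrees => exists_lt_degreeAt_eq hx r.2
  have hdeg : ∀ a b, degreeAt T x b = fraction (ρ a) → IsDegreeAt T q S x a b :=
    fun a b h => (isDegreeAt_iff hS hx hO h).2 (hρ' a)
  refine ⟨Sum.elim (fun p => ν p.1 p.2) fun j => d ⟨ρ (e.symm j), hρ _⟩, ?_, ⟨⟨?_, ?_⟩, ?_⟩⟩
  · rintro (p | j)
    · exact hν _ _
    · refine (hd _).trans_le ?_
      unfold poolSize
      omega
  · intro j j' hj
    simp only [Sum.elim_inl, hν']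
    exact Function.ne_iff.1 fun h => hj (e.symm.injective (Subtype.ext h))
  · intro j
    simp only [Sum.elim_inl, Sum.elim_inr, hν']
    exact hdeg _ _ (hd' _)
  · rintro ⟨u, hu, h1, h2, h3⟩
    simp only [Sum.elim_inl, Sum.elim_inr, hν', hd'] at h2 h3
    obtain ⟨r, hr, hr'⟩ := exists_degreeAt_eq (T := T) hx (u none)
    have h4 := (isDegreeAt_iff hS hx hO hr').1 h1
    have h5 := toUnit_le.1 (answers_unique (h4.mem_answers hO) ((hρ' _).mem_answers hO)).le
    refine h3 fun j => ?_
    rw [hr', fraction_le]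
    refine h5.trans (hm _ (mem_pool.2 fun i => ⟨_, hu _, rfl⟩) (fun hmem => ?_) _ (e.symm j).2)
    obtain ⟨i, hi⟩ := h2 (e ⟨_, hmem⟩)
    simp at hi

/-- Optimality within the pool implies optimality among all tuples: if an unlisted tuple has unknown
names, all of them are sent to one new name that no listed tuple contains. The result lies in the
pool, is still unlisted, and has no smaller degree. -/
theorem exists_pool_le (hS : S.Covers T q) {x : List Letter} {L : List Assertion}
    (hx : Codes x L) {k : ℕ} {s : Finset (Fin n → IndName)} (hs : s.card ≤ k)
    {a : Fin n → IndName} (ha : a ∉ s) {r : Degree} (hr : r ∈ (Ontology.mk T L.toFinset).degrees)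
    (h : (Ontology.mk T L.toFinset).IsCutDegree q a r) :
    ∃ b ∈ pool T q k x, b ∉ s ∧ ∀ r', (Ontology.mk T L.toFinset).IsCutDegree q b r' → r ≤ r' := by
  classical
  by_cases hp : ∀ i, Known q x (a i)
  · refine ⟨a, mem_pool.2 fun i => ?_, ha, fun r' h' =>
      isCutDegree_map_le hS hx (f := id) (fun _ _ => rfl) hr h h'⟩
    obtain ⟨ν, hν, e⟩ := exists_nameAt_eq (hp i)
    exact ⟨ν, by unfold poolSize; omega, e⟩
  · push Not at hp
    obtain ⟨i₀, hi₀⟩ := hp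
    -- The listed tuples have at most `k * n` components altogether, so one of `k * n + 1` distinct
    -- new names is missing from them.
    obtain ⟨t, ht, htn⟩ : ∃ t < k * n + 1, ∀ b ∈ s, ∀ i,
        b i ≠ nameAt q x ((constList q).length + x.length + 1 + t) := by
      by_contra hcon
      push Not at hcon
      have hsub : (Finset.range (k * n + 1)).image (fun t =>
          nameAt q x ((constList q).length + x.length + 1 + t)) ⊆
          (s ×ˢ Finset.univ).image fun p : (Fin n → IndName) × Fin n => p.1 p.2 := by
        intro w hw
        obtain ⟨t, ht, rfl⟩ := Finset.mem_image.1 hw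
        obtain ⟨b, hb, i, e⟩ := hcon t (Finset.mem_range.1 ht)
        exact Finset.mem_image.2 ⟨(b, i), by simpa using hb, e⟩
      have h1 := Finset.card_le_card hsub
      rw [Finset.card_image_of_injective _ (nameAt_new_injective q x), Finset.card_range] at h1
      have h2 := h1.trans Finset.card_image_le
      rw [Finset.card_product, Finset.card_univ, Fintype.card_fin] at h2
      have := Nat.mul_le_mul_right n hs
      omega
    let f : IndName → IndName := fun w => if Known q x w then w else
      nameAt q x ((constList q).length + x.length + 1 + t)
    refine ⟨fun i => f (a i), mem_pool.2 fun i => ?_, fun hmem => htn _ hmem i₀ (if_neg hi₀),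
      fun r' h' => isCutDegree_map_le hS hx (f := f) (fun w hw => if_pos hw) hr h h'⟩
    by_cases hi : Known q x (a i)
    · obtain ⟨ν, hν, e⟩ := exists_nameAt_eq hi
      exact ⟨ν, by unfold poolSize; omega, by rw [e]; exact (if_pos hi).symm⟩
    · exact ⟨_, by unfold poolSize; omega, (if_neg hi).symm⟩

theorem isTopK_of_isTopList (hS : S.Covers T q) {x : List Letter} {L : List Assertion}
    (hx : Codes x L) (hO : (Ontology.mk T L.toFinset).Consistent) {k : ℕ}
    {w : Fin (listLength n k) × Fin n ⊕ Fin (listLength n k) → ℕ}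
    (h : IsTopList T q S k (listLength n k) x w) {r : Fin (listLength n k) → Degree}
    (hr : ∀ j, degreeAt T x (w (.inr j)) = fraction (r j)) :
    IsTopK q (Ontology.mk T L.toFinset) k
      (List.ofFn fun j => (fun i => nameAt q x (w (.inl (j, i))), r j)) := by
  classical
  obtain ⟨⟨h1, h2⟩, h3⟩ := h
  have hmem : ∀ j, ((fun i => nameAt q x (w (.inl (j, i)))), toUnit (r j)) ∈
      q.answers (Ontology.mk T L.toFinset) :=
    fun j => ((isDegreeAt_iff hS hx hO (hr j)).1 (h2 j)).mem_answers hO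
  have hfst : ∀ a : Fin n → IndName, a ∈ (List.ofFn fun j =>
      ((fun i => nameAt q x (w (.inl (j, i)))), r j)).map Prod.fst ↔
      ∃ j, (fun i => nameAt q x (w (.inl (j, i)))) = a := by
    intro a
    simp [List.map_ofFn, List.mem_ofFn, Function.comp_def]
  refine ⟨?_, ?_, ?_, ?_, ?_⟩
  · rw [List.map_ofFn, List.nodup_ofFn]
    intro j j' hj
    by_contra hne
    obtain ⟨i, hi⟩ := h1 j j' hne
    exact hi (congrFun hj i)
  · intro p hp
    obtain ⟨j, rfl⟩ := List.mem_ofFn.1 hp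
    exact hmem j
  · simpa using listLength_le n k
  · intro hlt a
    rw [List.length_ofFn] at hlt
    rw [hfst]
    unfold listLength at hlt
    split at hlt
    · subst n
      have : 0 < listLength 0 k := by simp [listLength]; omega
      exact ⟨⟨0, this⟩, Subsingleton.elim _ _⟩
    · omega
  · intro p hp c hc hc'
    obtain ⟨j, rfl⟩ := List.mem_ofFn.1 hp
    obtain ⟨r₁, hr₁, hcut⟩ := (Ontology.mk T L.toFinset).exists_isCutDegree q c.1
    -- An arbitrary unlisted answer is compared through a member `b` of the pool with at least its
    -- degree; pointers to `b` and to its degree would refute the last clause of `IsTopList`.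
    rw [answers_unique hc (hcut.mem_answers hO), toUnit_le]
    obtain ⟨b, hb, hbs, hle⟩ := exists_pool_le hS hx (k := k)
      (s := Finset.univ.image fun j => fun i => nameAt q x (w (.inl (j, i))))
      (Finset.card_image_le.trans (by simpa using listLength_le n k)) (a := c.1)
      (by
        rw [hfst] at hc'
        simpa using hc') hr₁ hcut
    obtain ⟨r₂, hr₂, hcut₂⟩ := (Ontology.mk T L.toFinset).exists_isCutDegree q b
    choose ν hν hν' using mem_pool.1 hb
    obtain ⟨d, hd, hd'⟩ := exists_lt_degreeAt_eq hx hr₂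
    refine (hle r₂ hcut₂).trans ?_
    by_contra hlt
    refine h3 ⟨fun o => o.elim d ν, ?_, ?_, ?_, ?_⟩
    · rintro (_ | i)
      · refine hd.trans_le ?_
        unfold poolSize
        omega
      · exact hν i
    · simp only [Option.elim, hν']
      exact (isDegreeAt_iff hS hx hO hd').2 hcut₂
    · intro j'
      simp only [Option.elim, hν']
      refine Function.ne_iff.1 fun he => hbs ?_
      exact Finset.mem_image.2 ⟨j', Finset.mem_univ _, he⟩
    · intro hall
      have := hall j
      rw [hr] at this
      exact hlt (fraction_le.1 (hd' ▸ this))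

theorem solvable_topK (T : Finset FuzzyAxiom) (q : CQ n) (k : ℕ) :
    SolvableInLogSpace
      (X := List Assertion) (Y := List ((Fin n → IndName) × Degree))
      encodeABox encodeAnswers
      (fun L => (Ontology.mk T L.toFinset).Consistent)
      (fun L l => IsTopK q (Ontology.mk T L.toFinset) k l) := by
  have hS := signatureOf_covers T q
  obtain ⟨-, g, hg, hg'⟩ := LP.exVec (ι := Empty)
    (φ := fun x _ w => IsTopList T q (signatureOf T q) k (listLength n k) x w) (LF.poolSize k)
    ((LP.isTopList hS k (listLength n k)).rename Sum.inr)
  have hout : OutP (ι := Empty) fun x v => (List.finRange (listLength n k)).flatMap fun j =>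
      ((List.finRange n).flatMap fun i =>
        [Letter.tupleTag] ++ encodeName (nameAt q x (g (.inl (j, i)) x v))) ++
      ([Letter.degreeTag] ++ (encodeName (degreeAt T x (g (.inr j) x v)).1 ++
        Letter.sep :: encodeName (degreeAt T x (g (.inr j) x v)).2)) :=
    OutP.flatMap _ fun j => (OutP.flatMap _ fun i =>
      (LFO.letter .tupleTag).append (NF.nameAt q (hg _)).out).append
      ((LFO.letter .degreeTag).append (FF.degreeAt T (hg _)).out)
  obtain ⟨M, hM, hM'⟩ := LFO.exists_transducer hout
  refine ⟨M, hM, fun L hO => ?_⟩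
  have hx := codes_encodeABox L
  have hM' := hM' (encodeABox L)
  obtain ⟨-, h⟩ := hg' (encodeABox L) Empty.elim (exists_isTopList hS hx hO k)
  choose r _ hr using fun j => exists_degreeAt_eq (T := T) hx
    (g (.inr j) (encodeABox L) Empty.elim)
  refine ⟨_, isTopK_of_isTopList hS hx hO h hr, ?_⟩
  convert hM' using 1
  simp only [hr, encodeAnswers, encodeTuple, List.ofFn_eq_map, List.flatMap_map, encodeDegree_eq]
  simp

end LogSpace

theorem mainTheorem8 (T : Finset FuzzyAxiom) {n : ℕ} (q : CQ n) :
    -- the degree of a given answer, for a fixed TBox and query; the input is the ABox and the tuple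
    SolvableInLogSpace
      (X := List Assertion × (Fin n → IndName)) (Y := Degree)
      (fun x => encodeABox x.1 ++ encodeTuple x.2) encodeDegree
      (fun x => (Ontology.mk T x.1.toFinset).Consistent)
      (fun x d => (x.2, toUnit d) ∈ q.answers (Ontology.mk T x.1.toFinset)) ∧
    -- the iterative method over decreasing cuts returns that degree
    (∀ (A : Finset Assertion) (a : Fin n → IndName), (Ontology.mk T A).Consistent →
      (a, toUnit (iterativeDegree (Ontology.mk T A) q a)) ∈ q.answers (Ontology.mk T A)) ∧
    -- top-k answers, for a fixed TBox, query and k; the input is the ABox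
    (∀ k : ℕ, SolvableInLogSpace
      (X := List Assertion) (Y := List ((Fin n → IndName) × Degree))
      encodeABox encodeAnswers
      (fun L => (Ontology.mk T L.toFinset).Consistent)
      (fun L l => IsTopK q (Ontology.mk T L.toFinset) k l)) :=
  ⟨LogSpace.solvable_degree T q, fun _ a hO => iterativeDegree_mem_answers hO q a,
    LogSpace.solvable_topK T q⟩
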